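/- **The model.** Let $H\in(0,1)$, $\lambda>0$, $\sigma\ne 0$, and write $\theta=(H,\lambda,\sigma)$. A stationary fractional Ornstein–Uhlenbeck (fOU) process with parameter $\theta$ is a process $(X_t)_{t\in\mathbb R}$ such that, for every $t\in\mathbb R$, almost surely $$X_t=\sigma\int_{-\infty}^t e^{-\lambda(t-u)}\,dB^H_u$$ (pathwise improper Riemann–Stieltjes integral), where $B^H$ is a two-sided fractional Brownian motion with Hurst parameter $H$. Let $$\rho_\theta(t)=2\sigma^2c_H\int_0^\infty\cos(tx)\frac{x^{1-2H}}{\lambda^2+x^2}\,dx,\qquad c_H=\frac{\Gamma(2H+1)\sin(\pi H)}{2\pi}.$$ **The estimator.** Let $L\ge 3$ and $\alpha>0$. A filter of length $L+1$ and order $l\ge1$ is a vector $\mathbf a=(a_0,\dots,a_L)\in\mathbb R^{L+1}$ with $\sum_{q}a_qq^r=0$ for $0\le r\le l-1$ and $\sum_q a_qq^l\neq0$. Put $b_0=\sum_{q=0}^L a_q^2$ and $b_k=2\sum_{j=0}^{L-k}a_{k+j}a_j$ for $1\le k\le L$. Given $L$ filters $\mathbf a_1,\dots,\mathbf a_L$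 of orders $l_1,\dots,l_L\ge1$, let $B$ be the $L\times(L+1)$ matrix whose rows are the corresponding vectors $\mathbf b_1',\dots,\mathbf b_L'$, and assume that $B$ has full rank, $\operatorname{rank}(B)=L$. For each $\ell$ let $$\varphi_\ell(t)=\sum_{q=0}^L a_{\ell,q}X_{t-\alpha q},\qquad V_\ell(\theta)=\sum_{k=0}^L b_{\ell,k}\,\rho_\theta(\alpha k).$$ For $N\ge L$ and $t_i=\alpha i$ let $\hat{\mathbf g}_N(\theta)\in\mathbb R^L$ have the entries $\frac1{N-L+1}\sum_{i=L}^N\big(\varphi_\ell(t_i)^2-V_\ell(\theta)\big)$. For a symmetric positive-definite $L\times L$ matrix $A$ let $\hat Q_N(\theta)=\hat{\mathbf g}_N(\theta)'A\,\hat{\mathbf g}_N(\theta)$. Given a set $\Theta$ of parameters, a GMM estimator is a sequence of random vectors $\hat\theta_N$ such that, for every $N\ge L$, almost surely $\hat\theta_N\in\operatorname{argmin}_{\vartheta\in\Theta}\hat Q_N(\vartheta)$. **Proposition 3.1.** Let $\Theta=[H_1,H_2]\times[\lambda_1,\lambda_2]\times[\sigma_1,\sigma_2]$ be a closed rectangle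 with $0<H_1$, $H_2<1$, $0<\lambda_1$, $\lambda_2<\exp(\Psi(3))$, where $\Psi(x)=\frac{d}{dx}\log\Gamma(x)$, and with $\sigma$ of known sign ($\sigma_1>0$ or $\sigma_2<0$). Then there is $\alpha_0>0$, depending only on $\Theta$, such that for every step size $0<\alpha<\alpha_0$, every $L\ge3$, all filters as above, every symmetric positive-definite matrix $A$, every $\theta\in\Theta$, every stationary fOU process $X$ with parameter $\theta$, and every GMM estimator $\hat\theta_N$ over $\Theta$: 1. $E\|\hat\theta_N-\theta\|^2<\infty$ for every $N\ge L$, and $E\big[\|\hat\theta_N-\theta\|^2\big]=O(N^{-1})$ as $N\to\infty$; 2. for every $\gamma<\tfrac12$, $N^{\gamma}\|\hat\theta_N-\theta\|\to0$ almost surely as $N\to\infty$. -/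

import Mathlib

open MeasureTheory ProbabilityTheory Filter Topology

namespace FOU

noncomputable section

/-! ### The stationary fractional Ornstein-Uhlenbeck process -/

/-- A two-sided fractional Brownian motion with Hurst parameter `H`: a centered Gaussian process
indexed by the real line, with almost surely continuous paths and covariance
`(|s|^(2H) + |t|^(2H) - |t - s|^(2H)) / 2`. -/
structure IsFractionalBrownianMotion {Ω : Type*} [MeasurableSpace Ω] (μ : Measure Ω)
    (H : ℝ) (B : ℝ → Ω → ℝ) : Prop where
  gaussian : IsGaussianProcess B μ
  centered : ∀ t, ∫ ω, B t ω ∂μ = 0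
  covariance : ∀ s t, cov[B s, B t; μ] =
    (|s| ^ (2 * H) + |t| ^ (2 * H) - |t - s| ^ (2 * H)) / 2
  continuous : ∀ᵐ ω ∂μ, Continuous fun t => B t ω

/-- `I` is the Riemann-Stieltjes integral of `f` with respect to `g` over `[a, b]`: the tagged sums
`∑ f(ξᵢ) (g(xᵢ₊₁) - g(xᵢ))` over the partitions `a = x₀ ≤ x₁ ≤ ⋯ ≤ xₙ = b` with tags
`ξᵢ ∈ [xᵢ, xᵢ₊₁]` converge to `I` as the mesh tends to zero. -/
def HasRiemannStieltjesIntegral (f g : ℝ → ℝ) (a b I : ℝ) : Prop :=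
  ∀ ε > 0, ∃ δ > 0, ∀ (n : ℕ) (x ξ : ℕ → ℝ), x 0 = a → x n = b →
    (∀ i < n, x i ≤ ξ i ∧ ξ i ≤ x (i + 1) ∧ x (i + 1) - x i < δ) →
    |∑ i ∈ Finset.range n, f (ξ i) * (g (x (i + 1)) - g (x i)) - I| < ε

/-- `I` is the improper Riemann-Stieltjes integral of `f` with respect to `g` over `(-∞, t]`. -/
def HasImproperRiemannStieltjesIntegral (f g : ℝ → ℝ) (t I : ℝ) : Prop :=
  ∃ J : ℝ → ℝ, (∀ a ≤ t, HasRiemannStieltjesIntegral f g a t (J a)) ∧ Tendsto J atBot (𝓝 I)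

/-- The parameters `θ = (H, lam, σ)`, with the Euclidean norm. -/
abbrev Param : Type := EuclideanSpace ℝ (Fin 3)

/-- `X` is a stationary fractional Ornstein-Uhlenbeck process with parameters
`θ = (θ 0, θ 1, θ 2) = (H, lam, σ)`: there is a fractional Brownian motion `B` with Hurst
parameter `H` such that, for every `t`, almost surely
`X_t = σ ∫_{-∞}^t exp (-lam (t - u)) dB_u`, a pathwise Riemann-Stieltjes integral. -/
def IsStationaryFOU {Ω : Type*} [MeasurableSpace Ω] (μ : Measure Ω) (θ : Param)
    (X : ℝ → Ω → ℝ) : Prop :=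
  ∃ B : ℝ → Ω → ℝ, IsFractionalBrownianMotion μ (θ 0) B ∧
    ∀ t, ∀ᵐ ω ∂μ, ∃ I : ℝ,
      HasImproperRiemannStieltjesIntegral
        (fun u => Real.exp (-(θ 1) * (t - u))) (fun u => B u ω) t I ∧
      X t ω = θ 2 * I

/-- The constant `c_H = Γ(2H + 1) sin(πH) / (2π)`. -/
def cH (H : ℝ) : ℝ := Real.Gamma (2 * H + 1) * Real.sin (Real.pi * H) / (2 * Real.pi)

/-- The autocovariance function of the stationary fractional Ornstein-Uhlenbeck process,
`ρ_θ(t) = 2 σ² c_H ∫₀^∞ cos(tx) x^(1-2H) / (lam² + x²) dx`. -/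
def rho (θ : Param) (t : ℝ) : ℝ :=
  2 * θ 2 ^ 2 * cH (θ 0) *
    ∫ x in Set.Ioi (0 : ℝ), Real.cos (t * x) * (x ^ (1 - 2 * θ 0) / (θ 1 ^ 2 + x ^ 2))

/-- The closed rectangle with opposite corners `lo` and `hi` in the parameter space. -/
def rectangle (lo hi : Param) : Set Param := {θ | ∀ i, lo i ≤ θ i ∧ θ i ≤ hi i}

/-- The digamma function `Ψ(x) = d/dx log Γ(x)`. -/
def digamma (x : ℝ) : ℝ := deriv (fun y => Real.log (Real.Gamma y)) x

/-! ### Filters and the generalized method of moments -/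

/-- `a = (a_0, …, a_L)` is a filter of length `L + 1` and order `l`. -/
def IsFilter {L : ℕ} (a : Fin (L + 1) → ℝ) (l : ℕ) : Prop :=
  (0 < l → (∀ r < l, ∑ q, a q * ((q : ℕ) : ℝ) ^ r = 0) ∧ ∑ q, a q * ((q : ℕ) : ℝ) ^ l ≠ 0) ∧
  (l = 0 → a 0 = 1 ∧ ∀ q, q ≠ 0 → a q = 0)

/-- `b_0 = ∑_q a_q²` and `b_k = 2 ∑_j a_{k+j} a_j` for `k > 0`. -/
def filterB {L : ℕ} (a : Fin (L + 1) → ℝ) (k : Fin (L + 1)) : ℝ :=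
  (if k = 0 then 1 else 2) *
    ∑ i : Fin (L + 1), ∑ j : Fin (L + 1), if (i : ℕ) = k + j then a i * a j else 0

/-- The `L × (L + 1)` matrix whose rows are the vectors `b` of the filters `a_1, …, a_L`. -/
def matrixB {L : ℕ} (a : Fin L → Fin (L + 1) → ℝ) : Matrix (Fin L) (Fin (L + 1)) ℝ :=
  Matrix.of fun ℓ k => filterB (a ℓ) k

/-- `V(θ) = ∑_{k=0}^L b_k ρ_θ(α k)`. -/
def theoreticalVariance {L : ℕ} (a : Fin (L + 1) → ℝ) (α : ℝ) (θ : Param) : ℝ :=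
  ∑ k : Fin (L + 1), filterB a k * rho θ (α * (k : ℕ))

/-- The filtered process `φ(t) = ∑_{q=0}^L a_q X_{t - α q}`. -/
def filtered {Ω : Type*} {L : ℕ} (X : ℝ → Ω → ℝ) (a : Fin (L + 1) → ℝ) (α t : ℝ) (ω : Ω) : ℝ :=
  ∑ q : Fin (L + 1), a q * X (t - α * (q : ℕ)) ω

/-- The vector `ĝ_N(θ)`, whose entries are
`(N - L + 1)⁻¹ ∑_{i=L}^N (φ_ℓ(t_i)² - V_ℓ(θ))` with observation times `t_i = α i`. -/
def gHat {Ω : Type*} {L : ℕ} (X : ℝ → Ω → ℝ) (a : Fin L → Fin (L + 1) → ℝ) (α : ℝ) (N : ℕ)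
    (θ : Param) (ω : Ω) (ℓ : Fin L) : ℝ :=
  ((N : ℝ) - L + 1)⁻¹ *
    ∑ i ∈ Finset.Icc L N, (filtered X (a ℓ) α (α * i) ω ^ 2 - theoreticalVariance (a ℓ) α θ)

/-- The objective function `Q̂_N(θ) = ĝ_N(θ)' A ĝ_N(θ)`. -/
def QHat {Ω : Type*} {L : ℕ} (X : ℝ → Ω → ℝ) (a : Fin L → Fin (L + 1) → ℝ) (α : ℝ)
    (A : Matrix (Fin L) (Fin L) ℝ) (N : ℕ) (θ : Param) (ω : Ω) : ℝ :=
  gHat X a α N θ ω ⬝ᵥ A.mulVec (gHat X a α N θ ω)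

/-- `θhat` is a GMM estimator over the parameter set `Θ`: for every sample size `N ≥ L`, `θhat N`
is a random vector that almost surely minimizes `Q̂_N` over `Θ`. -/
def IsGMMEstimator {Ω : Type*} [MeasurableSpace Ω] (μ : Measure Ω) {L : ℕ} (X : ℝ → Ω → ℝ)
    (a : Fin L → Fin (L + 1) → ℝ) (α : ℝ) (A : Matrix (Fin L) (Fin L) ℝ) (Θ : Set Param)
    (θhat : ℕ → Ω → Param) : Prop :=
  ∀ N ≥ L, AEMeasurable (θhat N) μ ∧
    ∀ᵐ ω ∂μ, θhat N ω ∈ Θ ∧ ∀ θ ∈ Θ, QHat X a α A N (θhat N ω) ω ≤ QHat X a α A N θ ω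

end

end FOU

/-! The argument splits into a deterministic inverse problem and a limit theorem for quadratic
functionals of a Gaussian process.

Reduction. The sample term cancels in `ĝ_N(θ') - ĝ_N(θ) = V(θ) - V(θ')`. Suppose `V` has a Lipschitz
inverse on the rectangle. The estimator minimizes a positive definite form of `ĝ_N`, so
`‖ĝ_N(θhat)‖` is at most a constant times `‖ĝ_N(θ)‖`, and hence `‖θhat - θ‖ ≤ K ‖ĝ_N(θ)‖` almost
surely (`IsGMMEstimator.exists_norm_sub_le`). Both claims then concern `ĝ_N` at the true parameter
only.

Identification (`exists_norm_sub_le_variogram`). The variogram is `ρ(0) - ρ(t) = (σ²/2) t^(2H) (1 -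
defect)`, with a defect that is uniformly small for small `t`. Its logarithm is nearly affine in
`log σ²` and `H`, while a change of `lam` enters to first order through `p t^(2-2H)`, where `|p|` is
comparable to the change. At the lags `α, 2α, 3α` this is a perturbation of the linear system with
rows `(1, log k, k^β)`, `β = 2 - 2H`. Its determinant is nonzero by strict convexity of `exp`,
uniformly over the compact range of `β`. Filters of order at least one have zero sum, so constants
lie in the kernel of `B`; full rank makes them the whole kernel, and the moments control the
variogram at all lags (`exists_norm_le_mul_norm_of_rank`).

Fluctuations. Linear combinations of `X` are limits of Riemann-Stieltjes sums, hence Gaussian with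
covariance `ρ` (`IsStationaryFOU.hasLaw_sum`). The squares of a filtered process have covariance `2
R(t)²`. The zero sum turns `R` into a combination of second differences of `ρ`, so that `R(t) =
O(1/|t|)` for every `H` in `(0,1)` (`abs_rho_second_difference_le`). Thus `R²` is summable along the
lags, and sums of `n` centered squares have second moment `O(n)`
(`IsStationaryFOU.integral_sum_sq_le`). This is the mean square rate; a dyadic maximal inequality
upgrades it to the almost sure rate (`ae_tendsto_rpow_mul_sum`). -/

namespace FOU

/-! ### Spectral integrals and the variance of fractional Brownian motion -/

/-- The dominating function for the spectral integrals. -/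
noncomputable def spectralBound (H x : ℝ) : ℝ := min 1 (x ^ 2) * x ^ (-1 - 2 * H)

theorem spectralBound_nonneg (H : ℝ) {x : ℝ} (hx : 0 < x) : 0 ≤ spectralBound H x := by
  unfold spectralBound; positivity

theorem integrableOn_Ioi_of_rpow_bounds {f : ℝ → ℝ} {C p q : ℝ} (hp : -1 < p) (hq : q < -1)
    (hf : AEStronglyMeasurable f (volume.restrict (Set.Ioi 0)))
    (h0 : ∀ x, 0 < x → x ≤ 1 → |f x| ≤ C * x ^ p) (h1 : ∀ x, 1 < x → |f x| ≤ C * x ^ q) :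
    IntegrableOn f (Set.Ioi 0) := by
  rw [← Set.Ioc_union_Ioi_eq_Ioi zero_le_one]
  refine IntegrableOn.union ?_ ?_
  · have hint : IntegrableOn (fun x : ℝ => C * x ^ p) (Set.Ioc 0 1) := by
      rw [← intervalIntegrable_iff_integrableOn_Ioc_of_le zero_le_one]
      exact (intervalIntegral.intervalIntegrable_rpow' hp).const_mul C
    refine Integrable.mono' hint (hf.mono_set Set.Ioc_subset_Ioi_self) ?_
    exact ae_restrict_of_forall_mem measurableSet_Ioc fun x hx => h0 x hx.1 hx.2
  · refine Integrable.mono' ((integrableOn_Ioi_rpow_of_lt hq zero_lt_one).const_mul C)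
      (hf.mono_set (Set.Ioi_subset_Ioi zero_le_one)) ?_
    exact ae_restrict_of_forall_mem measurableSet_Ioi fun x hx => h1 x hx

theorem integrableOn_spectralBound {H : ℝ} (hH0 : 0 < H) (hH1 : H < 1) :
    IntegrableOn (spectralBound H) (Set.Ioi 0) := by
  have hm : Measurable (spectralBound H) := by unfold spectralBound; fun_prop
  refine integrableOn_Ioi_of_rpow_bounds (C := 1) (p := 1 - 2 * H) (q := -1 - 2 * H)
    (by linarith) (by linarith) hm.aestronglyMeasurable ?_ ?_
  · intro x hx _
    rw [abs_of_nonneg (spectralBound_nonneg H hx), one_mul, spectralBound,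
      show (1 - 2 * H) = 2 + (-1 - 2 * H) by ring, Real.rpow_add hx]
    gcongr
    rw [Real.rpow_two]
    exact min_le_right _ _
  · intro x hx
    have hx0 : 0 < x := by linarith
    rw [abs_of_nonneg (spectralBound_nonneg H hx0), spectralBound]
    gcongr
    exact min_le_left _ _

theorem integrableOn_of_le_spectralBound {H C : ℝ} (hH0 : 0 < H) (hH1 : H < 1) {E : Type*}
    [NormedAddCommGroup E] {f : ℝ → E}
    (hf : AEStronglyMeasurable f (volume.restrict (Set.Ioi 0)))
    (h : ∀ x, 0 < x → ‖f x‖ ≤ C * spectralBound H x) : IntegrableOn f (Set.Ioi 0) :=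
  Integrable.mono' ((integrableOn_spectralBound hH0 hH1).const_mul C) hf
    (ae_restrict_of_forall_mem measurableSet_Ioi fun x hx => h x hx)

theorem one_sub_cos_le_two_mul_min (y : ℝ) : 1 - Real.cos y ≤ 2 * min 1 (y ^ 2) := by
  have h1 := Real.neg_one_le_cos y
  have h2 := Real.one_sub_sq_div_two_le_cos (x := y)
  rcases le_total 1 (y ^ 2) with h | h
  · rw [min_eq_left h]; linarith
  · rw [min_eq_right h]; nlinarith [sq_nonneg y]

theorem min_one_mul_le (a b : ℝ) (hb : 0 ≤ b) : min 1 (a * b) ≤ max 1 a * min 1 b := by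
  rcases le_total 1 b with h | h
  · rw [min_eq_left h, mul_one]; exact (min_le_left _ _).trans (le_max_left _ _)
  · rw [min_eq_right h]
    exact (min_le_right _ _).trans (mul_le_mul_of_nonneg_right (le_max_right _ _) hb)

theorem one_sub_cos_mul_rpow_le (H t : ℝ) {x : ℝ} (hx : 0 < x) :
    ‖(1 - Real.cos (t * x)) * x ^ (-1 - 2 * H)‖ ≤ 2 * max 1 (t ^ 2) * spectralBound H x := by
  have h1 := Real.cos_le_one (t * x)
  rw [Real.norm_of_nonneg (mul_nonneg (by linarith) (by positivity)), spectralBound, ← mul_assoc]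
  gcongr
  refine (one_sub_cos_le_two_mul_min _).trans ?_
  rw [mul_assoc, mul_pow]
  gcongr
  exact min_one_mul_le _ _ (by positivity)

theorem integrableOn_one_sub_cos {H : ℝ} (hH0 : 0 < H) (hH1 : H < 1) (t : ℝ) :
    IntegrableOn (fun x : ℝ => (1 - Real.cos (t * x)) * x ^ (-1 - 2 * H)) (Set.Ioi 0) :=
  integrableOn_of_le_spectralBound hH0 hH1
    (Measurable.aestronglyMeasurable (by fun_prop)) fun _ hx => one_sub_cos_mul_rpow_le H t hx

theorem integrableOn_rpow_div_one_add_sq {H : ℝ} (hH0 : 0 < H) (hH1 : H < 1) :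
    IntegrableOn (fun y : ℝ => y ^ (2 * H - 1) * (1 / (1 + y ^ 2))) (Set.Ioi 0) := by
  refine integrableOn_Ioi_of_rpow_bounds (C := 1) (p := 2 * H - 1) (q := 2 * H - 3)
    (by linarith) (by linarith) (Measurable.aestronglyMeasurable (by fun_prop)) ?_ ?_
  · intro x hx _
    rw [abs_of_nonneg (by positivity), one_mul]
    refine mul_le_of_le_one_right (by positivity) ?_
    rw [div_le_one (by positivity)]
    nlinarith [sq_nonneg x]
  · intro x hx
    have hx0 : 0 < x := by linarith
    rw [abs_of_nonneg (by positivity), one_mul, show 2 * H - 3 = (2 * H - 1) - 2 by ring,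
      Real.rpow_sub hx0 (2 * H - 1) 2, Real.rpow_two, div_eq_mul_one_div (x ^ (2 * H - 1))]
    gcongr
    linarith

/-- Replace `1 / (1 + y²)` by `∫ exp (-(1 + y²) z) dz` and swap the integrals: the integral over `y`
is `Γ(H) / 2 · z^(-H) e^(-z)`, the one over `z` gives `Γ(1 - H)`, and the reflection formula
finishes. -/
theorem integral_rpow_div_one_add_sq {H : ℝ} (hH0 : 0 < H) (hH1 : H < 1) :
    ∫ y in Set.Ioi (0 : ℝ), y ^ (2 * H - 1) * (1 / (1 + y ^ 2)) =
      Real.pi / (2 * Real.sin (Real.pi * H)) := by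
  have hinner : ∀ y : ℝ, ∫ z in Set.Ioi (0 : ℝ), Real.exp (-(1 + y ^ 2) * z) = 1 / (1 + y ^ 2) := by
    intro y
    have hy : -(1 + y ^ 2) < 0 := by nlinarith [sq_nonneg y]
    rw [integral_exp_mul_Ioi hy 0, neg_div_neg_eq]
    simp
  have hmeas : AEStronglyMeasurable
      (Function.uncurry fun y z : ℝ => y ^ (2 * H - 1) * Real.exp (-(1 + y ^ 2) * z))
      ((volume.restrict (Set.Ioi (0 : ℝ))).prod (volume.restrict (Set.Ioi (0 : ℝ)))) := by
    refine Measurable.aestronglyMeasurable ?_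
    unfold Function.uncurry
    fun_prop
  have hint : Integrable
      (Function.uncurry fun y z : ℝ => y ^ (2 * H - 1) * Real.exp (-(1 + y ^ 2) * z))
      ((volume.restrict (Set.Ioi (0 : ℝ))).prod (volume.restrict (Set.Ioi (0 : ℝ)))) := by
    rw [integrable_prod_iff hmeas]
    constructor
    · refine Eventually.of_forall fun y => ?_
      have hy : -(1 + y ^ 2) < 0 := by nlinarith [sq_nonneg y]
      exact (integrableOn_exp_mul_Ioi hy 0).const_mul (y ^ (2 * H - 1))
    · refine (integrableOn_rpow_div_one_add_sq hH0 hH1).congr_fun ?_ measurableSet_Ioi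
      intro y hy
      have hy' : (0 : ℝ) < y := hy
      simp only [Function.uncurry]
      rw [← hinner y, ← integral_const_mul]
      refine integral_congr_ae (Eventually.of_forall fun z => ?_)
      simp only
      rw [Real.norm_of_nonneg (by positivity)]
  have hswap := integral_integral_swap hint
  have hleft : ∫ y in Set.Ioi (0 : ℝ), y ^ (2 * H - 1) * (1 / (1 + y ^ 2)) =
      ∫ y in Set.Ioi (0 : ℝ), ∫ z in Set.Ioi (0 : ℝ),
        y ^ (2 * H - 1) * Real.exp (-(1 + y ^ 2) * z) := by
    refine integral_congr_ae (Eventually.of_forall fun y => ?_)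
    simp only
    rw [integral_const_mul, hinner]
  rw [hleft, hswap]
  have hright : ∀ z ∈ Set.Ioi (0 : ℝ), ∫ y in Set.Ioi (0 : ℝ),
      y ^ (2 * H - 1) * Real.exp (-(1 + y ^ 2) * z) =
      (Real.Gamma H / 2) * (Real.exp (-z) * z ^ ((1 - H) - 1)) := by
    intro z hz
    have hz' : (0 : ℝ) < z := hz
    have h := integral_rpow_mul_exp_neg_mul_rpow (p := 2) (q := 2 * H - 1) (b := z)
      (by norm_num) (by linarith) hz'
    have e : ∀ y : ℝ, y ^ (2 * H - 1) * Real.exp (-(1 + y ^ 2) * z) =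
        Real.exp (-z) * (y ^ (2 * H - 1) * Real.exp (-z * y ^ (2 : ℝ))) := by
      intro y
      rw [Real.rpow_two, mul_left_comm, ← Real.exp_add]
      ring_nf
    simp_rw [e]
    rw [integral_const_mul, h]
    rw [show -(2 * H - 1 + 1) / 2 = (1 - H) - 1 by ring, show (2 * H - 1 + 1) / 2 = H by ring]
    ring
  rw [setIntegral_congr_fun measurableSet_Ioi hright, integral_const_mul,
    ← Real.Gamma_eq_integral (by linarith)]
  have hG := Real.Gamma_mul_Gamma_one_sub H
  have : Real.Gamma H / 2 * Real.Gamma (1 - H) = (Real.Gamma H * Real.Gamma (1 - H)) / 2 := by ring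
  rw [this, hG, div_div, mul_comm 2]

theorem integral_one_sub_cos_mul_exp {y : ℝ} (hy : 0 < y) :
    ∫ x in Set.Ioi (0 : ℝ), (1 - Real.cos x) * Real.exp (-y * x) = 1 / (y * (1 + y ^ 2)) := by
  have hI1 : IntegrableOn (fun x : ℝ => Real.exp (-y * x)) (Set.Ioi 0) :=
    integrableOn_exp_mul_Ioi (by linarith) 0
  have ha : ((-y : ℝ) + Complex.I : ℂ).re < 0 := by simpa using hy
  have hI2 := integrableOn_exp_mul_complex_Ioi ha 0
  have h2 := integral_exp_mul_complex_Ioi ha 0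
  have hre : ∀ x : ℝ, (Complex.exp (((-y : ℝ) + Complex.I) * x)).re =
      Real.cos x * Real.exp (-y * x) := by
    intro x
    rw [Complex.exp_re]
    simp [mul_comm]
  have hI3 : IntegrableOn (fun x : ℝ => Real.cos x * Real.exp (-y * x)) (Set.Ioi 0) := by
    have := hI2.re
    simp only [RCLike.re_to_complex, hre] at this
    exact this
  have h3 : ∫ x in Set.Ioi (0 : ℝ), Real.cos x * Real.exp (-y * x) = y / (1 + y ^ 2) := by
    have h4 := integral_re hI2
    simp only [RCLike.re_to_complex, hre] at h4
    rw [h4, h2]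
    have hne : ((-y : ℝ) + Complex.I : ℂ) ≠ 0 := by
      intro h; rw [h] at ha; simp at ha
    simp [Complex.div_re, Complex.normSq_apply, -Complex.ofReal_neg]
    field_simp
    ring
  have hs : ∀ x : ℝ, (1 - Real.cos x) * Real.exp (-y * x) =
      Real.exp (-y * x) - Real.cos x * Real.exp (-y * x) := fun x => by ring
  simp_rw [hs]
  rw [integral_sub hI1 hI3, h3, integral_exp_mul_Ioi (by linarith) 0]
  simp
  field_simp
  ring

/-- Write `Γ(2H + 1) x^(-1-2H)` as the Laplace integral of `y^(2H)` and swap: the inner integral of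
`1 - cos` against an exponential is rational in `y`, which leaves `integral_rpow_div_one_add_sq`. -/
theorem integral_one_sub_cos {H : ℝ} (hH0 : 0 < H) (hH1 : H < 1) :
    ∫ x in Set.Ioi (0 : ℝ), (1 - Real.cos x) * x ^ (-1 - 2 * H) =
      Real.pi / (2 * Real.Gamma (2 * H + 1) * Real.sin (Real.pi * H)) := by
  have hGpos : 0 < Real.Gamma (2 * H + 1) := Real.Gamma_pos_of_pos (by linarith)
  have hinner : ∀ x ∈ Set.Ioi (0 : ℝ), ∫ y in Set.Ioi (0 : ℝ),
      y ^ (2 * H) * Real.exp (-(x * y)) = x ^ (-1 - 2 * H) * Real.Gamma (2 * H + 1) := by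
    intro x hx
    have hx' : (0 : ℝ) < x := hx
    have h := Real.integral_rpow_mul_exp_neg_mul_Ioi (a := 2 * H + 1) (by linarith) hx'
    rw [show 2 * H + 1 - 1 = 2 * H by ring] at h
    rw [h, one_div, Real.inv_rpow hx'.le, ← Real.rpow_neg hx'.le,
      show -(2 * H + 1) = -1 - 2 * H by ring]
  -- A function that is not integrable has integral `0` by convention, so the positive value in
  -- `hinner` already forces integrability.
  have hinnerI : ∀ x ∈ Set.Ioi (0 : ℝ), IntegrableOn (fun y : ℝ =>
      y ^ (2 * H) * Real.exp (-(x * y))) (Set.Ioi 0) := by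
    intro x hx
    by_contra hcon
    have h0 := hinner x hx
    rw [integral_undef hcon] at h0
    have : (0 : ℝ) < x ^ (-1 - 2 * H) * Real.Gamma (2 * H + 1) :=
      mul_pos (Real.rpow_pos_of_pos hx _) hGpos
    linarith
  have hmeas : AEStronglyMeasurable
      (Function.uncurry fun x y : ℝ => (1 - Real.cos x) * (y ^ (2 * H) * Real.exp (-(x * y))))
      ((volume.restrict (Set.Ioi (0 : ℝ))).prod (volume.restrict (Set.Ioi (0 : ℝ)))) := by
    refine Measurable.aestronglyMeasurable ?_
    unfold Function.uncurry
    fun_prop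
  have hbase : IntegrableOn (fun x : ℝ => (1 - Real.cos x) * x ^ (-1 - 2 * H)) (Set.Ioi 0) := by
    simpa using integrableOn_one_sub_cos hH0 hH1 1
  have hint : Integrable
      (Function.uncurry fun x y : ℝ => (1 - Real.cos x) * (y ^ (2 * H) * Real.exp (-(x * y))))
      ((volume.restrict (Set.Ioi (0 : ℝ))).prod (volume.restrict (Set.Ioi (0 : ℝ)))) := by
    rw [integrable_prod_iff hmeas]
    constructor
    · exact ae_restrict_of_forall_mem measurableSet_Ioi fun x hx =>
        (hinnerI x hx).const_mul (1 - Real.cos x)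
    · refine IntegrableOn.congr_fun (hbase.mul_const (Real.Gamma (2 * H + 1))) ?_ measurableSet_Ioi
      intro x hx
      simp only [Function.uncurry]
      rw [mul_assoc, ← hinner x hx, ← integral_const_mul]
      refine setIntegral_congr_fun measurableSet_Ioi fun y hy => ?_
      have hy' : (0 : ℝ) < y := hy
      have := Real.cos_le_one x
      rw [Real.norm_of_nonneg (mul_nonneg (by linarith) (by positivity))]
  have hswap := integral_integral_swap hint
  have hleft : ∫ x in Set.Ioi (0 : ℝ), ∫ y in Set.Ioi (0 : ℝ),
      (1 - Real.cos x) * (y ^ (2 * H) * Real.exp (-(x * y))) =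
      (∫ x in Set.Ioi (0 : ℝ), (1 - Real.cos x) * x ^ (-1 - 2 * H)) * Real.Gamma (2 * H + 1) := by
    rw [← integral_mul_const]
    refine setIntegral_congr_fun measurableSet_Ioi fun x hx => ?_
    rw [integral_const_mul, hinner x hx, mul_assoc]
  have hright : ∫ y in Set.Ioi (0 : ℝ), ∫ x in Set.Ioi (0 : ℝ),
      (1 - Real.cos x) * (y ^ (2 * H) * Real.exp (-(x * y))) =
      ∫ y in Set.Ioi (0 : ℝ), y ^ (2 * H - 1) * (1 / (1 + y ^ 2)) := by
    refine setIntegral_congr_fun measurableSet_Ioi fun y hy => ?_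
    have hy' : (0 : ℝ) < y := hy
    have e : ∀ x : ℝ, (1 - Real.cos x) * (y ^ (2 * H) * Real.exp (-(x * y))) =
        y ^ (2 * H) * ((1 - Real.cos x) * Real.exp (-y * x)) := by
      intro x
      rw [show -(x * y) = -y * x by ring]
      ring
    simp_rw [e]
    rw [integral_const_mul, integral_one_sub_cos_mul_exp hy', Real.rpow_sub_one hy'.ne']
    field_simp
  rw [hleft, hright, integral_rpow_div_one_add_sq hH0 hH1] at hswap
  rw [← eq_div_iff hGpos.ne'] at hswap
  rw [hswap]
  field_simp

theorem sin_pi_mul_pos {H : ℝ} (hH0 : 0 < H) (hH1 : H < 1) : 0 < Real.sin (Real.pi * H) :=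
  Real.sin_pos_of_pos_of_lt_pi (by positivity) (by nlinarith [Real.pi_pos])

theorem cH_pos {H : ℝ} (hH0 : 0 < H) (hH1 : H < 1) : 0 < cH H := by
  have h1 := sin_pi_mul_pos hH0 hH1
  have h2 : 0 < Real.Gamma (2 * H + 1) := Real.Gamma_pos_of_pos (by linarith)
  unfold cH
  positivity

/-- The spectral representation of the variance of fractional Brownian motion. -/
theorem abs_rpow_eq_integral {H : ℝ} (hH0 : 0 < H) (hH1 : H < 1) (t : ℝ) :
    |t| ^ (2 * H) =
      4 * cH H * ∫ x in Set.Ioi (0 : ℝ), (1 - Real.cos (t * x)) * x ^ (-1 - 2 * H) := by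
  have hsin := sin_pi_mul_pos hH0 hH1
  have hG : 0 < Real.Gamma (2 * H + 1) := Real.Gamma_pos_of_pos (by linarith)
  rcases eq_or_ne t 0 with rfl | ht
  · simp [Real.zero_rpow (by linarith : 2 * H ≠ 0)]
  have ht' : 0 < |t| := abs_pos.mpr ht
  have h := integral_comp_mul_left_Ioi
    (fun x : ℝ => (1 - Real.cos x) * x ^ (-1 - 2 * H)) 0 ht'
  rw [mul_zero, integral_one_sub_cos hH0 hH1] at h
  have e : ∀ x ∈ Set.Ioi (0 : ℝ), (1 - Real.cos (|t| * x)) * (|t| * x) ^ (-1 - 2 * H) =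
      |t| ^ (-1 - 2 * H) * ((1 - Real.cos (t * x)) * x ^ (-1 - 2 * H)) := by
    intro x hx
    have hx' : (0 : ℝ) < x := hx
    rw [Real.mul_rpow ht'.le hx'.le]
    have : Real.cos (|t| * x) = Real.cos (t * x) := by
      rw [← abs_of_pos hx', ← abs_mul, Real.cos_abs, abs_of_pos hx']
    rw [this]
    ring
  rw [setIntegral_congr_fun measurableSet_Ioi e, integral_const_mul, smul_eq_mul] at h
  have hp : |t| ^ (-1 - 2 * H) = |t|⁻¹ * (|t| ^ (2 * H))⁻¹ := by
    rw [show -1 - 2 * H = -1 + -(2 * H) by ring, Real.rpow_add ht', Real.rpow_neg_one,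
      Real.rpow_neg ht'.le]
  have hpos : 0 < |t| ^ (2 * H) := Real.rpow_pos_of_pos ht' _
  rw [hp, mul_assoc, mul_right_inj' (by positivity), inv_mul_eq_iff_eq_mul₀ hpos.ne'] at h
  rw [h, cH]
  have hsin' := hsin.ne'
  generalize Real.sin (Real.pi * H) = s at hsin'
  field_simp
  norm_num

/-! ### Gaussian limits and increments of fractional Brownian motion -/

/-- Characteristic functions pass to the limit by dominated convergence on one side and by
convergence of the variances on the other. Measurability of the limit is part of the conclusion, so
pathwise chosen integrals need no measurability of their own. -/
theorem hasLaw_gaussianReal_of_tendsto_ae {Ω : Type*} [MeasurableSpace Ω] {μ : Measure Ω}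
    [IsProbabilityMeasure μ] {Z : ℕ → Ω → ℝ} {Y : Ω → ℝ} {v : ℕ → ℝ} {w : ℝ}
    (hZ : ∀ n, HasLaw (Z n) (gaussianReal 0 (v n).toNNReal) μ) (hv : Tendsto v atTop (𝓝 w))
    (h : ∀ᵐ ω ∂μ, Tendsto (fun n => Z n ω) atTop (𝓝 (Y ω))) :
    HasLaw Y (gaussianReal 0 w.toNNReal) μ := by
  have hY : AEMeasurable Y μ := aemeasurable_of_tendsto_metrizable_ae' (fun n => (hZ n).aemeasurable) h
  refine ⟨hY, ?_⟩
  have : IsProbabilityMeasure (μ.map Y) := Measure.isProbabilityMeasure_map hY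
  refine Measure.ext_of_charFun ?_
  funext t
  have hchar : ∀ {X : Ω → ℝ}, AEMeasurable X μ →
      charFun (μ.map X) t = ∫ ω, Complex.exp (t * X ω * Complex.I) ∂μ := by
    intro X hX
    rw [charFun_apply_real, integral_map hX]
    exact Measurable.aestronglyMeasurable (by fun_prop)
  have h1 : Tendsto (fun n => charFun (μ.map (Z n)) t) atTop (𝓝 (charFun (μ.map Y) t)) := by
    simp_rw [fun n => hchar (hZ n).aemeasurable]
    rw [hchar hY]
    refine tendsto_integral_of_dominated_convergence (fun _ => 1) ?_ (integrable_const 1) ?_ ?_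
    · intro n
      have := (hZ n).aemeasurable
      exact AEMeasurable.aestronglyMeasurable (by fun_prop)
    · intro n
      refine Eventually.of_forall fun ω => ?_
      rw [← Complex.ofReal_mul, Complex.norm_exp_ofReal_mul_I]
    · filter_upwards [h] with ω hω
      have hc : Continuous fun y : ℝ => Complex.exp (t * y * Complex.I) := by fun_prop
      exact (hc.tendsto (Y ω)).comp hω
  have h2 : Tendsto (fun n => charFun (μ.map (Z n)) t) atTop
      (𝓝 (charFun (gaussianReal 0 w.toNNReal) t)) := by
    simp_rw [fun n => (hZ n).map_eq, charFun_gaussianReal]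
    have hc : Continuous fun u : ℝ =>
        Complex.exp (t * (0 : ℝ) * Complex.I - (u.toNNReal : ℝ) * t ^ 2 / 2) := by
      have : Continuous fun u : ℝ => ((u.toNNReal : ℝ) : ℂ) := by
        exact Complex.continuous_ofReal.comp (NNReal.continuous_coe.comp continuous_real_toNNReal)
      fun_prop
    exact (hc.tendsto w).comp hv
  exact tendsto_nhds_unique h1 h2

/-- The increment of `p ↦ exp (i p x)` between `q` and `p`. -/
noncomputable def expIncrement (p q x : ℝ) : ℂ :=
  Complex.exp ((p * x : ℝ) * Complex.I) - Complex.exp ((q * x : ℝ) * Complex.I)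

theorem continuous_expIncrement (p q : ℝ) : Continuous (expIncrement p q) := by
  unfold expIncrement; fun_prop

/-- The grouping into `1 - cos` matters: each such term is separately integrable against `x^(-1-2H)`
near the origin, so the four terms match the four powers in the covariance of two increments. -/
theorem re_expIncrement_mul_conj (p q p' q' x : ℝ) :
    (expIncrement p q x * (starRingEnd ℂ) (expIncrement p' q' x)).re =
      (1 - Real.cos ((p - q') * x)) + (1 - Real.cos ((q - p') * x))
        - (1 - Real.cos ((p - p') * x)) - (1 - Real.cos ((q - q') * x)) := by
  simp only [expIncrement, sub_mul, Real.cos_sub, Complex.mul_re, Complex.conj_re, Complex.conj_im,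
    Complex.sub_re, Complex.sub_im, Complex.exp_ofReal_mul_I_re, Complex.exp_ofReal_mul_I_im]
  ring

section FractionalIncrements

variable {Ω : Type*} [MeasurableSpace Ω] {μ : Measure Ω} {H : ℝ} {B : ℝ → Ω → ℝ}

theorem IsFractionalBrownianMotion.memLp_two (hB : IsFractionalBrownianMotion μ H B) (t : ℝ) :
    MemLp (B t) 2 μ :=
  (hB.gaussian.hasGaussianLaw_eval t).memLp_two

theorem IsFractionalBrownianMotion.covariance_increments [IsProbabilityMeasure μ]
    (hB : IsFractionalBrownianMotion μ H B) (hH0 : 0 < H) (hH1 : H < 1) (p q p' q' : ℝ) :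
    cov[fun ω => B p ω - B q ω, fun ω => B p' ω - B q' ω; μ] =
      2 * cH H * ∫ x in Set.Ioi (0 : ℝ),
        (expIncrement p q x * (starRingEnd ℂ) (expIncrement p' q' x)).re * x ^ (-1 - 2 * H) := by
  rw [covariance_fun_sub_fun_sub (hB.memLp_two p) (hB.memLp_two q) (hB.memLp_two p')
    (hB.memLp_two q')]
  simp only [hB.covariance]
  have hI := fun t => integrableOn_one_sub_cos hH0 hH1 t
  set g : ℝ → ℝ → ℝ := fun t x => (1 - Real.cos (t * x)) * x ^ (-1 - 2 * H) with hg
  have e : (fun x : ℝ =>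
      (expIncrement p q x * (starRingEnd ℂ) (expIncrement p' q' x)).re * x ^ (-1 - 2 * H)) =
      g (p - q') + g (q - p') - g (p - p') - g (q - q') := by
    funext x
    rw [re_expIncrement_mul_conj]
    simp only [hg, Pi.add_apply, Pi.sub_apply]
    ring
  rw [e, integral_sub' (((hI _).add (hI _)).sub (hI _)) (hI _),
    integral_sub' ((hI _).add (hI _)) (hI _), integral_add' (hI _) (hI _)]
  have h := fun t => abs_rpow_eq_integral hH0 hH1 t
  rw [abs_sub_comm p' p, abs_sub_comm q' p, abs_sub_comm p' q, abs_sub_comm q' q,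
    h (p - p'), h (p - q'), h (q - p'), h (q - q')]
  ring

theorem norm_expIncrement_le (p q x : ℝ) : ‖expIncrement p q x‖ ≤ |p - q| * |x| := by
  have h : expIncrement p q x =
      Complex.exp ((q * x : ℝ) * Complex.I) * (Complex.exp (Complex.I * ((p - q) * x : ℝ)) - 1) := by
    unfold expIncrement
    rw [mul_sub, ← Complex.exp_add, mul_one]
    congr 2
    push_cast
    ring
  rw [h, norm_mul, Complex.norm_exp_ofReal_mul_I, one_mul, ← abs_mul]
  exact Real.norm_exp_I_mul_ofReal_sub_one_le

/-- A uniform bound controls high frequencies and a linear bound controls low ones. Together they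
give the integrable majorant behind the passages to the limit in the spectral domain. -/
theorem norm_sq_mul_rpow_le_spectralBound {z : ℂ} {C x : ℝ} (hx : 0 < x) (H : ℝ)
    (h1 : ‖z‖ ≤ C) (h2 : ‖z‖ ≤ C * x) :
    ‖‖z‖ ^ 2 * x ^ (-1 - 2 * H)‖ ≤ C ^ 2 * spectralBound H x := by
  rw [Real.norm_of_nonneg (by positivity), spectralBound, ← mul_assoc]
  gcongr
  have h1' : ‖z‖ ^ 2 ≤ C ^ 2 := by gcongr
  have h2' : ‖z‖ ^ 2 ≤ (C * x) ^ 2 := by gcongr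
  rcases le_total 1 (x ^ 2) with h | h
  · rw [min_eq_left h]; linarith
  · rw [min_eq_right h]; linarith [mul_pow C x 2]

theorem integrableOn_re_expIncrement (hH0 : 0 < H) (hH1 : H < 1) (p q p' q' : ℝ) :
    IntegrableOn (fun x : ℝ =>
      (expIncrement p q x * (starRingEnd ℂ) (expIncrement p' q' x)).re * x ^ (-1 - 2 * H))
      (Set.Ioi 0) := by
  have hI := fun t => integrableOn_one_sub_cos hH0 hH1 t
  refine IntegrableOn.congr_fun ((((hI (p - q')).add (hI (q - p'))).sub
    (hI (p - p'))).sub (hI (q - q'))) ?_ measurableSet_Ioi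
  intro x _
  simp only [re_expIncrement_mul_conj, Pi.add_apply, Pi.sub_apply]
  ring

theorem normSq_sum_eq_sum_sum_re {κ : Type*} (s : Finset κ) (w : κ → ℝ) (z : κ → ℂ) :
    ‖∑ k ∈ s, (w k : ℂ) * z k‖ ^ 2 =
      ∑ k ∈ s, ∑ j ∈ s, w k * w j * (z k * (starRingEnd ℂ) (z j)).re := by
  have h : ((‖∑ k ∈ s, (w k : ℂ) * z k‖ ^ 2 : ℝ) : ℂ) =
      (∑ k ∈ s, (w k : ℂ) * z k) * (starRingEnd ℂ) (∑ k ∈ s, (w k : ℂ) * z k) := by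
    rw [Complex.mul_conj, Complex.normSq_eq_norm_sq]
  have h' := congrArg Complex.re h
  rw [Complex.ofReal_re] at h'
  rw [h', map_sum, Finset.sum_mul_sum, Complex.re_sum]
  refine Finset.sum_congr rfl fun k _ => ?_
  rw [Complex.re_sum]
  refine Finset.sum_congr rfl fun j _ => ?_
  rw [map_mul, Complex.conj_ofReal, mul_mul_mul_comm, ← Complex.ofReal_mul, Complex.re_ofReal_mul]

/-- Linear combinations of increments of fractional Brownian motion are centered Gaussian, with
variance given by the spectral representation. -/
theorem IsFractionalBrownianMotion.hasLaw_sum_increments [IsProbabilityMeasure μ]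
    (hB : IsFractionalBrownianMotion μ H B) (hH0 : 0 < H) (hH1 : H < 1) {κ : Type*}
    (s : Finset κ) (w p q : κ → ℝ) :
    HasLaw (fun ω => ∑ k ∈ s, w k * (B (p k) ω - B (q k) ω))
      (gaussianReal 0 (2 * cH H * ∫ x in Set.Ioi (0 : ℝ),
        ‖∑ k ∈ s, (w k : ℂ) * expIncrement (p k) (q k) x‖ ^ 2 * x ^ (-1 - 2 * H)).toNNReal) μ := by
  classical
  have hG : IsGaussianProcess (fun k ω => w k * (B (p k) ω - B (q k) ω)) μ := by
    refine hB.gaussian.of_isGaussianProcess fun k => ⟨{p k, q k},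
      w k • (ContinuousLinearMap.proj ⟨p k, by simp⟩ - ContinuousLinearMap.proj ⟨q k, by simp⟩), ?_⟩
    intro ω
    simp [Finset.restrict_def]
  have hZ : HasGaussianLaw (fun ω => ∑ k ∈ s, w k * (B (p k) ω - B (q k) ω)) μ :=
    hG.hasGaussianLaw_fun_sum
  have hmem : ∀ k, MemLp (fun ω => B (p k) ω - B (q k) ω) 2 μ := fun k =>
    (hB.memLp_two _).sub (hB.memLp_two _)
  have hint := fun t => (hB.memLp_two t).integrable (by norm_num)
  refine ⟨hZ.aemeasurable, ?_⟩
  rw [hZ.map_eq_gaussianReal]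
  congr 2
  · rw [integral_finsetSum]
    · refine Finset.sum_eq_zero fun k _ => ?_
      rw [integral_const_mul, integral_sub (hint _) (hint _), hB.centered, hB.centered]
      simp
    · exact fun k _ => ((hint _).sub (hint _)).const_mul _
  · rw [← covariance_self hZ.aemeasurable,
      covariance_fun_sum_fun_sum' (fun k _ => (hmem k).const_mul _) (fun k _ => (hmem k).const_mul _)]
    simp_rw [covariance_const_mul_left, covariance_const_mul_right,
      hB.covariance_increments hH0 hH1, normSq_sum_eq_sum_sum_re, Finset.sum_mul]
    have hI := fun k j => integrableOn_re_expIncrement hH0 hH1 (p k) (q k) (p j) (q j)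
    rw [integral_finsetSum, Finset.mul_sum]
    · refine Finset.sum_congr rfl fun k _ => ?_
      rw [integral_finsetSum, Finset.mul_sum]
      · refine Finset.sum_congr rfl fun j _ => ?_
        simp_rw [mul_assoc (w k * w j)]
        rw [integral_const_mul]
        ring
      · intro j _
        simp_rw [mul_assoc (w k * w j)]
        exact (hI k j).const_mul _
    · intro k _
      refine integrable_finsetSum _ fun j _ => ?_
      simp_rw [mul_assoc (w k * w j)]
      exact (hI k j).const_mul _

end FractionalIncrements

/-! ### Riemann-Stieltjes sums and the law of the Ornstein-Uhlenbeck process -/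

/-- The points of the uniform partition of `[a, t]` into `n + 1` pieces. -/
noncomputable def partitionPoint (a t : ℝ) (n i : ℕ) : ℝ := a + i * ((t - a) / (n + 1))

theorem partitionPoint_zero (a t : ℝ) (n : ℕ) : partitionPoint a t n 0 = a := by
  simp [partitionPoint]

theorem partitionPoint_last (a t : ℝ) (n : ℕ) : partitionPoint a t n (n + 1) = t := by
  have : (n : ℝ) + 1 ≠ 0 := by positivity
  simp only [partitionPoint]
  push_cast
  field_simp
  ring

theorem partitionPoint_succ_sub (a t : ℝ) (n i : ℕ) :
    partitionPoint a t n (i + 1) - partitionPoint a t n i = (t - a) / (n + 1) := by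
  simp only [partitionPoint]
  push_cast
  ring

theorem partitionPoint_mono {a t : ℝ} (h : a ≤ t) (n : ℕ) : Monotone (partitionPoint a t n) := by
  refine monotone_nat_of_le_succ fun i => ?_
  have := partitionPoint_succ_sub a t n i
  have : 0 ≤ (t - a) / ((n : ℝ) + 1) := div_nonneg (by linarith) (by positivity)
  linarith

/-- The Riemann-Stieltjes sum of `u ↦ exp (-lam (t - u))` with respect to `u ↦ exp (i u x)`. -/
noncomputable def expRiemannSum (lam a t : ℝ) (n : ℕ) (x : ℝ) : ℂ :=
  ∑ i ∈ Finset.range (n + 1), (Real.exp (-lam * (t - partitionPoint a t n i)) : ℂ) *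
    expIncrement (partitionPoint a t n (i + 1)) (partitionPoint a t n i) x

theorem continuous_expRiemannSum (lam a t : ℝ) (n : ℕ) : Continuous (expRiemannSum lam a t n) := by
  unfold expRiemannSum
  have := fun i => continuous_expIncrement
    (partitionPoint a t n (i + 1)) (partitionPoint a t n i)
  fun_prop

/-- Summation by parts, arranged for induction: after subtracting the boundary term `f n * z n`,
each step adds only `-(f (n + 1) - f n) z (n + 1)`, and these weights telescope. -/
theorem norm_sum_mul_sub_sub_le {f : ℕ → ℝ} {z : ℕ → ℂ} (hf : Monotone f) (hf0 : 0 ≤ f 0)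
    (hz : ∀ i, ‖z i‖ ≤ 1) (n : ℕ) :
    ‖∑ i ∈ Finset.range n, (f i : ℂ) * (z (i + 1) - z i) - f n * z n‖ ≤ f n := by
  induction n with
  | zero =>
    simp only [Finset.range_zero, Finset.sum_empty, zero_sub, norm_neg, norm_mul, Complex.norm_real]
    rw [Real.norm_of_nonneg hf0]
    exact mul_le_of_le_one_right hf0 (hz 0)
  | succ n ih =>
    have h1 : f n ≤ f (n + 1) := hf n.le_succ
    have e : ∑ i ∈ Finset.range (n + 1), (f i : ℂ) * (z (i + 1) - z i) - f (n + 1) * z (n + 1) =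
        (∑ i ∈ Finset.range n, (f i : ℂ) * (z (i + 1) - z i) - f n * z n)
          - ((f (n + 1) - f n : ℝ) : ℂ) * z (n + 1) := by
      rw [Finset.sum_range_succ]; push_cast; ring
    rw [e]
    refine (norm_sub_le _ _).trans ?_
    rw [norm_mul, Complex.norm_real, Real.norm_of_nonneg (by linarith)]
    have := mul_le_of_le_one_right (by linarith : 0 ≤ f (n + 1) - f n) (hz (n + 1))
    linarith

/-- The weight at the right endpoint is `1`, so summation by parts and the boundary term contribute
at most `1` each. Adding the sizes of the increments instead would grow with `x`. -/
theorem norm_expRiemannSum_le_two {lam a t : ℝ} (hl : 0 < lam) (hat : a ≤ t) (n : ℕ) (x : ℝ) :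
    ‖expRiemannSum lam a t n x‖ ≤ 2 := by
  have hm : Monotone fun i => Real.exp (-lam * (t - partitionPoint a t n i)) := by
    intro i j hij
    have := partitionPoint_mono hat n hij
    simp only [Real.exp_le_exp]
    nlinarith
  have h := norm_sum_mul_sub_sub_le hm (Real.exp_pos _).le
    (z := fun i => Complex.exp ((partitionPoint a t n i * x : ℝ) * Complex.I))
    (fun i => (Complex.norm_exp_ofReal_mul_I _).le) (n + 1)
  simp only [partitionPoint_last, sub_self, mul_zero, Real.exp_zero, Complex.ofReal_one,
    one_mul] at h
  have h2 := norm_le_norm_sub_add (expRiemannSum lam a t n x)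
    (Complex.exp ((t * x : ℝ) * Complex.I))
  rw [Complex.norm_exp_ofReal_mul_I] at h2
  unfold expRiemannSum expIncrement at *
  linarith

theorem norm_expRiemannSum_le {lam a t : ℝ} (hl : 0 < lam) (hat : a ≤ t) (n : ℕ) {x : ℝ}
    (hx : 0 < x) : ‖expRiemannSum lam a t n x‖ ≤ (t - a) * x := by
  unfold expRiemannSum
  refine (norm_sum_le _ _).trans ?_
  have h : ∀ i ∈ Finset.range (n + 1), ‖(Real.exp (-lam * (t - partitionPoint a t n i)) : ℂ) *
      expIncrement (partitionPoint a t n (i + 1)) (partitionPoint a t n i) x‖ ≤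
      (t - a) / (n + 1) * x := by
    intro i hi
    have hit : partitionPoint a t n i ≤ t := by
      have := partitionPoint_mono hat n (Finset.mem_range.mp hi).le
      rwa [partitionPoint_last] at this
    have hnn : 0 ≤ (t - a) / ((n : ℝ) + 1) := div_nonneg (by linarith) (by positivity)
    have h1 := norm_expIncrement_le (partitionPoint a t n (i + 1)) (partitionPoint a t n i) x
    rw [partitionPoint_succ_sub, abs_of_nonneg hnn, abs_of_pos hx] at h1
    rw [norm_mul, Complex.norm_real, Real.norm_of_nonneg (Real.exp_pos _).le]
    have h2 : Real.exp (-lam * (t - partitionPoint a t n i)) ≤ 1 := by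
      rw [Real.exp_le_one_iff]; nlinarith
    exact (mul_le_of_le_one_left (norm_nonneg _) h2).trans h1
  refine (Finset.sum_le_card_nsmul _ _ _ h).trans (le_of_eq ?_)
  rw [Finset.card_range, nsmul_eq_mul]
  have : (n : ℝ) + 1 ≠ 0 := by positivity
  push_cast
  field_simp

theorem tendsto_exp_mul_sub_one_div (c : ℂ) :
    Tendsto (fun h : ℝ => (Complex.exp (c * h) - 1) / h) (𝓝[≠] 0) (𝓝 c) := by
  have h1 : HasDerivAt (fun h : ℝ => Complex.exp (c * h)) c 0 := by
    have h2 : HasDerivAt (fun h : ℂ => Complex.exp (c * h)) (Complex.exp (c * (0 : ℝ)) * c)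
        ((0 : ℝ) : ℂ) := by
      have := ((hasDerivAt_id ((0 : ℝ) : ℂ)).const_mul c).cexp
      simpa using this
    simpa using h2.comp_ofReal
  have h3 := hasDerivAt_iff_tendsto_slope_zero.mp h1
  refine h3.congr fun h => ?_
  simp [div_eq_inv_mul]

/-- On a uniform partition the sum is geometric with ratio `exp ((lam + i x) h)`. As the mesh `h`
vanishes, the remaining quotient tends to the transfer function `i x / (lam + i x)`. -/
theorem expRiemannSum_eq {lam a t : ℝ} (hl : 0 < lam) (hat : a < t) (n : ℕ) (x : ℝ) :
    expRiemannSum lam a t n x =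
      (Complex.exp ((t * x : ℝ) * Complex.I) -
        Real.exp (-lam * (t - a)) * Complex.exp ((a * x : ℝ) * Complex.I)) *
      ((Complex.exp (x * Complex.I * ((t - a) / (n + 1) : ℝ)) - 1) /
        (Complex.exp ((lam + x * Complex.I) * ((t - a) / (n + 1) : ℝ)) - 1)) := by
  set h : ℝ := (t - a) / (n + 1) with hh
  have hn : (0 : ℝ) < n + 1 := by positivity
  have hpos : 0 < h := div_pos (by linarith) hn
  have hnh : (n + 1) * h = t - a := by rw [hh]; field_simp
  set z : ℂ := Complex.exp ((lam + x * Complex.I) * (h : ℝ)) with hz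
  have hz1 : z ≠ 1 := by
    intro hcon
    have h1 : ‖z‖ = Real.exp (lam * h) := by rw [hz, Complex.norm_exp]; simp
    rw [hcon, norm_one] at h1
    have : 1 < Real.exp (lam * h) := by rw [Real.one_lt_exp_iff]; positivity
    linarith
  have hterm : ∀ i ∈ Finset.range (n + 1),
      (Real.exp (-lam * (t - partitionPoint a t n i)) : ℂ) *
        expIncrement (partitionPoint a t n (i + 1)) (partitionPoint a t n i) x =
      (Real.exp (-lam * (t - a)) * Complex.exp ((a * x : ℝ) * Complex.I) *
        (Complex.exp (x * Complex.I * (h : ℝ)) - 1)) * z ^ i := by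
    intro i _
    rw [hz, ← Complex.exp_nat_mul]
    simp only [expIncrement, partitionPoint, ← hh, Complex.ofReal_exp]
    have hl' : ∀ u v w : ℂ, u * (v - w) = u * v - u * w := mul_sub
    have hr' : ∀ u v w r : ℂ, u * v * (w - 1) * r = u * v * w * r - u * v * r := by intros; ring
    rw [hr', hl', ← Complex.exp_add, ← Complex.exp_add,
      ← Complex.exp_add, ← Complex.exp_add, ← Complex.exp_add, ← Complex.exp_add]
    congr 2 <;> (push_cast; ring)
  unfold expRiemannSum
  rw [Finset.sum_congr rfl hterm, ← Finset.mul_sum, geom_sum_eq hz1]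
  have hzn : z ^ (n + 1) = Complex.exp ((lam + x * Complex.I) * ((t - a : ℝ) : ℂ)) := by
    rw [hz, ← Complex.exp_nat_mul, ← hnh]
    congr 1
    push_cast
    ring
  have hkey : (Real.exp (-lam * (t - a)) * Complex.exp ((a * x : ℝ) * Complex.I)) *
      (z ^ (n + 1) - 1) = Complex.exp ((t * x : ℝ) * Complex.I) -
        Real.exp (-lam * (t - a)) * Complex.exp ((a * x : ℝ) * Complex.I) := by
    rw [hzn, mul_sub, mul_one, Complex.ofReal_exp, ← Complex.exp_add, ← Complex.exp_add]
    congr 2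
    push_cast
    ring
  rw [← hkey]
  ring

theorem tendsto_expRiemannSum {lam a t : ℝ} (hl : 0 < lam) (hat : a < t) (x : ℝ) :
    Tendsto (fun n => expRiemannSum lam a t n x) atTop
      (𝓝 ((Complex.exp ((t * x : ℝ) * Complex.I) -
        Real.exp (-lam * (t - a)) * Complex.exp ((a * x : ℝ) * Complex.I)) *
        (x * Complex.I / (lam + x * Complex.I)))) := by
  simp_rw [fun n => expRiemannSum_eq hl hat n x]
  refine Tendsto.const_mul _ ?_
  have hne : (lam + x * Complex.I : ℂ) ≠ 0 := by
    intro h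
    have := congrArg Complex.re h
    simp at this
    linarith
  have h0 : Tendsto (fun n : ℕ => (t - a) / ((n : ℝ) + 1)) atTop (𝓝[≠] 0) := by
    rw [tendsto_nhdsWithin_iff]
    constructor
    · have := (tendsto_one_div_add_atTop_nhds_zero_nat (𝕜 := ℝ)).const_mul (t - a)
      simpa [div_eq_mul_inv] using this
    · refine Eventually.of_forall fun n => ?_
      have : (0 : ℝ) < n + 1 := by positivity
      exact (div_pos (by linarith) this).ne'
  have h1 := ((tendsto_exp_mul_sub_one_div (x * Complex.I)).div
    (tendsto_exp_mul_sub_one_div (lam + x * Complex.I)) hne).comp h0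
  refine h1.congr fun n => ?_
  have hn : (0 : ℝ) < n + 1 := by positivity
  have hh : (((t - a) / ((n : ℝ) + 1) : ℝ) : ℂ) ≠ 0 := by
    rw [Complex.ofReal_ne_zero]
    exact (div_pos (by linarith) hn).ne'
  simp only [Function.comp, Pi.div_apply]
  rw [div_div_div_cancel_right₀ hh]

theorem norm_mul_I_div (lam x : ℝ) :
    ‖(x * Complex.I / (lam + x * Complex.I) : ℂ)‖ ^ 2 = x ^ 2 / (lam ^ 2 + x ^ 2) := by
  rw [norm_div, div_pow, ← Complex.normSq_eq_norm_sq, ← Complex.normSq_eq_norm_sq,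
    Complex.normSq_apply, Complex.normSq_apply]
  simp [sq]

/-- The constant `1 + lam⁻¹` exceeds both natural bounds `1` and `lam⁻¹`, so that one constant fits
the two hypotheses of `norm_sq_mul_rpow_le_spectralBound`. -/
theorem norm_mul_I_div_le {lam : ℝ} (hl : 0 < lam) {x : ℝ} (hx : 0 < x) :
    ‖(x * Complex.I / (lam + x * Complex.I) : ℂ)‖ ≤ 1 + lam⁻¹ ∧
    ‖(x * Complex.I / (lam + x * Complex.I) : ℂ)‖ ≤ (1 + lam⁻¹) * x := by
  have h := norm_mul_I_div lam x
  have hl' : 0 < lam⁻¹ := by positivity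
  constructor
  · have : ‖(x * Complex.I / (lam + x * Complex.I) : ℂ)‖ ≤ 1 := by
      rw [← abs_of_nonneg (norm_nonneg (x * Complex.I / (lam + x * Complex.I) : ℂ)),
        ← sq_le_one_iff_abs_le_one, h, div_le_one (by positivity)]
      nlinarith
    linarith
  · have : ‖(x * Complex.I / (lam + x * Complex.I) : ℂ)‖ ≤ lam⁻¹ * x := by
      refine le_of_sq_le_sq ?_ (by positivity)
      rw [h, div_le_iff₀ (by positivity)]
      have : (lam⁻¹ * x) ^ 2 * lam ^ 2 = x ^ 2 := by field_simp
      nlinarith [sq_nonneg (lam⁻¹ * x * x)]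
    nlinarith

theorem tendsto_integral_norm_sq_mul_rpow {H C : ℝ} (hH0 : 0 < H) (hH1 : H < 1)
    {g : ℕ → ℝ → ℂ} {g' : ℝ → ℂ} (hg : ∀ n, Measurable (g n))
    (h1 : ∀ n, ∀ x > 0, ‖g n x‖ ≤ C) (h2 : ∀ n, ∀ x > 0, ‖g n x‖ ≤ C * x)
    (h : ∀ x > 0, Tendsto (fun n => g n x) atTop (𝓝 (g' x))) :
    Tendsto (fun n => ∫ x in Set.Ioi (0 : ℝ), ‖g n x‖ ^ 2 * x ^ (-1 - 2 * H)) atTop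
      (𝓝 (∫ x in Set.Ioi (0 : ℝ), ‖g' x‖ ^ 2 * x ^ (-1 - 2 * H))) := by
  refine tendsto_integral_of_dominated_convergence (fun x => C ^ 2 * spectralBound H x) ?_
    ((integrableOn_spectralBound hH0 hH1).const_mul _) ?_ ?_
  · intro n
    have := hg n
    exact Measurable.aestronglyMeasurable (by fun_prop)
  · intro n
    exact ae_restrict_of_forall_mem measurableSet_Ioi fun x hx =>
      norm_sq_mul_rpow_le_spectralBound hx H (h1 n x hx) (h2 n x hx)
  · exact ae_restrict_of_forall_mem measurableSet_Ioi fun x hx =>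
      ((h x hx).norm.pow 2).mul_const _

theorem norm_sum_ofReal_mul_le {ι : Type*} (s : Finset ι) (c : ι → ℝ) (z : ι → ℂ) {D : ℝ}
    (h : ∀ j ∈ s, ‖z j‖ ≤ D) : ‖∑ j ∈ s, (c j : ℂ) * z j‖ ≤ (∑ j ∈ s, |c j|) * D := by
  refine (norm_sum_le _ _).trans ?_
  rw [Finset.sum_mul]
  refine Finset.sum_le_sum fun j hj => ?_
  rw [norm_mul, Complex.norm_real, Real.norm_eq_abs]
  exact mul_le_mul_of_nonneg_left (h j hj) (abs_nonneg _)

theorem integrableOn_rho_integrand {H lam : ℝ} (hH0 : 0 < H) (hH1 : H < 1) (hl : 0 < lam) (t : ℝ) :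
    IntegrableOn (fun x : ℝ => Real.cos (t * x) * (x ^ (1 - 2 * H) / (lam ^ 2 + x ^ 2)))
      (Set.Ioi 0) := by
  refine integrableOn_of_le_spectralBound (C := (1 + lam⁻¹) ^ 2) hH0 hH1
    (Measurable.aestronglyMeasurable (by fun_prop)) fun x hx => ?_
  have h := norm_mul_I_div_le hl hx
  have h' := norm_sq_mul_rpow_le_spectralBound hx H h.1 h.2
  rw [norm_mul_I_div] at h'
  refine le_trans ?_ h'
  rw [norm_mul]
  refine (mul_le_of_le_one_left (norm_nonneg _) (Real.abs_cos_le_one _)).trans (le_of_eq ?_)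
  congr 1
  rw [show 1 - 2 * H = 2 + (-1 - 2 * H) by ring, Real.rpow_add hx, Real.rpow_two]
  ring

/-- The squared modulus of the transfer function times the spectral density `x^(-1-2H)` of the noise
is the density in `rho`; expanding the square gives the quadratic form, which is therefore also
nonnegative. -/
theorem integral_norm_sum_sq_eq_sum_rho {θ : Param} (hH0 : 0 < θ 0) (hH1 : θ 0 < 1)
    (hl : 0 < θ 1) {ι : Type*} (s : Finset ι) (c t : ι → ℝ) :
    2 * cH (θ 0) * ∫ x in Set.Ioi (0 : ℝ),
        ‖∑ j ∈ s, ((θ 2 * c j : ℝ) : ℂ) * (Complex.exp ((t j * x : ℝ) * Complex.I) *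
          (x * Complex.I / (θ 1 + x * Complex.I)))‖ ^ 2 * x ^ (-1 - 2 * θ 0) =
      ∑ i ∈ s, ∑ j ∈ s, c i * c j * rho θ (t i - t j) := by
  have e : ∀ x ∈ Set.Ioi (0 : ℝ),
      ‖∑ j ∈ s, ((θ 2 * c j : ℝ) : ℂ) * (Complex.exp ((t j * x : ℝ) * Complex.I) *
          (x * Complex.I / (θ 1 + x * Complex.I)))‖ ^ 2 * x ^ (-1 - 2 * θ 0) =
      ∑ i ∈ s, ∑ j ∈ s, (θ 2 ^ 2 * (c i * c j)) *
        (Real.cos ((t i - t j) * x) * (x ^ (1 - 2 * θ 0) / (θ 1 ^ 2 + x ^ 2))) := by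
    intro x hx
    simp_rw [← mul_assoc]
    rw [← Finset.sum_mul, norm_mul, mul_pow, norm_mul_I_div, normSq_sum_eq_sum_sum_re, mul_assoc,
      Finset.sum_mul]
    refine Finset.sum_congr rfl fun i _ => ?_
    rw [Finset.sum_mul]
    refine Finset.sum_congr rfl fun j _ => ?_
    have hcos : (Complex.exp ((t i * x : ℝ) * Complex.I) *
        (starRingEnd ℂ) (Complex.exp ((t j * x : ℝ) * Complex.I))).re =
        Real.cos ((t i - t j) * x) := by
      rw [sub_mul, Real.cos_sub]
      simp only [Complex.mul_re, Complex.conj_re, Complex.conj_im, Complex.exp_ofReal_mul_I_re,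
        Complex.exp_ofReal_mul_I_im]
      ring
    have hx' : (0 : ℝ) < x := hx
    rw [hcos, show 1 - 2 * θ 0 = 2 + (-1 - 2 * θ 0) by ring, Real.rpow_add hx', Real.rpow_two]
    ring
  rw [setIntegral_congr_fun measurableSet_Ioi e]
  have hI := fun i j => integrableOn_rho_integrand hH0 hH1 hl (t i - t j)
  rw [integral_finsetSum, Finset.mul_sum]
  · refine Finset.sum_congr rfl fun i _ => ?_
    rw [integral_finsetSum, Finset.mul_sum]
    · refine Finset.sum_congr rfl fun j _ => ?_
      rw [integral_const_mul, rho]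
      ring
    · exact fun j _ => (hI i j).const_mul _
  · exact fun i _ => integrable_finsetSum _ fun j _ => (hI i j).const_mul _

theorem HasRiemannStieltjesIntegral.tendsto {f g : ℝ → ℝ} {a b I : ℝ}
    (h : HasRiemannStieltjesIntegral f g a b I) (hab : a ≤ b) :
    Tendsto (fun n : ℕ => ∑ i ∈ Finset.range (n + 1), f (partitionPoint a b n i) *
      (g (partitionPoint a b n (i + 1)) - g (partitionPoint a b n i))) atTop (𝓝 I) := by
  rw [Metric.tendsto_atTop]
  intro ε hε
  obtain ⟨δ, hδ, hδ'⟩ := h ε hε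
  have h0 : Tendsto (fun n : ℕ => (b - a) / ((n : ℝ) + 1)) atTop (𝓝 0) := by
    have := (tendsto_one_div_add_atTop_nhds_zero_nat (𝕜 := ℝ)).const_mul (b - a)
    simpa [div_eq_mul_inv] using this
  obtain ⟨N, hN⟩ := eventually_atTop.mp (h0.eventually (gt_mem_nhds hδ))
  refine ⟨N, fun n hn => ?_⟩
  rw [Real.dist_eq]
  refine hδ' (n + 1) (partitionPoint a b n) (partitionPoint a b n) (partitionPoint_zero _ _ _)
    (partitionPoint_last _ _ _) fun i _ => ⟨le_rfl, partitionPoint_mono hab n i.le_succ, ?_⟩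
  rw [partitionPoint_succ_sub]
  exact hN n hn

theorem exists_nat_forall_neg_lt {ι : Type*} (s : Finset ι) (t : ι → ℝ) :
    ∃ M : ℕ, ∀ j ∈ s, -(M : ℝ) < t j := by
  obtain ⟨M, hM⟩ := exists_nat_gt (∑ j ∈ s, |t j|)
  refine ⟨M, fun j hj => ?_⟩
  have h1 := Finset.single_le_sum (f := fun j => |t j|) (fun i _ => abs_nonneg _) hj
  have h2 := neg_abs_le (t j)
  linarith

/-- The integrals from a finite start `a` are limits of left-tagged sums over uniform partitions,
that is, of linear combinations of increments, whose spectral variances converge by domination. -/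
theorem hasLaw_sum_integral {Ω : Type*} [MeasurableSpace Ω] {μ : Measure Ω}
    [IsProbabilityMeasure μ] {H lam : ℝ} {B : ℝ → Ω → ℝ} (hB : IsFractionalBrownianMotion μ H B)
    (hH0 : 0 < H) (hH1 : H < 1) (hl : 0 < lam) {ι : Type*} (s : Finset ι) (c t : ι → ℝ) {a : ℝ}
    (hat : ∀ j ∈ s, a < t j) {J : ι → Ω → ℝ}
    (hJ : ∀ᵐ ω ∂μ, ∀ j ∈ s, HasRiemannStieltjesIntegral
      (fun u => Real.exp (-lam * (t j - u))) (fun u => B u ω) a (t j) (J j ω)) :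
    HasLaw (fun ω => ∑ j ∈ s, c j * J j ω) (gaussianReal 0 (2 * cH H * ∫ x in Set.Ioi (0 : ℝ),
      ‖∑ j ∈ s, (c j : ℂ) * ((Complex.exp ((t j * x : ℝ) * Complex.I) -
        Real.exp (-lam * (t j - a)) * Complex.exp ((a * x : ℝ) * Complex.I)) *
        (x * Complex.I / (lam + x * Complex.I)))‖ ^ 2 * x ^ (-1 - 2 * H)).toNNReal) μ := by
  have hlaw := fun n : ℕ => hB.hasLaw_sum_increments hH0 hH1 (s ×ˢ Finset.range (n + 1))
    (fun k => c k.1 * Real.exp (-lam * (t k.1 - partitionPoint a (t k.1) n k.2)))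
    (fun k => partitionPoint a (t k.1) n (k.2 + 1)) (fun k => partitionPoint a (t k.1) n k.2)
  simp only [Finset.sum_product, Complex.ofReal_mul, mul_assoc, ← Finset.mul_sum] at hlaw
  refine hasLaw_gaussianReal_of_tendsto_ae hlaw ?_ ?_
  · simp only [← mul_assoc]
    refine Tendsto.const_mul _ ?_
    -- A single `D` dominates both the uniform bound `2` and the slopes `t j - a` of the linear
    -- bound.
    obtain ⟨D, hD2, hD⟩ : ∃ D : ℝ, 2 ≤ D ∧ ∀ j ∈ s, t j - a ≤ D := by
      refine ⟨2 + ∑ j ∈ s, |t j - a|, ?_, fun j hj => ?_⟩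
      · have := Finset.sum_nonneg fun j (_ : j ∈ s) => abs_nonneg (t j - a)
        linarith
      · have h1 := Finset.single_le_sum (f := fun j => |t j - a|) (fun i _ => abs_nonneg _) hj
        have h2 := le_abs_self (t j - a)
        linarith
    refine tendsto_integral_norm_sq_mul_rpow (C := (∑ j ∈ s, |c j|) * D)
      (g := fun n x => ∑ j ∈ s, (c j : ℂ) * expRiemannSum lam a (t j) n x) hH0 hH1 ?_ ?_ ?_ ?_
    · intro n
      have := fun j => continuous_expRiemannSum lam a (t j) n
      fun_prop
    · intro n x _
      exact norm_sum_ofReal_mul_le s c _ fun j hj =>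
        (norm_expRiemannSum_le_two hl (hat j hj).le n x).trans hD2
    · intro n x hx
      rw [mul_assoc]
      exact norm_sum_ofReal_mul_le s c _ fun j hj =>
        (norm_expRiemannSum_le hl (hat j hj).le n hx).trans
          (mul_le_mul_of_nonneg_right (hD j hj) (le_of_lt hx))
    · intro x _
      simp only [mul_assoc]
      refine tendsto_finsetSum _ fun j hj => ?_
      have := (tendsto_expRiemannSum hl (hat j hj) x).const_mul (c j : ℂ)
      simpa only [mul_assoc] using this
  · filter_upwards [hJ] with ω hω
    refine tendsto_finsetSum _ fun j hj => ?_
    exact ((hω j hj).tendsto (hat j hj).le).const_mul _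

/-- Let the common start tend to `-∞`: the term carried by the start has modulus `exp (-lam (t -
a))` and disappears, leaving the stationary spectral representation. -/
theorem IsStationaryFOU.hasLaw_sum {Ω : Type*} [MeasurableSpace Ω] {μ : Measure Ω}
    [IsProbabilityMeasure μ] {θ : Param} {X : ℝ → Ω → ℝ} (hX : IsStationaryFOU μ θ X)
    (hH0 : 0 < θ 0) (hH1 : θ 0 < 1) (hl : 0 < θ 1) {ι : Type*} (s : Finset ι) (c t : ι → ℝ) :
    HasLaw (fun ω => ∑ j ∈ s, c j * X (t j) ω)
      (gaussianReal 0 (∑ i ∈ s, ∑ j ∈ s, c i * c j * rho θ (t i - t j)).toNNReal) μ := by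
  obtain ⟨B, hB, hX⟩ := hX
  have hJ : ∀ j, ∃ J : Ω → ℝ → ℝ, ∀ᵐ ω ∂μ,
      (∀ a ≤ t j, HasRiemannStieltjesIntegral (fun u => Real.exp (-(θ 1) * (t j - u)))
        (fun u => B u ω) a (t j) (J ω a)) ∧
      Tendsto (fun a => θ 2 * J ω a) atBot (𝓝 (X (t j) ω)) := by
    intro j
    have h : ∀ᵐ ω ∂μ, ∃ J : ℝ → ℝ,
        (∀ a ≤ t j, HasRiemannStieltjesIntegral (fun u => Real.exp (-(θ 1) * (t j - u)))
          (fun u => B u ω) a (t j) (J a)) ∧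
        Tendsto (fun a => θ 2 * J a) atBot (𝓝 (X (t j) ω)) := by
      filter_upwards [hX (t j)] with ω ⟨I, ⟨J, hJ1, hJ2⟩, hI⟩
      exact ⟨J, hJ1, hI ▸ hJ2.const_mul _⟩
    exact h.choice
  choose J hJ using hJ
  have hJ' : ∀ᵐ ω ∂μ, ∀ j ∈ s, (∀ a ≤ t j, HasRiemannStieltjesIntegral
        (fun u => Real.exp (-(θ 1) * (t j - u))) (fun u => B u ω) a (t j) (J j ω a)) ∧
      Tendsto (fun a => θ 2 * J j ω a) atBot (𝓝 (X (t j) ω)) := by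
    rw [eventually_all_finset]
    exact fun j _ => hJ j
  -- Starting at `-(M + m)` keeps the start strictly below all the times, for every `m`.
  obtain ⟨M, hM⟩ := exists_nat_forall_neg_lt s t
  have hlim : Tendsto (fun m : ℕ => -((M : ℝ) + m)) atTop atBot :=
    tendsto_neg_atTop_atBot.comp (tendsto_atTop_add_const_left _ _ tendsto_natCast_atTop_atTop)
  have hM' : ∀ m : ℕ, ∀ j ∈ s, -((M : ℝ) + m) < t j := fun m j hj => by
    have := hM j hj
    have : (0 : ℝ) ≤ m := by positivity
    linarith
  have hlaw := fun m : ℕ => hasLaw_sum_integral hB hH0 hH1 hl s (fun j => θ 2 * c j) t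
    (hM' m) (J := fun j ω => J j ω (-((M : ℝ) + m))) (by
      filter_upwards [hJ'] with ω hω j hj
      exact (hω j hj).1 _ (hM' m j hj).le)
  rw [← integral_norm_sum_sq_eq_sum_rho hH0 hH1 hl]
  refine hasLaw_gaussianReal_of_tendsto_ae hlaw ?_ ?_
  · refine Tendsto.const_mul _ ?_
    have hbd : ∀ m : ℕ, ∀ j ∈ s, ∀ x : ℝ, ‖Complex.exp ((t j * x : ℝ) * Complex.I) -
        Real.exp (-(θ 1) * (t j - -((M : ℝ) + m))) *
          Complex.exp ((-((M : ℝ) + m) * x : ℝ) * Complex.I)‖ ≤ 2 := by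
      intro m j hj x
      refine (norm_sub_le _ _).trans ?_
      rw [norm_mul, Complex.norm_exp_ofReal_mul_I, Complex.norm_exp_ofReal_mul_I,
        Complex.norm_real, Real.norm_of_nonneg (Real.exp_pos _).le, mul_one]
      have : Real.exp (-(θ 1) * (t j - -((M : ℝ) + m))) ≤ 1 := by
        rw [Real.exp_le_one_iff]
        nlinarith [hM' m j hj]
      linarith
    refine tendsto_integral_norm_sq_mul_rpow
      (C := (∑ j ∈ s, |θ 2 * c j|) * (2 * (1 + (θ 1)⁻¹))) hH0 hH1 ?_ ?_ ?_ ?_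
    · intro n
      fun_prop
    · intro m x hx
      refine norm_sum_ofReal_mul_le s _ _ fun j hj => ?_
      rw [norm_mul]
      exact mul_le_mul (hbd m j hj x) (norm_mul_I_div_le hl hx).1 (norm_nonneg _) (by norm_num)
    · intro m x hx
      rw [mul_assoc, mul_assoc]
      refine norm_sum_ofReal_mul_le s _ _ fun j hj => ?_
      rw [norm_mul]
      exact mul_le_mul (hbd m j hj x) (norm_mul_I_div_le hl hx).2 (norm_nonneg _) (by norm_num)
    · intro x _
      refine tendsto_finsetSum _ fun j hj => ?_
      refine Tendsto.const_mul _ (Tendsto.mul_const _ ?_)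
      rw [← sub_zero (Complex.exp ((t j * x : ℝ) * Complex.I))]
      refine Tendsto.sub (by simp) ?_
      rw [tendsto_zero_iff_norm_tendsto_zero]
      simp only [norm_mul, Complex.norm_exp_ofReal_mul_I, Complex.norm_real, mul_one,
        Real.norm_of_nonneg (Real.exp_pos _).le]
      refine Real.tendsto_exp_atBot.comp ?_
      have h1 : Tendsto (fun m : ℕ => t j - -((M : ℝ) + m)) atTop atTop := by
        simp only [sub_eq_add_neg]
        exact tendsto_atTop_add_const_left _ _ (tendsto_neg_atBot_atTop.comp hlim)
      exact h1.const_mul_atTop_of_neg (by linarith)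
  · filter_upwards [hJ'] with ω hω
    refine tendsto_finsetSum _ fun j hj => ?_
    have := (((hω j hj).2.comp hlim).const_mul (c j))
    refine this.congr fun m => ?_
    simp only [Function.comp]
    ring

/-! ### Decay of the second differences of the autocovariance -/

theorem rho_neg (θ : Param) (t : ℝ) : rho θ (-t) = rho θ t := by
  simp [rho]

/-- The spectral density of the Ornstein-Uhlenbeck process, up to a constant. -/
noncomputable def spectralDensity (H lam x : ℝ) : ℝ := x ^ (1 - 2 * H) / (lam ^ 2 + x ^ 2)

theorem spectralDensity_nonneg (H lam : ℝ) {x : ℝ} (hx : 0 < x) : 0 ≤ spectralDensity H lam x := by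
  unfold spectralDensity; positivity

theorem hasDerivAt_spectralDensity (H lam : ℝ) {x : ℝ} (hx : 0 < x) :
    HasDerivAt (spectralDensity H lam)
      (spectralDensity H lam x * ((1 - 2 * H) / x - 2 * x / (lam ^ 2 + x ^ 2))) x := by
  have h1 : HasDerivAt (fun x : ℝ => x ^ (1 - 2 * H)) ((1 - 2 * H) * x ^ (1 - 2 * H - 1)) x :=
    Real.hasDerivAt_rpow_const (Or.inl hx.ne')
  have h2 : HasDerivAt (fun x : ℝ => lam ^ 2 + x ^ 2) (2 * x) x := by
    simpa using (hasDerivAt_pow 2 x).const_add (lam ^ 2)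
  have hne : lam ^ 2 + x ^ 2 ≠ 0 := by positivity
  have h3 := h1.div h2 hne
  refine h3.congr_deriv ?_
  rw [Real.rpow_sub_one hx.ne', spectralDensity]
  field_simp

theorem spectralDensity_le_small (H : ℝ) {lam x : ℝ} (hl : 0 < lam) (hx : 0 < x) :
    spectralDensity H lam x ≤ x ^ (1 - 2 * H) * (lam ^ 2)⁻¹ := by
  unfold spectralDensity
  rw [div_eq_mul_inv]
  gcongr
  nlinarith

theorem spectralDensity_le_large (H lam : ℝ) {x : ℝ} (hx : 0 < x) :
    spectralDensity H lam x ≤ x ^ (-1 - 2 * H) := by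
  unfold spectralDensity
  rw [div_le_iff₀ (by positivity), show 1 - 2 * H = (-1 - 2 * H) + 2 by ring, Real.rpow_add hx,
    Real.rpow_two]
  gcongr
  nlinarith [sq_nonneg lam]

theorem one_sub_cos_le_sq (y : ℝ) : 1 - Real.cos y ≤ y ^ 2 := by
  have := Real.one_sub_sq_div_two_le_cos (x := y)
  nlinarith [sq_nonneg y]

/-- A second difference multiplies the spectral density by `1 - cos (τ x)`. The density behaves like
`x^(1-2H)` at the origin, with a derivative that is not integrable there when `H > 1/2`; the new
factor gains two powers of `x` and makes the derivative integrable for all `H`. One integration by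
parts then yields `1 / |t|`. -/
theorem abs_rho_second_difference_le {θ : Param} (hH0 : 0 < θ 0) (hH1 : θ 0 < 1)
    (hl : 0 < θ 1) (τ : ℝ) :
    ∃ C, ∀ t ≠ 0, |rho θ t - (rho θ (t - τ) + rho θ (t + τ)) / 2| ≤ C / |t| := by
  set H := θ 0
  set lam := θ 1
  set g := spectralDensity H lam with hg
  set u : ℝ → ℝ := fun x => (1 - Real.cos (τ * x)) * g x with hu
  set u' : ℝ → ℝ := fun x => τ * Real.sin (τ * x) * g x +
    (1 - Real.cos (τ * x)) * (g x * ((1 - 2 * H) / x - 2 * x / (lam ^ 2 + x ^ 2))) with hu'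
  have hgm : Measurable g := by
    rw [hg]; unfold spectralDensity; fun_prop
  have hder : ∀ x ∈ Set.Ioi (0 : ℝ), HasDerivAt u (u' x) x := by
    intro x hx
    have h1 : HasDerivAt (fun x : ℝ => 1 - Real.cos (τ * x)) (τ * Real.sin (τ * x)) x := by
      have := ((hasDerivAt_id x).const_mul τ).cos.const_sub 1
      refine this.congr_deriv ?_
      simp [mul_comm]
    exact h1.mul (hasDerivAt_spectralDensity H lam hx)
  have hfac : ∀ x : ℝ, 0 < x → |(1 - 2 * H) / x - 2 * x / (lam ^ 2 + x ^ 2)| ≤ 3 / x := by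
    intro x hx
    have h1 : |(1 - 2 * H) / x| ≤ 1 / x := by
      rw [abs_div, abs_of_pos hx]
      gcongr
      rw [abs_le]; constructor <;> linarith
    have h2 : |2 * x / (lam ^ 2 + x ^ 2)| ≤ 2 / x := by
      rw [abs_of_nonneg (by positivity), div_le_div_iff₀ (by positivity) hx]
      nlinarith [sq_nonneg lam]
    refine (abs_sub _ _).trans ?_
    have : 3 / x = 1 / x + 2 / x := by ring
    linarith
  have hcos := fun y => Real.cos_le_one y
  have hbound : ∀ x : ℝ, 0 < x → |u' x| ≤
      (|τ * Real.sin (τ * x)| + (1 - Real.cos (τ * x)) * (3 / x)) * g x := by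
    intro x hx
    have hg0 : 0 ≤ g x := spectralDensity_nonneg H lam hx
    refine (abs_add_le _ _).trans ?_
    rw [abs_mul _ (g x), abs_of_nonneg hg0, abs_mul (1 - Real.cos (τ * x)), abs_mul (g x),
      abs_of_nonneg hg0, abs_of_nonneg (by linarith [hcos (τ * x)] : 0 ≤ 1 - Real.cos (τ * x)),
      add_mul]
    have := mul_le_mul_of_nonneg_left (hfac x hx)
      (mul_nonneg (by linarith [hcos (τ * x)] : 0 ≤ 1 - Real.cos (τ * x)) hg0)
    nlinarith
  have hint : IntegrableOn u' (Set.Ioi 0) := by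
    -- In the constant, `4 τ² / lam²` serves `x ≤ 1` and `|τ| + 6` serves `x > 1`.
    refine integrableOn_Ioi_of_rpow_bounds (C := 4 * τ ^ 2 * (lam ^ 2)⁻¹ + |τ| + 6)
      (p := 2 - 2 * H) (q := -1 - 2 * H) (by linarith) (by linarith)
      (Measurable.aestronglyMeasurable (by fun_prop)) ?_ ?_
    · intro x hx _
      refine (hbound x hx).trans ?_
      have h1 : |τ * Real.sin (τ * x)| ≤ τ ^ 2 * x := by
        rw [abs_mul]
        have := Real.abs_sin_le_abs (x := τ * x)
        rw [abs_mul, abs_of_pos hx] at this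
        calc |τ| * |Real.sin (τ * x)| ≤ |τ| * (|τ| * x) := by gcongr
          _ = τ ^ 2 * x := by rw [← sq_abs τ]; ring
      have h2 : (1 - Real.cos (τ * x)) * (3 / x) ≤ 3 * τ ^ 2 * x := by
        calc (1 - Real.cos (τ * x)) * (3 / x) ≤ (τ * x) ^ 2 * (3 / x) := by
              gcongr; exact one_sub_cos_le_sq _
          _ = 3 * τ ^ 2 * x := by field_simp
      calc (|τ * Real.sin (τ * x)| + (1 - Real.cos (τ * x)) * (3 / x)) * g x
          ≤ (τ ^ 2 * x + 3 * τ ^ 2 * x) * (x ^ (1 - 2 * H) * (lam ^ 2)⁻¹) := by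
            gcongr
            · exact spectralDensity_nonneg H lam hx
            · exact spectralDensity_le_small H hl hx
        _ = (4 * τ ^ 2 * (lam ^ 2)⁻¹) * x ^ (2 - 2 * H) := by
            rw [show 2 - 2 * H = 1 + (1 - 2 * H) by ring, Real.rpow_add hx, Real.rpow_one]; ring
        _ ≤ _ := by
            gcongr
            have := abs_nonneg τ
            linarith
    · intro x hx
      have hx0 : 0 < x := by linarith
      refine (hbound x hx0).trans ?_
      have h1 : |τ * Real.sin (τ * x)| ≤ |τ| := by
        rw [abs_mul]; exact mul_le_of_le_one_right (abs_nonneg _) (Real.abs_sin_le_one _)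
      have h2 : (1 - Real.cos (τ * x)) * (3 / x) ≤ 2 * 3 := by
        have h3 : 3 / x ≤ 3 := div_le_self (by norm_num) hx.le
        have h4 := Real.neg_one_le_cos (τ * x)
        gcongr
        linarith
      calc (|τ * Real.sin (τ * x)| + (1 - Real.cos (τ * x)) * (3 / x)) * g x
          ≤ (|τ| + 2 * 3) * x ^ (-1 - 2 * H) := by
            gcongr
            · exact spectralDensity_nonneg H lam hx0
            · exact spectralDensity_le_large H lam hx0
        _ ≤ _ := by
            gcongr
            · have : 0 ≤ 4 * τ ^ 2 * (lam ^ 2)⁻¹ := by positivity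
              linarith
            · norm_num
  have hcg : ∀ s : ℝ, IntegrableOn (fun x : ℝ => Real.cos (s * x) * g x) (Set.Ioi 0) :=
    integrableOn_rho_integrand hH0 hH1 hl
  have hu0 : Tendsto u (𝓝[>] 0) (𝓝 0) := by
    have h1 : Tendsto (fun x : ℝ => τ ^ 2 * (lam ^ 2)⁻¹ * x ^ (3 - 2 * H)) (𝓝[>] 0) (𝓝 0) := by
      have h2 : Tendsto (fun x : ℝ => x ^ (3 - 2 * H)) (𝓝 0) (𝓝 0) := by
        have := (Real.continuous_rpow_const (q := 3 - 2 * H) (by linarith)).tendsto 0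
        rwa [Real.zero_rpow (by linarith)] at this
      simpa using (h2.mono_left nhdsWithin_le_nhds).const_mul (τ ^ 2 * (lam ^ 2)⁻¹)
    refine squeeze_zero_norm' ?_ h1
    filter_upwards [self_mem_nhdsWithin] with x hx
    have hx0 : (0 : ℝ) < x := hx
    have hg0 : 0 ≤ g x := spectralDensity_nonneg H lam hx0
    rw [Real.norm_of_nonneg (mul_nonneg (by linarith [hcos (τ * x)]) hg0)]
    calc (1 - Real.cos (τ * x)) * g x ≤ (τ * x) ^ 2 * (x ^ (1 - 2 * H) * (lam ^ 2)⁻¹) := by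
          gcongr
          · exact one_sub_cos_le_sq _
          · exact spectralDensity_le_small H hl hx0
      _ = _ := by
          rw [show 3 - 2 * H = 2 + (1 - 2 * H) by ring, Real.rpow_add hx0, Real.rpow_two]; ring
  have huT : Tendsto u atTop (𝓝 0) := by
    have h1 : Tendsto (fun x : ℝ => 2 * x ^ (-(1 + 2 * H))) atTop (𝓝 0) := by
      simpa using (tendsto_rpow_neg_atTop (by linarith : 0 < 1 + 2 * H)).const_mul 2
    refine squeeze_zero_norm' ?_ h1
    filter_upwards [eventually_gt_atTop 0] with x hx0
    have hg0 : 0 ≤ g x := spectralDensity_nonneg H lam hx0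
    rw [Real.norm_of_nonneg (mul_nonneg (by linarith [hcos (τ * x)]) hg0)]
    rw [show -(1 + 2 * H) = -1 - 2 * H by ring]
    gcongr
    · linarith [Real.neg_one_le_cos (τ * x)]
    · exact spectralDensity_le_large H lam hx0
  refine ⟨|2 * θ 2 ^ 2 * cH H| * ∫ x in Set.Ioi (0 : ℝ), |u' x|, fun t ht => ?_⟩
  set v : ℝ → ℝ := fun x => Real.sin (t * x) / t with hv
  have hvder : ∀ x ∈ Set.Ioi (0 : ℝ), HasDerivAt v (Real.cos (t * x)) x := by
    intro x _
    have := ((hasDerivAt_id x).const_mul t).sin.div_const t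
    refine this.congr_deriv ?_
    simp only [id, mul_one]
    field_simp
  have hvb : ∀ x, |v x| ≤ 1 / |t| := by
    intro x
    rw [hv]
    simp only
    rw [abs_div]
    gcongr
    exact Real.abs_sin_le_one _
  -- By the addition formulas `u x * cos (t x)` combines the densities at `t` and `t ± τ`; the same
  -- identity gives `hK`.
  have huv' : IntegrableOn (u * fun x => Real.cos (t * x)) (Set.Ioi 0) := by
    refine IntegrableOn.congr_fun (((hcg t).sub ((hcg (t - τ)).div_const 2)).sub
      ((hcg (t + τ)).div_const 2)) ?_ measurableSet_Ioi
    intro x _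
    simp only [Pi.sub_apply, Pi.mul_apply, hu, sub_mul t, add_mul t, Real.cos_sub, Real.cos_add]
    ring
  have hu'v : IntegrableOn (u' * v) (Set.Ioi 0) := by
    refine Integrable.mono' (hint.norm.mul_const (1 / |t|))
      (Measurable.aestronglyMeasurable (by fun_prop)) ?_
    refine Eventually.of_forall fun x => ?_
    rw [Pi.mul_apply, norm_mul]
    exact mul_le_mul_of_nonneg_left (hvb x) (norm_nonneg _)
  have hbv : ∀ {l : Filter ℝ}, Tendsto u l (𝓝 0) → Tendsto (u * v) l (𝓝 0) := by
    intro l hl0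
    have h1 : Tendsto (fun x => ‖u x‖ * (1 / |t|)) l (𝓝 0) := by
      simpa using hl0.norm.mul_const (1 / |t|)
    refine squeeze_zero_norm (fun x => ?_) h1
    rw [Pi.mul_apply, norm_mul]
    exact mul_le_mul_of_nonneg_left (hvb x) (norm_nonneg _)
  have hparts := integral_Ioi_mul_deriv_eq_deriv_mul hder hvder huv' hu'v (hbv hu0) (hbv huT)
  have hK : rho θ t - (rho θ (t - τ) + rho θ (t + τ)) / 2 =
      2 * θ 2 ^ 2 * cH H * ∫ x in Set.Ioi (0 : ℝ), u x * Real.cos (t * x) := by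
    have e : (fun x => u x * Real.cos (t * x)) = ((fun x : ℝ => Real.cos (t * x) * g x) -
        fun x : ℝ => Real.cos ((t - τ) * x) * g x / 2) -
        fun x : ℝ => Real.cos ((t + τ) * x) * g x / 2 := by
      funext x
      simp only [Pi.sub_apply, hu, sub_mul t, add_mul t, Real.cos_sub, Real.cos_add]
      ring
    rw [e, integral_sub' ((hcg t).sub ((hcg (t - τ)).div_const 2)) ((hcg (t + τ)).div_const 2),
      integral_sub' (hcg t) ((hcg (t - τ)).div_const 2), integral_div, integral_div]
    simp only [rho, hg, spectralDensity]
    ring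
  rw [hK, hparts, abs_mul, mul_div_assoc]
  gcongr
  rw [sub_zero, zero_sub, abs_neg]
  refine (abs_integral_le_integral_abs).trans ?_
  rw [← integral_div]
  refine integral_mono_of_nonneg (Eventually.of_forall fun x => abs_nonneg _)
    (hint.norm.div_const _) (Eventually.of_forall fun x => ?_)
  simp only
  rw [abs_mul, div_eq_mul_one_div |u' x|]
  exact mul_le_mul_of_nonneg_left (hvb x) (abs_nonneg _)

/-! ### Gaussian moments and covariances of filtered processes -/

/-- The moment is the fourth derivative at `0` of the moment generating function; every derivative
is a polynomial times the same exponential, so one rule `hder` is iterated. -/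
theorem integral_pow_four_gaussianReal (v : NNReal) :
    ∫ x, x ^ 4 ∂(gaussianReal 0 v) = 3 * (v : ℝ) ^ 2 := by
  have h := iteratedDeriv_mgf_zero (X := id) (μ := gaussianReal 0 v) (by simp) 4
  have hmgf : mgf id (gaussianReal 0 v) = fun t : ℝ => Real.exp (v * t ^ 2 / 2) := by
    rw [mgf_id_gaussianReal]; simp
  have hder : ∀ (p p' : ℝ → ℝ), (∀ t, HasDerivAt p (p' t) t) →
      deriv (fun t : ℝ => p t * Real.exp (v * t ^ 2 / 2)) =
        fun t => (p' t + v * t * p t) * Real.exp (v * t ^ 2 / 2) := by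
    intro p p' hp
    funext t
    have h1 : HasDerivAt (fun t : ℝ => Real.exp (v * t ^ 2 / 2))
        (Real.exp (v * t ^ 2 / 2) * (v * t)) t := by
      have := (((hasDerivAt_pow 2 t).const_mul (v : ℝ)).div_const 2).exp
      refine this.congr_deriv ?_
      simp; ring
    refine (((hp t).mul h1).congr_deriv ?_).deriv
    ring
  have h1 : deriv (fun t : ℝ => Real.exp (v * t ^ 2 / 2)) =
      fun t => (v * t) * Real.exp (v * t ^ 2 / 2) := by
    have := hder (fun _ => 1) (fun _ => 0) (fun t => hasDerivAt_const t 1)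
    simpa using this
  have h2 := hder (fun t => v * t) (fun _ => v) (fun t => by
    simpa using (hasDerivAt_id t).const_mul (v : ℝ))
  have h3 := hder (fun t => v + v * t * (v * t)) (fun t => 2 * v ^ 2 * t) (fun t => by
    have := ((hasDerivAt_pow 2 t).const_mul ((v : ℝ) ^ 2)).const_add (v : ℝ)
    convert! this using 1
    · funext s; ring
    · simp; ring)
  have h4 := hder (fun t => 2 * v ^ 2 * t + v * t * (v + v * t * (v * t)))
    (fun t => 3 * v ^ 2 + 3 * v ^ 3 * t ^ 2) (fun t => by
    have := ((hasDerivAt_id t).const_mul (3 * (v : ℝ) ^ 2)).add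
      ((hasDerivAt_pow 3 t).const_mul ((v : ℝ) ^ 3))
    convert! this using 1
    · funext s; simp; ring
    · simp; ring)
  rw [iteratedDeriv_eq_iterate] at h
  simp only [Function.iterate_succ, Function.iterate_zero, Function.comp, id] at h
  change deriv (deriv (deriv (deriv (mgf id (gaussianReal 0 v))))) 0 = _ at h
  rw [hmgf, h1, h2, h3, h4] at h
  simp at h
  rw [← h]

/-- With truncated subtraction `(i - j) + (j - i)` is `|i - j|`. The coefficients `b_k` are thus the
quadratic form of the filter folded along the distance to the diagonal. -/
theorem sum_filterB_mul {L : ℕ} (a : Fin (L + 1) → ℝ) (g : ℕ → ℝ) :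
    ∑ k : Fin (L + 1), filterB a k * g k =
      ∑ i : Fin (L + 1), ∑ j : Fin (L + 1), a i * a j * g ((i - j : ℕ) + (j - i : ℕ)) := by
  -- `f` puts the whole weight on `j ≤ i`, doubled off the diagonal; averaging it with its transpose
  -- gives the symmetric form.
  set f : Fin (L + 1) → Fin (L + 1) → ℝ := fun i j =>
    a i * a j * (if (j : ℕ) < i then 2 * g (i - j) else if (i : ℕ) = j then g 0 else 0) with hf
  have hm : ∀ k : Fin (L + 1), (if k = 0 then (1 : ℝ) else 2) = if (k : ℕ) = 0 then 1 else 2 := by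
    intro k
    exact if_congr Fin.ext_iff rfl rfl
  have h1 : ∑ k : Fin (L + 1), filterB a k * g k = ∑ i, ∑ j, f i j := by
    simp only [filterB, hm, Finset.mul_sum, Finset.sum_mul]
    rw [Finset.sum_comm]
    refine Finset.sum_congr rfl fun i _ => ?_
    rw [Finset.sum_comm]
    refine Finset.sum_congr rfl fun j _ => ?_
    simp only [hf]
    by_cases hji : (j : ℕ) ≤ i
    · rw [Finset.sum_eq_single (⟨i - j, by omega⟩ : Fin (L + 1))]
      · have hij : (i : ℕ) = i - j + j := by omega
        rcases hji.lt_or_eq with h | h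
        · rw [if_pos h, if_neg (show ¬(i : ℕ) - j = 0 by omega), if_pos hij]
          ring
        · have hs : (i : ℕ) - j = 0 := by omega
          rw [if_pos hs, if_pos hij, if_neg (by omega), if_pos h.symm]
          simp only [hs]
          ring
      · intro k _ hk
        have hne : ¬(i : ℕ) = k + j := fun hcon => hk (Fin.ext (by simp only; omega))
        rw [if_neg hne]
        ring
      · simp
    · rw [if_neg (by omega), if_neg (by omega), mul_zero]
      refine Finset.sum_eq_zero fun k _ => ?_
      rw [if_neg (show ¬(i : ℕ) = k + j by omega)]
      ring
  have h2 : ∑ i, ∑ j, f i j = ∑ i, ∑ j, f j i := Finset.sum_comm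
  have h3 : ∀ i j, f i j + f j i = 2 * (a i * a j * g ((i - j : ℕ) + (j - i : ℕ))) := by
    intro i j
    simp only [hf]
    rcases lt_trichotomy (i : ℕ) j with h | h | h
    · have e : (i : ℕ) - j = 0 := by omega
      rw [if_neg (by omega), if_neg (by omega), if_pos h, e, zero_add]
      ring
    · rw [h]
      simp
      ring
    · have e : (j : ℕ) - i = 0 := by omega
      rw [if_pos h, if_neg (by omega), if_neg (by omega), e, add_zero]
      ring
  have h4 : 2 * ∑ i, ∑ j, f i j =
      2 * ∑ i : Fin (L + 1), ∑ j : Fin (L + 1), a i * a j * g ((i - j : ℕ) + (j - i : ℕ)) := by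
    rw [two_mul]
    nth_rewrite 2 [h2]
    simp only [← Finset.sum_add_distrib, h3, Finset.mul_sum]
  rw [h1]
  linarith

theorem IsFilter.sum_eq_zero {L l : ℕ} {a : Fin (L + 1) → ℝ} (h : IsFilter a l) (hl : 1 ≤ l) :
    ∑ q, a q = 0 := by
  have := (h.1 hl).1 0 hl
  simpa using this

/-- The sum of the `b_k` is the square of the sum of the filter. It puts the constant vectors in the
kernel of `matrixB`. -/
theorem sum_filterB_eq_zero {L : ℕ} {a : Fin (L + 1) → ℝ} (h : ∑ q, a q = 0) :
    ∑ k, filterB a k = 0 := by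
  have := sum_filterB_mul a (fun _ => 1)
  simp only [mul_one] at this
  rw [this, ← Finset.sum_mul_sum, h, zero_mul]

/-- The autocovariance function of the filtered process. -/
noncomputable def filteredCov {L : ℕ} (θ : Param) (a : Fin (L + 1) → ℝ) (α t : ℝ) : ℝ :=
  ∑ q : Fin (L + 1), ∑ r : Fin (L + 1), a q * a r * rho θ (t - (α * (q : ℕ) - α * (r : ℕ)))

theorem filteredCov_neg {L : ℕ} (θ : Param) (a : Fin (L + 1) → ℝ) (α t : ℝ) :
    filteredCov θ a α (-t) = filteredCov θ a α t := by
  unfold filteredCov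
  rw [Finset.sum_comm]
  refine Finset.sum_congr rfl fun q _ => Finset.sum_congr rfl fun r _ => ?_
  rw [← rho_neg, mul_comm (a r)]
  congr 2
  ring

theorem theoreticalVariance_eq_filteredCov {L : ℕ} (θ : Param) (a : Fin (L + 1) → ℝ) (α : ℝ) :
    theoreticalVariance a α θ = filteredCov θ a α 0 := by
  unfold theoreticalVariance filteredCov
  rw [sum_filterB_mul a (fun k => rho θ (α * k))]
  refine Finset.sum_congr rfl fun q _ => Finset.sum_congr rfl fun r _ => ?_
  congr 1
  rcases le_total (q : ℕ) r with h | h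
  · rw [Nat.sub_eq_zero_of_le h, zero_add, Nat.cast_sub h]
    congr 1
    ring
  · rw [Nat.sub_eq_zero_of_le h, add_zero, Nat.cast_sub h, ← rho_neg]
    congr 1
    ring

/-- Exchanging the two indices averages the shifts of opposite sign, and the zero sum allows the
subtraction of `rho θ t` from every term. -/
theorem filteredCov_eq_second_difference {L : ℕ} (θ : Param) {a : Fin (L + 1) → ℝ}
    (ha : ∑ q, a q = 0) (α t : ℝ) :
    filteredCov θ a α t = ∑ q : Fin (L + 1), ∑ r : Fin (L + 1), -(a q * a r) *
      (rho θ t - (rho θ (t - (α * (q : ℕ) - α * (r : ℕ))) +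
        rho θ (t + (α * (q : ℕ) - α * (r : ℕ)))) / 2) := by
  have h0 : ∑ q : Fin (L + 1), ∑ r : Fin (L + 1), a q * a r * rho θ t = 0 := by
    simp only [← Finset.sum_mul]
    rw [← Finset.sum_mul_sum, ha]
    simp
  have h1 : filteredCov θ a α t = ∑ q : Fin (L + 1), ∑ r : Fin (L + 1),
      a q * a r * rho θ (t + (α * (q : ℕ) - α * (r : ℕ))) := by
    unfold filteredCov
    rw [Finset.sum_comm]
    refine Finset.sum_congr rfl fun q _ => Finset.sum_congr rfl fun r _ => ?_
    rw [mul_comm (a r)]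
    congr 2
    ring
  have h2 : filteredCov θ a α t = (filteredCov θ a α t + ∑ q : Fin (L + 1), ∑ r : Fin (L + 1),
      a q * a r * rho θ (t + (α * (q : ℕ) - α * (r : ℕ)))) / 2 -
      ∑ q : Fin (L + 1), ∑ r : Fin (L + 1), a q * a r * rho θ t := by
    rw [← h1, h0]; ring
  rw [h2]
  unfold filteredCov
  rw [← Finset.sum_add_distrib, Finset.sum_div, ← Finset.sum_sub_distrib]
  refine Finset.sum_congr rfl fun q _ => ?_
  rw [← Finset.sum_add_distrib, Finset.sum_div, ← Finset.sum_sub_distrib]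
  refine Finset.sum_congr rfl fun r _ => ?_
  ring

theorem abs_filteredCov_le {L : ℕ} {θ : Param} (hH0 : 0 < θ 0) (hH1 : θ 0 < 1) (hl : 0 < θ 1)
    {a : Fin (L + 1) → ℝ} (ha : ∑ q, a q = 0) (α : ℝ) :
    ∃ C, ∀ t ≠ 0, |filteredCov θ a α t| ≤ C / |t| := by
  choose C hC using fun q r : Fin (L + 1) =>
    abs_rho_second_difference_le hH0 hH1 hl (α * (q : ℕ) - α * (r : ℕ))
  refine ⟨∑ q : Fin (L + 1), ∑ r : Fin (L + 1), |a q * a r| * C q r, fun t ht => ?_⟩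
  rw [filteredCov_eq_second_difference θ ha, Finset.sum_div]
  refine (Finset.abs_sum_le_sum_abs _ _).trans (Finset.sum_le_sum fun q _ => ?_)
  rw [Finset.sum_div]
  refine (Finset.abs_sum_le_sum_abs _ _).trans (Finset.sum_le_sum fun r _ => ?_)
  rw [abs_mul, abs_neg, mul_div_assoc]
  exact mul_le_mul_of_nonneg_left (hC q r t ht) (abs_nonneg _)

/-- Only the squared covariance enters the variance of sums of squares, so decay like `1 / |k|` is
enough. -/
theorem summable_filteredCov_sq {L : ℕ} {θ : Param} (hH0 : 0 < θ 0) (hH1 : θ 0 < 1)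
    (hl : 0 < θ 1) {a : Fin (L + 1) → ℝ} (ha : ∑ q, a q = 0) {α : ℝ} (hα : 0 < α) :
    Summable fun k : ℤ => filteredCov θ a α (α * k) ^ 2 := by
  obtain ⟨C, hC⟩ := abs_filteredCov_le hH0 hH1 hl ha α
  have hs : Summable fun k : ℤ => (C / α) ^ 2 * (1 / (k : ℝ) ^ 2) :=
    (Real.summable_one_div_int_pow.mpr one_lt_two).mul_left _
  refine Summable.of_norm_bounded_eventually hs ?_
  have : ∀ᶠ k : ℤ in cofinite, k ≠ 0 := by
    rw [eventually_cofinite]; simp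
  filter_upwards [this] with k hk
  have hk' : (k : ℝ) ≠ 0 := Int.cast_ne_zero.mpr hk
  have h := hC (α * k) (mul_ne_zero hα.ne' hk')
  rw [Real.norm_of_nonneg (sq_nonneg _), ← sq_abs]
  calc |filteredCov θ a α (α * k)| ^ 2 ≤ (C / |α * k|) ^ 2 := by gcongr
    _ = (C / α) ^ 2 * (1 / (k : ℝ) ^ 2) := by
      rw [div_pow, sq_abs]; field_simp

section GaussianMoments

variable {Ω : Type*} [MeasurableSpace Ω] {μ : Measure Ω} {Y : Ω → ℝ} {v : ℝ}

theorem integrable_pow_of_hasLaw_gaussianReal (h : HasLaw Y (gaussianReal 0 v.toNNReal) μ)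
    (n : ℕ) : Integrable (fun ω => Y ω ^ n) μ := by
  have h1 : Integrable (fun x : ℝ => x ^ n) (gaussianReal 0 v.toNNReal) := by
    rcases Nat.eq_zero_or_pos n with rfl | hn
    · simp
    have := (memLp_id_gaussianReal (μ := 0) (v := v.toNNReal) n).integrable_norm_pow hn.ne'
    refine (integrable_norm_iff (Measurable.aestronglyMeasurable (by fun_prop))).mp ?_
    simpa using this
  rw [← h.map_eq] at h1
  exact h1.comp_aemeasurable h.aemeasurable

theorem integral_sq_of_hasLaw_gaussianReal (h : HasLaw Y (gaussianReal 0 v.toNNReal) μ)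
    (hv : 0 ≤ v) : ∫ ω, Y ω ^ 2 ∂μ = v := by
  have h1 := h.integral_comp (f := fun x : ℝ => x ^ 2)
    (Measurable.aestronglyMeasurable (by fun_prop))
  simp only [Function.comp_def] at h1
  rw [h1]
  have h2 := variance_fun_id_gaussianReal (μ := 0) (v := v.toNNReal)
  rw [variance_eq_integral (by fun_prop), integral_id_gaussianReal] at h2
  simpa [hv] using h2

theorem integral_pow_four_of_hasLaw_gaussianReal (h : HasLaw Y (gaussianReal 0 v.toNNReal) μ)
    (hv : 0 ≤ v) : ∫ ω, Y ω ^ 4 ∂μ = 3 * v ^ 2 := by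
  have h1 := h.integral_comp (f := fun x : ℝ => x ^ 4)
    (Measurable.aestronglyMeasurable (by fun_prop))
  simp only [Function.comp_def] at h1
  rw [h1, integral_pow_four_gaussianReal, Real.coe_toNNReal _ hv]

end GaussianMoments

theorem sum_rho_nonneg {θ : Param} (hH0 : 0 < θ 0) (hH1 : θ 0 < 1)
    (hl : 0 < θ 1) {ι : Type*} (s : Finset ι) (c t : ι → ℝ) :
    0 ≤ ∑ i ∈ s, ∑ j ∈ s, c i * c j * rho θ (t i - t j) := by
  rw [← integral_norm_sum_sq_eq_sum_rho hH0 hH1 hl]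
  refine mul_nonneg (by linarith [cH_pos hH0 hH1]) (setIntegral_nonneg measurableSet_Ioi ?_)
  intro x hx
  have hx' : (0 : ℝ) < x := hx
  positivity

theorem integral_add_sub_sub {Ω : Type*} [MeasurableSpace Ω] {μ : Measure Ω}
    {f₁ f₂ f₃ f₄ : Ω → ℝ} (h₁ : Integrable f₁ μ) (h₂ : Integrable f₂ μ) (h₃ : Integrable f₃ μ)
    (h₄ : Integrable f₄ μ) (c : ℝ) :
    Integrable (fun ω => f₁ ω + f₂ ω - c * f₃ ω - c * f₄ ω) μ ∧
    ∫ ω, (f₁ ω + f₂ ω - c * f₃ ω - c * f₄ ω) ∂μ =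
      ∫ ω, f₁ ω ∂μ + ∫ ω, f₂ ω ∂μ - c * ∫ ω, f₃ ω ∂μ - c * ∫ ω, f₄ ω ∂μ := by
  have h₁₂ : Integrable (fun ω => f₁ ω + f₂ ω) μ := h₁.add h₂
  have h : Integrable (fun ω => f₁ ω + f₂ ω - c * f₃ ω) μ := h₁₂.sub (h₃.const_mul c)
  refine ⟨h.sub (h₄.const_mul c), ?_⟩
  rw [integral_sub h (h₄.const_mul c), integral_sub h₁₂ (h₃.const_mul c),
    integral_add h₁ h₂, integral_const_mul, integral_const_mul]

section FilteredMoments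

variable {Ω : Type*} [MeasurableSpace Ω] {μ : Measure Ω} [IsProbabilityMeasure μ]
  {θ : Param} {X : ℝ → Ω → ℝ} {L : ℕ}

/-- General weights `u, w` are kept for the polarization of fourth moments. Nonnegativity of the
variance is recorded because `toNNReal` would truncate a negative value. -/
theorem IsStationaryFOU.hasLaw_filtered (hX : IsStationaryFOU μ θ X)
    (hH0 : 0 < θ 0) (hH1 : θ 0 < 1) (hl : 0 < θ 1) (a : Fin (L + 1) → ℝ) (α s t u w : ℝ) :
    0 ≤ (u ^ 2 + w ^ 2) * filteredCov θ a α 0 + 2 * u * w * filteredCov θ a α (s - t) ∧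
    HasLaw (fun ω => u * filtered X a α s ω + w * filtered X a α t ω)
      (gaussianReal 0 ((u ^ 2 + w ^ 2) * filteredCov θ a α 0 +
        2 * u * w * filteredCov θ a α (s - t)).toNNReal) μ := by
  set idx : Finset (Fin 2 × Fin (L + 1)) := Finset.univ ×ˢ Finset.univ
  set c : Fin 2 × Fin (L + 1) → ℝ := fun k => ![u, w] k.1 * a k.2 with hc
  set τ : Fin 2 × Fin (L + 1) → ℝ := fun k => ![s, t] k.1 - α * (k.2 : ℕ) with hτ
  have hlaw := hX.hasLaw_sum hH0 hH1 hl idx c τ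
  have hnn := sum_rho_nonneg hH0 hH1 hl idx c τ
  have hv : ∑ i ∈ idx, ∑ j ∈ idx, c i * c j * rho θ (τ i - τ j) =
      (u ^ 2 + w ^ 2) * filteredCov θ a α 0 + 2 * u * w * filteredCov θ a α (s - t) := by
    have key : ∀ x y p r : ℝ, ∑ q : Fin (L + 1), ∑ q' : Fin (L + 1),
        p * a q * (r * a q') * rho θ (x - α * (q : ℕ) - (y - α * (q' : ℕ))) =
        p * r * filteredCov θ a α (x - y) := by
      intro x y p r
      rw [filteredCov, Finset.mul_sum]
      refine Finset.sum_congr rfl fun q _ => ?_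
      rw [Finset.mul_sum]
      refine Finset.sum_congr rfl fun q' _ => ?_
      rw [show x - α * (q : ℕ) - (y - α * (q' : ℕ)) =
        x - y - (α * (q : ℕ) - α * (q' : ℕ)) by ring]
      ring
    simp only [idx, Finset.sum_product, hc, hτ, Fin.sum_univ_two, Matrix.cons_val_zero,
      Matrix.cons_val_one, Finset.sum_add_distrib, key]
    rw [← neg_sub s t, filteredCov_neg, sub_self, sub_self]
    ring
  have hφ : (fun ω => ∑ j ∈ idx, c j * X (τ j) ω) =
      fun ω => u * filtered X a α s ω + w * filtered X a α t ω := by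
    funext ω
    simp only [idx, Finset.sum_product, hc, hτ, Fin.sum_univ_two, Matrix.cons_val_zero,
      Matrix.cons_val_one, filtered, Finset.mul_sum, mul_assoc]
  rw [hv] at hlaw hnn
  rw [hφ] at hlaw
  exact ⟨hnn, hlaw⟩

/-- Wick's formula by polarization: `12 x² y² = (x+y)⁴ + (x-y)⁴ - 2x⁴ - 2y⁴` reduces the mixed
moment to fourth moments of four centered Gaussian variables. -/
theorem IsStationaryFOU.integral_sq_mul_sq (hX : IsStationaryFOU μ θ X)
    (hH0 : 0 < θ 0) (hH1 : θ 0 < 1) (hl : 0 < θ 1) (a : Fin (L + 1) → ℝ) (α s t : ℝ) :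
    Integrable (fun ω => filtered X a α s ω ^ 2) μ ∧
    ∫ ω, filtered X a α s ω ^ 2 ∂μ = filteredCov θ a α 0 ∧
    Integrable (fun ω => filtered X a α s ω ^ 2 * filtered X a α t ω ^ 2) μ ∧
    ∫ ω, filtered X a α s ω ^ 2 * filtered X a α t ω ^ 2 ∂μ =
      filteredCov θ a α 0 ^ 2 + 2 * filteredCov θ a α (s - t) ^ 2 := by
  have h := hX.hasLaw_filtered hH0 hH1 hl a α s t
  obtain ⟨v1, l1⟩ := h 1 0
  obtain ⟨v2, l2⟩ := h 0 1
  obtain ⟨v3, l3⟩ := h 1 1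
  obtain ⟨v4, l4⟩ := h 1 (-1)
  have i1 := integrable_pow_of_hasLaw_gaussianReal l1 4
  have i2 := integrable_pow_of_hasLaw_gaussianReal l2 4
  have i3 := integrable_pow_of_hasLaw_gaussianReal l3 4
  have i4 := integrable_pow_of_hasLaw_gaussianReal l4 4
  have e : (fun ω => filtered X a α s ω ^ 2 * filtered X a α t ω ^ 2) = fun ω =>
      (1 / 12 : ℝ) * ((1 * filtered X a α s ω + 1 * filtered X a α t ω) ^ 4 +
        (1 * filtered X a α s ω + -1 * filtered X a α t ω) ^ 4 -
        2 * (1 * filtered X a α s ω + 0 * filtered X a α t ω) ^ 4 -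
        2 * (0 * filtered X a α s ω + 1 * filtered X a α t ω) ^ 4) := by
    funext ω; ring
  have j1 := integrable_pow_of_hasLaw_gaussianReal l1 2
  have k1 := integral_sq_of_hasLaw_gaussianReal l1 v1
  obtain ⟨m1, m2⟩ := integral_add_sub_sub i3 i4 i1 i2 2
  refine ⟨by simpa using j1, by simpa using k1, ?_, ?_⟩
  · rw [e]
    exact m1.const_mul _
  · rw [e, integral_const_mul, m2, integral_pow_four_of_hasLaw_gaussianReal l1 v1,
      integral_pow_four_of_hasLaw_gaussianReal l2 v2,
      integral_pow_four_of_hasLaw_gaussianReal l3 v3,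
      integral_pow_four_of_hasLaw_gaussianReal l4 v4]
    ring

/-- The second moment of sums of centered squares of the filtered process grows linearly. -/
theorem IsStationaryFOU.integral_sum_sq_le (hX : IsStationaryFOU μ θ X)
    (hH0 : 0 < θ 0) (hH1 : θ 0 < 1) (hl : 0 < θ 1) {a : Fin (L + 1) → ℝ} (ha : ∑ q, a q = 0)
    {α : ℝ} (hα : 0 < α) (s : Finset ℕ) :
    Integrable (fun ω =>
      (∑ i ∈ s, (filtered X a α (α * i) ω ^ 2 - theoreticalVariance a α θ)) ^ 2) μ ∧
    ∫ ω, (∑ i ∈ s, (filtered X a α (α * i) ω ^ 2 - theoreticalVariance a α θ)) ^ 2 ∂μ ≤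
      (2 * ∑' k : ℤ, filteredCov θ a α (α * k) ^ 2) * s.card := by
  rw [theoreticalVariance_eq_filteredCov]
  set φ := fun (i : ℕ) ω => filtered X a α (α * i) ω with hφ
  set R := filteredCov θ a α with hR
  have hmom := fun i j : ℕ => hX.integral_sq_mul_sq hH0 hH1 hl a α (α * i) (α * j)
  have e : ∀ i j, (fun ω => (φ i ω ^ 2 - R 0) * (φ j ω ^ 2 - R 0)) = fun ω =>
      φ i ω ^ 2 * φ j ω ^ 2 + R 0 ^ 2 - R 0 * φ i ω ^ 2 - R 0 * φ j ω ^ 2 := by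
    intro i j; funext ω; ring
  have hlin := fun i j => integral_add_sub_sub (hmom i j).2.2.1 (integrable_const (R 0 ^ 2))
    (hmom i j).1 (hmom j i).1 (R 0)
  have hI : ∀ i j, Integrable (fun ω => (φ i ω ^ 2 - R 0) * (φ j ω ^ 2 - R 0)) μ := by
    intro i j
    rw [e]
    exact (hlin i j).1
  have hE : ∀ i j : ℕ, ∫ ω, (φ i ω ^ 2 - R 0) * (φ j ω ^ 2 - R 0) ∂μ =
      2 * R (α * ((i : ℤ) - j : ℤ)) ^ 2 := by
    intro i j
    rw [e, (hlin i j).2, (hmom i j).2.2.2, (hmom i j).2.1, (hmom j i).2.1]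
    simp only [integral_const, probReal_univ, smul_eq_mul, Int.cast_sub, Int.cast_natCast,
      mul_sub, ← hR]
    ring
  have hsum := summable_filteredCov_sq hH0 hH1 hl ha hα
  simp only [sq (∑ i ∈ s, _), Finset.sum_mul_sum]
  refine ⟨integrable_finsetSum _ fun i _ => integrable_finsetSum _ fun j _ => hI i j, ?_⟩
  rw [integral_finsetSum _ fun i _ => integrable_finsetSum _ fun j _ => hI i j, mul_comm,
    ← nsmul_eq_mul]
  refine Finset.sum_le_card_nsmul _ _ _ fun i _ => ?_
  rw [integral_finsetSum _ fun j _ => hI i j]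
  simp only [hE]
  rw [← Finset.mul_sum]
  gcongr
  -- For fixed `i` the differences `i - j` are distinct integers, so each row of the covariance
  -- matrix sums to at most the series over `ℤ`.
  have hinj : Set.InjOn (fun j : ℕ => ((i : ℤ) - j)) s := by
    intro x _ y _ hxy
    simp only at hxy
    omega
  rw [← Finset.sum_image (f := fun k : ℤ => R (α * k) ^ 2) hinj]
  exact hsum.sum_le_tsum _ fun k _ => sq_nonneg _

end FilteredMoments

/-! ### Dyadic maximal inequality and a strong law with rate -/

/-- The sum of the squares of the sums of `x` over the dyadic blocks inside `[0, 2 ^ k)`. -/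
noncomputable def dyadicSquares (x : ℕ → ℝ) (k : ℕ) : ℝ :=
  ∑ j ∈ Finset.range k, ∑ b ∈ Finset.range (2 ^ (k - j)),
    (∑ i ∈ Finset.Ico (b * 2 ^ j) ((b + 1) * 2 ^ j), x i) ^ 2

theorem dyadicSquares_nonneg (x : ℕ → ℝ) (k : ℕ) : 0 ≤ dyadicSquares x k :=
  Finset.sum_nonneg fun _ _ => Finset.sum_nonneg fun _ _ => sq_nonneg _

/-- Clearing the binary digits of `n` one at a time splits `[0, n)` into at most one dyadic block
per scale; Cauchy-Schwarz over the `k` scales costs a factor `k`. The right side does not depend on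
`n`, so this is a maximal inequality. -/
theorem sq_sum_range_le_dyadicSquares (x : ℕ → ℝ) {k n : ℕ} (hn : n < 2 ^ k) :
    (∑ i ∈ Finset.range n, x i) ^ 2 ≤ k * dyadicSquares x k := by
  set S : ℕ → ℝ := fun m => ∑ i ∈ Finset.range m, x i with hS
  set d : ℕ → ℝ := fun j => S (n / 2 ^ j * 2 ^ j) - S (n / 2 ^ (j + 1) * 2 ^ (j + 1)) with hd
  have htel : ∑ j ∈ Finset.range k, d j = S n := by
    rw [hd, Finset.sum_range_sub' (fun j => S (n / 2 ^ j * 2 ^ j))]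
    simp [Nat.div_eq_of_lt hn, hS]
  have hdj : ∀ j ∈ Finset.range k, d j ^ 2 ≤ ∑ b ∈ Finset.range (2 ^ (k - j)),
      (∑ i ∈ Finset.Ico (b * 2 ^ j) ((b + 1) * 2 ^ j), x i) ^ 2 := by
    intro j hj
    have hjk : j < k := Finset.mem_range.mp hj
    have hc : n / 2 ^ (j + 1) = n / 2 ^ j / 2 := by rw [pow_succ, Nat.div_div_eq_div_mul]
    have hlt : n / 2 ^ j < 2 ^ (k - j) := by
      rw [Nat.div_lt_iff_lt_mul (by positivity), ← pow_add, Nat.sub_add_cancel hjk.le]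
      exact hn
    -- The parity of `n / 2 ^ j` is the binary digit at scale `j`: an even quotient contributes
    -- nothing, an odd one contributes exactly one block.
    rcases Nat.even_or_odd' (n / 2 ^ j) with ⟨c, h | h⟩
    · have hz : d j = 0 := by
        have h2 : n / 2 ^ j / 2 = c := by omega
        have h5 : n / 2 ^ (j + 1) * 2 ^ (j + 1) = 2 * c * 2 ^ j := by
          rw [hc, h2, pow_succ]; ring
        simp only [hd, h5, h, sub_self]
      rw [hz]
      simpa using Finset.sum_nonneg fun b (_ : b ∈ Finset.range (2 ^ (k - j))) =>
        sq_nonneg (∑ i ∈ Finset.Ico (b * 2 ^ j) ((b + 1) * 2 ^ j), x i)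
    · have h2 : n / 2 ^ j / 2 = c := by omega
      have hz : d j = ∑ i ∈ Finset.Ico (2 * c * 2 ^ j) ((2 * c + 1) * 2 ^ j), x i := by
        rw [Finset.sum_Ico_eq_sub _ (Nat.mul_le_mul_right _ (Nat.le_succ _))]
        have h5 : n / 2 ^ (j + 1) * 2 ^ (j + 1) = 2 * c * 2 ^ j := by
          rw [hc, h2, pow_succ]; ring
        simp only [hd, h5, h, hS]
      rw [hz]
      exact Finset.single_le_sum (f := fun b =>
        (∑ i ∈ Finset.Ico (b * 2 ^ j) ((b + 1) * 2 ^ j), x i) ^ 2) (fun b _ => sq_nonneg _)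
        (Finset.mem_range.mpr (by omega))
  change S n ^ 2 ≤ _
  rw [← htel]
  refine sq_sum_le_card_mul_sum_sq.trans ?_
  rw [Finset.card_range, dyadicSquares]
  gcongr with j hj
  exact hdj j hj

/-- The series of the `f n` has finite expectation, hence converges almost surely, and its terms
vanish. -/
theorem ae_tendsto_zero_of_summable_integral {Ω : Type*} [MeasurableSpace Ω] {μ : Measure Ω}
    {f : ℕ → Ω → ℝ} (hf : ∀ n, Integrable (f n) μ) (h0 : ∀ n ω, 0 ≤ f n ω)
    (hs : Summable fun n => ∫ ω, f n ω ∂μ) :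
    ∀ᵐ ω ∂μ, Tendsto (fun n => f n ω) atTop (𝓝 0) := by
  have h1 : ∫⁻ ω, ∑' n, ENNReal.ofReal (f n ω) ∂μ ≠ ⊤ := by
    rw [lintegral_tsum fun n => (hf n).aemeasurable.ennreal_ofReal]
    have e : ∀ n, ∫⁻ ω, ENNReal.ofReal (f n ω) ∂μ = ENNReal.ofReal (∫ ω, f n ω ∂μ) := fun n =>
      (ofReal_integral_eq_lintegral_ofReal (hf n) (Eventually.of_forall (h0 n))).symm
    simp_rw [e]
    exact hs.tsum_ofReal_ne_top
  have h2 := ae_lt_top' (AEMeasurable.tsum fun n => (hf n).aemeasurable.ennreal_ofReal) h1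
  filter_upwards [h2] with ω hω
  have h3 := ENNReal.tendsto_atTop_zero_of_tsum_ne_top hω.ne
  have h4 := (ENNReal.tendsto_toReal (ENNReal.zero_ne_top)).comp h3
  refine (h4.congr fun n => ?_).trans (by simp)
  simp [h0 n ω]

/-- A strong law with rate for sequences whose partial sums have linearly growing second moment. -/
theorem ae_tendsto_rpow_mul_sum {Ω : Type*} [MeasurableSpace Ω] {μ : Measure Ω}
    {ξ : ℕ → Ω → ℝ} {C : ℝ}
    (hint : ∀ s : Finset ℕ, Integrable (fun ω => (∑ i ∈ s, ξ i ω) ^ 2) μ)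
    (hC : ∀ s : Finset ℕ, ∫ ω, (∑ i ∈ s, ξ i ω) ^ 2 ∂μ ≤ C * s.card) {γ : ℝ} (hγ : γ < 1 / 2) :
    ∀ᵐ ω ∂μ, Tendsto (fun n : ℕ => (n : ℝ) ^ (γ - 1) * |∑ i ∈ Finset.range n, ξ i ω|)
      atTop (𝓝 0) := by
  set W : ℕ → Ω → ℝ := fun k ω => dyadicSquares (fun i => ξ i ω) k with hW
  have hWint : ∀ k, Integrable (W k) μ := fun k =>
    integrable_finsetSum _ fun j _ => integrable_finsetSum _ fun b _ => hint _
  have hWle : ∀ k : ℕ, ∫ ω, W k ω ∂μ ≤ k * (C * 2 ^ k) := by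
    intro k
    simp only [hW, dyadicSquares]
    rw [integral_finsetSum _ fun j _ => integrable_finsetSum _ fun b _ => hint _]
    have : ∀ j ∈ Finset.range k, ∫ ω, ∑ b ∈ Finset.range (2 ^ (k - j)),
        (∑ i ∈ Finset.Ico (b * 2 ^ j) ((b + 1) * 2 ^ j), ξ i ω) ^ 2 ∂μ ≤ C * 2 ^ k := by
      intro j hj
      rw [integral_finsetSum _ fun b _ => hint _]
      refine (Finset.sum_le_card_nsmul _ _ (C * 2 ^ j) fun b _ => ?_).trans (le_of_eq ?_)
      · refine (hC _).trans (le_of_eq ?_)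
        rw [Nat.card_Ico, ← Nat.sub_mul, Nat.add_sub_cancel_left, one_mul]
        push_cast
        ring
      · rw [Finset.card_range, nsmul_eq_mul]
        push_cast
        have : (2 : ℝ) ^ k = 2 ^ (k - j) * 2 ^ j := by
          rw [← pow_add, Nat.sub_add_cancel (Finset.mem_range.mp hj).le]
        rw [this]
        ring
    refine (Finset.sum_le_card_nsmul _ _ _ this).trans (le_of_eq ?_)
    rw [Finset.card_range, nsmul_eq_mul]
  -- On the dyadic scale `β ^ k` is `n^(2γ-2)` at `n = 2 ^ k`. Since `W k` has mean at most `C k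
  -- 2^k`, the weighted means are at most `C k² (2β)^k`, and `2β < 1` amounts to `γ < 1/2`.
  set β : ℝ := 2 ^ (2 * γ - 2) with hβ
  have hβ0 : 0 < β := by positivity
  have hβ1 : 2 * β < 1 := by
    rw [hβ]
    calc (2 : ℝ) * 2 ^ (2 * γ - 2) = 2 ^ (1 + (2 * γ - 2)) := by
          rw [Real.rpow_add two_pos, Real.rpow_one]
      _ < 1 := Real.rpow_lt_one_of_one_lt_of_neg one_lt_two (by linarith)
  have hsum : Summable fun k : ℕ => ∫ ω, (k * β ^ k) * W k ω ∂μ := by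
    have hg : Summable fun k : ℕ => C * ((k : ℝ) ^ 2 * (2 * β) ^ k) :=
      (summable_pow_mul_geometric_of_norm_lt_one 2 (by
        rw [Real.norm_of_nonneg (by positivity)]; exact hβ1)).mul_left C
    refine Summable.of_nonneg_of_le (fun k => integral_nonneg fun ω => ?_) (fun k => ?_) hg
    · exact mul_nonneg (by positivity) (dyadicSquares_nonneg _ _)
    · rw [integral_const_mul]
      refine (mul_le_mul_of_nonneg_left (hWle k) (by positivity)).trans (le_of_eq ?_)
      rw [mul_pow]
      ring
  have hae := ae_tendsto_zero_of_summable_integral (fun k => (hWint k).const_mul (k * β ^ k))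
    (fun k ω => mul_nonneg (by positivity) (dyadicSquares_nonneg _ _)) hsum
  filter_upwards [hae] with ω hω
  have hlog : Tendsto (fun n : ℕ => Nat.log 2 n + 1) atTop atTop := by
    refine tendsto_atTop_mono (fun n => Nat.le_succ _) ?_
    refine tendsto_atTop_atTop.mpr fun b => ⟨2 ^ b, fun n hn => ?_⟩
    exact Nat.le_log_of_pow_le one_lt_two hn
  -- The block level is `log₂ n + 1`, since `n < 2 ^ k` is required, but the weight is compared with
  -- `2 ^ log₂ n ≤ n`; the factor `β⁻¹` makes up for the shift by one.
  have h1 := (hω.comp hlog).const_mul β⁻¹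
  rw [mul_zero] at h1
  have h2 : Tendsto (fun n : ℕ => ((n : ℝ) ^ (γ - 1) * |∑ i ∈ Finset.range n, ξ i ω|) ^ 2)
      atTop (𝓝 0) := by
    refine squeeze_zero' (Eventually.of_forall fun n => sq_nonneg _) ?_ h1
    filter_upwards [eventually_gt_atTop 0] with n hn
    have hnlt : n < 2 ^ (Nat.log 2 n + 1) := Nat.lt_pow_succ_log_self one_lt_two n
    have hnge : 2 ^ Nat.log 2 n ≤ n := Nat.pow_log_le_self 2 hn.ne'
    have hn' : (0 : ℝ) < n := by exact_mod_cast hn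
    have hS := sq_sum_range_le_dyadicSquares (fun i => ξ i ω) hnlt
    have hpow : ((n : ℝ) ^ (γ - 1)) ^ 2 ≤ β ^ Nat.log 2 n := by
      rw [← Real.rpow_natCast, ← Real.rpow_mul hn'.le, hβ, ← Real.rpow_natCast, ← Real.rpow_mul
        two_pos.le, mul_comm (2 * γ - 2), Real.rpow_mul two_pos.le,
        show (γ - 1) * ((2 : ℕ) : ℝ) = 2 * γ - 2 by push_cast; ring, Real.rpow_natCast]
      refine Real.rpow_le_rpow_of_nonpos (by positivity) ?_ (by linarith)
      exact_mod_cast hnge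
    rw [mul_pow, sq_abs]
    refine (mul_le_mul hpow hS (sq_nonneg _) (by positivity)).trans (le_of_eq ?_)
    simp only [Function.comp, hW]
    rw [pow_succ]
    field_simp
  have h3 := (Real.continuous_sqrt.tendsto 0).comp h2
  rw [Real.sqrt_zero] at h3
  refine h3.congr fun n => ?_
  exact Real.sqrt_sq (by positivity)

/-! ### Small-time behaviour of the variogram -/

/-- `Γ` is convex, hence locally Lipschitz, on `(0, ∞)`, so it is Lipschitz on the compact range of
`2H + 1`; the sine factor is Lipschitz as well. Positivity of `cH` and compactness give the lower
bound. -/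
theorem exists_cH_bounds {h₁ h₂ : ℝ} (h1 : 0 < h₁) (h2 : h₂ < 1) :
    ∃ c C K : ℝ, 0 < c ∧ 0 ≤ K ∧ (∀ H ∈ Set.Icc h₁ h₂, c ≤ cH H ∧ cH H ≤ C) ∧
      ∀ H ∈ Set.Icc h₁ h₂, ∀ H' ∈ Set.Icc h₁ h₂, |cH H - cH H'| ≤ K * |H - H'| := by
  have hsub : Set.Icc (2 * h₁ + 1) (2 * h₂ + 1) ⊆ Set.Ioi 0 := fun x hx => by
    have := hx.1
    simp only [Set.mem_Ioi]
    linarith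
  obtain ⟨K, hK⟩ := LocallyLipschitzOn.exists_lipschitzOnWith_of_compact isCompact_Icc
    ((Real.convexOn_Gamma.locallyLipschitzOn isOpen_Ioi).mono hsub)
  obtain ⟨M, hM⟩ := (isCompact_Icc (a := 2 * h₁ + 1) (b := 2 * h₂ + 1)).exists_bound_of_continuousOn
    hK.continuousOn
  have hmem : ∀ H ∈ Set.Icc h₁ h₂, 2 * H + 1 ∈ Set.Icc (2 * h₁ + 1) (2 * h₂ + 1) :=
    fun H hH => ⟨by linarith [hH.1], by linarith [hH.2]⟩
  have hlip : ∀ H ∈ Set.Icc h₁ h₂, ∀ H' ∈ Set.Icc h₁ h₂,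
      |cH H - cH H'| ≤ (2 * K + |M| * Real.pi) * |H - H'| := by
    intro H hH H' hH'
    have e1 := hK.dist_le_mul _ (hmem H hH) _ (hmem H' hH')
    rw [Real.dist_eq, Real.dist_eq, show 2 * H + 1 - (2 * H' + 1) = 2 * (H - H') by ring, abs_mul,
      abs_two] at e1
    have e2 := hM _ (hmem H' hH')
    rw [Real.norm_eq_abs] at e2
    have e3 : |Real.sin (Real.pi * H) - Real.sin (Real.pi * H')| ≤ Real.pi * |H - H'| := by
      have := Real.abs_sin_sub_sin_le (Real.pi * H) (Real.pi * H')
      rwa [← mul_sub, abs_mul, abs_of_pos Real.pi_pos] at this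
    have e4 := Real.abs_sin_le_one (Real.pi * H)
    have e : cH H - cH H' = ((Real.Gamma (2 * H + 1) - Real.Gamma (2 * H' + 1)) *
        Real.sin (Real.pi * H) + Real.Gamma (2 * H' + 1) *
        (Real.sin (Real.pi * H) - Real.sin (Real.pi * H'))) / (2 * Real.pi) := by
      unfold cH; ring
    rw [e, abs_div, abs_of_pos (by positivity : (0 : ℝ) < 2 * Real.pi)]
    have h2pi : 1 ≤ 2 * Real.pi := by linarith [Real.pi_gt_three]
    refine (div_le_self (abs_nonneg _) h2pi).trans ((abs_add_le _ _).trans ?_)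
    rw [abs_mul, abs_mul, add_mul]
    refine add_le_add ?_ ?_
    · refine (mul_le_mul e1 e4 (abs_nonneg _) (by positivity)).trans (le_of_eq (by ring))
    · refine (mul_le_mul (e2.trans (le_abs_self M)) e3 (abs_nonneg _) (abs_nonneg _)).trans
        (le_of_eq (by ring))
  have hcont : ContinuousOn cH (Set.Icc h₁ h₂) := by
    have : LipschitzOnWith (Real.toNNReal (2 * K + |M| * Real.pi)) cH (Set.Icc h₁ h₂) := by
      refine LipschitzOnWith.of_dist_le_mul fun x hx y hy => ?_
      rw [Real.coe_toNNReal _ (by positivity), Real.dist_eq, Real.dist_eq]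
      exact hlip x hx y hy
    exact this.continuousOn
  rcases Set.eq_empty_or_nonempty (Set.Icc h₁ h₂) with he | hne
  · rw [he]
    exact ⟨1, 1, 0, one_pos, le_rfl, by simp, by simp⟩
  obtain ⟨x, hx, hxm⟩ := isCompact_Icc.exists_isMinOn hne hcont
  obtain ⟨y, hy, hym⟩ := isCompact_Icc.exists_isMaxOn hne hcont
  exact ⟨cH x, cH y, 2 * K + |M| * Real.pi,
    cH_pos (by linarith [hx.1]) (by linarith [hx.2]), by positivity,
    fun H hH => ⟨hxm hH, hym hH⟩, hlip⟩

/-- The relative deviation of the variogram of the Ornstein-Uhlenbeck process from the variogram of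
fractional Brownian motion. -/
noncomputable def defect (H lam t : ℝ) : ℝ :=
  4 * cH H * ∫ x in Set.Ioi (0 : ℝ),
    (1 - Real.cos (t * x)) * (t * x) ^ (-(2 * H)) * (lam ^ 2 * x⁻¹ / (lam ^ 2 + x ^ 2))

/-- The exponent `1 - h₂` serves every `H ≤ h₂` at once: for `z ≤ 1` the left side is of order
`z^(2-2H)` and `2 - 2H ≥ 1 - h₂`, while for `z ≥ 1` it is bounded. -/
theorem one_sub_cos_mul_rpow_le_rpow {h₂ H z : ℝ} (hH0 : 0 < H) (hH : H ≤ h₂) (h2 : h₂ < 1)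
    (hz : 0 < z) :
    0 ≤ (1 - Real.cos z) * z ^ (-(2 * H)) ∧
      (1 - Real.cos z) * z ^ (-(2 * H)) ≤ 2 * z ^ (1 - h₂) := by
  have hc : 0 ≤ 1 - Real.cos z := by linarith [Real.cos_le_one z]
  refine ⟨mul_nonneg hc (by positivity), ?_⟩
  rcases le_total z 1 with h | h
  · calc (1 - Real.cos z) * z ^ (-(2 * H)) ≤ (2 * z ^ 2) * z ^ (-(2 * H)) := by
          gcongr
          have := one_sub_cos_le_sq z
          nlinarith
      _ = 2 * z ^ (2 - 2 * H) := by
          rw [show 2 - 2 * H = 2 + -(2 * H) by ring, Real.rpow_add hz, Real.rpow_two]; ring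
      _ ≤ 2 * z ^ (1 - h₂) := by
          gcongr 2 * ?_
          exact Real.rpow_le_rpow_of_exponent_ge hz h (by linarith)
  · calc (1 - Real.cos z) * z ^ (-(2 * H)) ≤ 2 * 1 := by
          gcongr
          · linarith [Real.neg_one_le_cos z]
          · exact Real.rpow_le_one_of_one_le_of_nonpos h (by linarith)
      _ ≤ 2 * z ^ (1 - h₂) := by
          gcongr
          exact Real.one_le_rpow h (by linarith)

theorem abs_exp_sub_exp_le {u v M : ℝ} (hu : Real.exp u ≤ M) (hv : Real.exp v ≤ M) :
    |Real.exp u - Real.exp v| ≤ M * |u - v| := by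
  wlog h : u ≤ v generalizing u v
  · rw [abs_sub_comm, abs_sub_comm u]
    exact this hv hu (le_of_not_ge h)
  rw [abs_sub_comm, abs_sub_comm u, abs_of_nonneg (sub_nonneg.mpr (Real.exp_le_exp.mpr h)),
    abs_of_nonneg (sub_nonneg.mpr h)]
  have h1 : Real.exp u = Real.exp v * Real.exp (u - v) := by rw [← Real.exp_add]; ring_nf
  have h2 := Real.add_one_le_exp (u - v)
  have h3 := Real.exp_pos v
  calc Real.exp v - Real.exp u = Real.exp v * (1 - Real.exp (u - v)) := by rw [h1]; ring
    _ ≤ Real.exp v * (v - u) := mul_le_mul_of_nonneg_left (by linarith) h3.le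
    _ ≤ M * (v - u) := mul_le_mul_of_nonneg_right hv (sub_nonneg.mpr h)

/-- Varying `H` costs a factor `|log z|`. For `z ≤ 1` the size is `z^(2(1-h₂))`, and half of this
power absorbs the logarithm; for `z ≥ 1` one has `log z ≤ z^(1-h₂) / (1 - h₂)`. -/
theorem abs_one_sub_cos_mul_rpow_sub_le {h₂ H H' z : ℝ} (hH0 : 0 < H) (hH : H ≤ h₂)
    (hH0' : 0 < H') (hH' : H' ≤ h₂) (h2 : h₂ < 1) (hz : 0 < z) :
    |(1 - Real.cos z) * z ^ (-(2 * H)) - (1 - Real.cos z) * z ^ (-(2 * H'))| ≤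
      4 / (1 - h₂) * z ^ (1 - h₂) * |H - H'| := by
  have hc : 0 ≤ 1 - Real.cos z := by linarith [Real.cos_le_one z]
  have hε : 0 < 1 - h₂ := by linarith
  rw [← mul_sub, abs_mul, abs_of_nonneg hc]
  have key : ∀ M : ℝ, z ^ (-(2 * H)) ≤ M → z ^ (-(2 * H')) ≤ M →
      |z ^ (-(2 * H)) - z ^ (-(2 * H'))| ≤ M * (2 * |Real.log z| * |H - H'|) := by
    intro M h1 h2
    rw [Real.rpow_def_of_pos hz] at h1 h2 ⊢
    rw [Real.rpow_def_of_pos hz]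
    refine (abs_exp_sub_exp_le h1 h2).trans (le_of_eq ?_)
    rw [show Real.log z * -(2 * H) - Real.log z * -(2 * H') = -(2 * Real.log z * (H - H')) by ring,
      abs_neg, abs_mul, abs_mul, abs_two]
  rcases le_total z 1 with h | h
  · have h1 := key (z ^ (-(2 * h₂)))
      (Real.rpow_le_rpow_of_exponent_ge hz h (by linarith))
      (Real.rpow_le_rpow_of_exponent_ge hz h (by linarith))
    have h3 := (Real.abs_log_mul_self_rpow_lt z (1 - h₂) hz h hε).le
    rw [abs_mul, abs_of_pos (Real.rpow_pos_of_pos hz _)] at h3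
    calc (1 - Real.cos z) * |z ^ (-(2 * H)) - z ^ (-(2 * H'))|
        ≤ (2 * z ^ 2) * (z ^ (-(2 * h₂)) * (2 * |Real.log z| * |H - H'|)) := by
          gcongr
          have := one_sub_cos_le_sq z
          nlinarith
      _ = 4 * (|Real.log z| * z ^ (1 - h₂)) * z ^ (1 - h₂) * |H - H'| := by
          have : z ^ 2 * z ^ (-(2 * h₂)) = z ^ (1 - h₂) * z ^ (1 - h₂) := by
            rw [← Real.rpow_two, ← Real.rpow_add hz, ← Real.rpow_add hz]; ring_nf
          linear_combination 4 * |Real.log z| * |H - H'| * this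
      _ ≤ 4 * (1 / (1 - h₂)) * z ^ (1 - h₂) * |H - H'| := by gcongr
      _ = _ := by ring
  · have h1 := key 1 (Real.rpow_le_one_of_one_le_of_nonpos h (by linarith))
      (Real.rpow_le_one_of_one_le_of_nonpos h (by linarith))
    have h3 := Real.log_le_rpow_div hz.le hε
    rw [← abs_of_nonneg (Real.log_nonneg h)] at h3
    calc (1 - Real.cos z) * |z ^ (-(2 * H)) - z ^ (-(2 * H'))|
        ≤ 2 * (1 * (2 * |Real.log z| * |H - H'|)) := by
          gcongr
          linarith [Real.neg_one_le_cos z]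
      _ ≤ 2 * (1 * (2 * (z ^ (1 - h₂) / (1 - h₂)) * |H - H'|)) := by gcongr
      _ = _ := by ring

theorem integrableOn_rpow_div {l p : ℝ} (hl : 0 < l) (hp : -1 < p) (hp' : p < 1) :
    IntegrableOn (fun x : ℝ => x ^ p / (l ^ 2 + x ^ 2)) (Set.Ioi 0) := by
  refine integrableOn_Ioi_of_rpow_bounds (C := 1 + (l ^ 2)⁻¹) hp (q := p - 2) (by linarith)
    (Measurable.aestronglyMeasurable (by fun_prop)) ?_ ?_
  · intro x hx _
    rw [abs_of_nonneg (by positivity), div_eq_mul_inv, mul_comm]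
    gcongr
    calc (l ^ 2 + x ^ 2)⁻¹ ≤ (l ^ 2)⁻¹ := by gcongr; nlinarith
      _ ≤ 1 + (l ^ 2)⁻¹ := by linarith
  · intro x hx
    have hx0 : 0 < x := by linarith
    rw [abs_of_nonneg (by positivity), Real.rpow_sub hx0, Real.rpow_two]
    calc x ^ p / (l ^ 2 + x ^ 2) ≤ x ^ p / x ^ 2 := by gcongr; nlinarith [sq_nonneg l]
      _ ≤ (1 + (l ^ 2)⁻¹) * (x ^ p / x ^ 2) := by
        refine le_mul_of_one_le_left (by positivity) ?_
        have : 0 < (l ^ 2)⁻¹ := by positivity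
        linarith

theorem defect_integrand_le {l₁ l₂ lam ε t x : ℝ} (hl₁ : 0 < l₁) (h1 : l₁ ≤ lam) (h2 : lam ≤ l₂)
    (ht : 0 < t) (hx : 0 < x) :
    (t * x) ^ ε * (lam ^ 2 * x⁻¹ / (lam ^ 2 + x ^ 2)) ≤
      l₂ ^ 2 * t ^ ε * (x ^ (ε - 1) / (l₁ ^ 2 + x ^ 2)) := by
  rw [Real.mul_rpow ht.le hx.le, Real.rpow_sub_one hx.ne']
  have hlam : 0 < lam := by linarith
  calc t ^ ε * x ^ ε * (lam ^ 2 * x⁻¹ / (lam ^ 2 + x ^ 2))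
      ≤ t ^ ε * x ^ ε * (l₂ ^ 2 * x⁻¹ / (l₁ ^ 2 + x ^ 2)) := by gcongr
    _ = _ := by ring

/-- Uniform bounds for `defect`, with the modulus of continuity in the Hurst parameter. -/
theorem exists_defect_bounds {h₁ h₂ l₁ l₂ : ℝ} (hh₁ : 0 < h₁) (hh₂ : h₂ < 1) (hl₁ : 0 < l₁) :
    ∃ C, 0 ≤ C ∧ ∀ H ∈ Set.Icc h₁ h₂, ∀ lam ∈ Set.Icc l₁ l₂, ∀ t > 0,
      0 ≤ defect H lam t ∧ defect H lam t ≤ C * t ^ (1 - h₂) ∧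
      ∀ H' ∈ Set.Icc h₁ h₂, |defect H lam t - defect H' lam t| ≤ C * t ^ (1 - h₂) * |H - H'| := by
  obtain ⟨c, M, K, hc, hK, hcM, hlip⟩ := exists_cH_bounds hh₁ hh₂
  rcases Set.eq_empty_or_nonempty (Set.Icc h₁ h₂) with he | ⟨H₀, hH₀⟩
  · rw [he]; exact ⟨0, le_rfl, by simp⟩
  have hM : 0 ≤ M := by linarith [(hcM H₀ hH₀).1, (hcM H₀ hH₀).2]
  set ε := 1 - h₂ with hεd
  have hε : 0 < ε := by linarith
  have hε1 : ε < 1 := by linarith [hH₀.1, hH₀.2]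
  have hJint := integrableOn_rpow_div (p := ε - 1) hl₁ (by linarith) (by linarith)
  set J := ∫ x in Set.Ioi (0 : ℝ), x ^ (ε - 1) / (l₁ ^ 2 + x ^ 2) with hJ
  have hJ0 : 0 ≤ J := setIntegral_nonneg measurableSet_Ioi fun x hx => by
    have : (0 : ℝ) < x := hx
    positivity
  set f : ℝ → ℝ → ℝ → ℝ → ℝ := fun H lam t x =>
    (1 - Real.cos (t * x)) * (t * x) ^ (-(2 * H)) * (lam ^ 2 * x⁻¹ / (lam ^ 2 + x ^ 2)) with hf
  have hfb : ∀ H ∈ Set.Icc h₁ h₂, ∀ lam ∈ Set.Icc l₁ l₂, ∀ t > 0, ∀ x > 0,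
      0 ≤ f H lam t x ∧
      f H lam t x ≤ 2 * l₂ ^ 2 * t ^ ε * (x ^ (ε - 1) / (l₁ ^ 2 + x ^ 2)) := by
    intro H hH lam hlam t ht x hx
    have hb := one_sub_cos_mul_rpow_le_rpow (by linarith [hH.1]) hH.2 hh₂ (mul_pos ht hx)
    have hlam0 : 0 < lam := by linarith [hlam.1]
    refine ⟨mul_nonneg hb.1 (by positivity), ?_⟩
    calc f H lam t x ≤ 2 * (t * x) ^ ε * (lam ^ 2 * x⁻¹ / (lam ^ 2 + x ^ 2)) := by
          exact mul_le_mul_of_nonneg_right hb.2 (by positivity)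
      _ = 2 * ((t * x) ^ ε * (lam ^ 2 * x⁻¹ / (lam ^ 2 + x ^ 2))) := by ring
      _ ≤ 2 * (l₂ ^ 2 * t ^ ε * (x ^ (ε - 1) / (l₁ ^ 2 + x ^ 2))) := by
          exact mul_le_mul_of_nonneg_left
            (defect_integrand_le hl₁ hlam.1 hlam.2 ht hx) (by norm_num)
      _ = _ := by ring
  have hfint : ∀ H ∈ Set.Icc h₁ h₂, ∀ lam ∈ Set.Icc l₁ l₂, ∀ t > 0,
      IntegrableOn (f H lam t) (Set.Ioi 0) := by
    intro H hH lam hlam t ht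
    refine Integrable.mono' (hJint.const_mul (2 * l₂ ^ 2 * t ^ ε))
      (Measurable.aestronglyMeasurable (by fun_prop)) ?_
    refine ae_restrict_of_forall_mem measurableSet_Ioi fun x hx => ?_
    have := hfb H hH lam hlam t ht x hx
    rw [Real.norm_of_nonneg this.1]
    exact this.2
  have hint0 : ∀ H ∈ Set.Icc h₁ h₂, ∀ lam ∈ Set.Icc l₁ l₂, ∀ t > 0,
      0 ≤ ∫ x in Set.Ioi (0 : ℝ), f H lam t x := fun H hH lam hlam t ht =>
    setIntegral_nonneg measurableSet_Ioi fun x hx => (hfb H hH lam hlam t ht x hx).1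
  have hintle : ∀ H ∈ Set.Icc h₁ h₂, ∀ lam ∈ Set.Icc l₁ l₂, ∀ t > 0,
      ∫ x in Set.Ioi (0 : ℝ), f H lam t x ≤ 2 * l₂ ^ 2 * t ^ ε * J := by
    intro H hH lam hlam t ht
    rw [hJ, ← integral_const_mul]
    exact setIntegral_mono_on (hfint H hH lam hlam t ht) (hJint.const_mul _) measurableSet_Ioi
      fun x hx => (hfb H hH lam hlam t ht x hx).2
  have hdiff : ∀ H ∈ Set.Icc h₁ h₂, ∀ H' ∈ Set.Icc h₁ h₂, ∀ lam ∈ Set.Icc l₁ l₂, ∀ t > 0,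
      |(∫ x in Set.Ioi (0 : ℝ), f H lam t x) - ∫ x in Set.Ioi (0 : ℝ), f H' lam t x| ≤
        4 / ε * l₂ ^ 2 * t ^ ε * J * |H - H'| := by
    intro H hH H' hH' lam hlam t ht
    have hlam0 : 0 < lam := by linarith [hlam.1]
    rw [← integral_sub (hfint H hH lam hlam t ht) (hfint H' hH' lam hlam t ht)]
    have e : 4 / ε * l₂ ^ 2 * t ^ ε * J * |H - H'| = ∫ x in Set.Ioi (0 : ℝ),
        (4 / ε * l₂ ^ 2 * t ^ ε * |H - H'|) * (x ^ (ε - 1) / (l₁ ^ 2 + x ^ 2)) := by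
      rw [integral_const_mul, ← hJ]; ring
    rw [e, ← Real.norm_eq_abs]
    refine norm_integral_le_of_norm_le (hJint.const_mul _) ?_
    refine ae_restrict_of_forall_mem measurableSet_Ioi fun x hx => ?_
    have hx0 : (0 : ℝ) < x := hx
    have hb := abs_one_sub_cos_mul_rpow_sub_le (by linarith [hH.1]) hH.2 (by linarith [hH'.1])
      hH'.2 hh₂ (mul_pos ht hx0)
    rw [Real.norm_eq_abs]
    simp only [hf]
    rw [← sub_mul, abs_mul, abs_of_nonneg (by positivity : 0 ≤ lam ^ 2 * x⁻¹ / (lam ^ 2 + x ^ 2))]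
    calc _ ≤ 4 / (1 - h₂) * (t * x) ^ (1 - h₂) * |H - H'| *
          (lam ^ 2 * x⁻¹ / (lam ^ 2 + x ^ 2)) := by gcongr
      _ = (4 / ε * |H - H'|) * ((t * x) ^ ε * (lam ^ 2 * x⁻¹ / (lam ^ 2 + x ^ 2))) := by
          rw [← hεd]; ring
      _ ≤ (4 / ε * |H - H'|) * (l₂ ^ 2 * t ^ ε * (x ^ (ε - 1) / (l₁ ^ 2 + x ^ 2))) := by
          exact mul_le_mul_of_nonneg_left
            (defect_integrand_le hl₁ hlam.1 hlam.2 ht hx0) (by positivity)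
      _ = _ := by ring
  -- The three summands bound the size of the defect, the effect of varying `cH`, and the effect of
  -- varying `H` inside the integral.
  refine ⟨4 * M * (2 * l₂ ^ 2 * J) + 4 * K * (2 * l₂ ^ 2 * J) + 4 * M * (4 / ε * l₂ ^ 2 * J),
    by positivity, fun H hH lam hlam t ht => ⟨?_, ?_, fun H' hH' => ?_⟩⟩
  · exact mul_nonneg (by linarith [(hcM H hH).1]) (hint0 H hH lam hlam t ht)
  · calc defect H lam t ≤ 4 * M * (2 * l₂ ^ 2 * t ^ ε * J) := by
          unfold defect
          gcongr
          · exact hint0 H hH lam hlam t ht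
          · exact (hcM H hH).2
          · exact hintle H hH lam hlam t ht
      _ = 4 * M * (2 * l₂ ^ 2 * J) * t ^ ε := by ring
      _ ≤ _ := by
          gcongr
          have : 0 ≤ 4 * K * (2 * l₂ ^ 2 * J) := by positivity
          have : 0 ≤ 4 * M * (4 / ε * l₂ ^ 2 * J) := by positivity
          linarith
  · have e : defect H lam t - defect H' lam t =
        4 * (cH H - cH H') * (∫ x in Set.Ioi (0 : ℝ), f H lam t x) +
        4 * cH H' * ((∫ x in Set.Ioi (0 : ℝ), f H lam t x) -
          ∫ x in Set.Ioi (0 : ℝ), f H' lam t x) := by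
      simp only [defect, hf]; ring
    have hcH' := hcM H' hH'
    rw [e]
    refine (abs_add_le _ _).trans ?_
    rw [abs_mul, abs_mul, abs_mul, abs_mul, abs_of_pos (by linarith : 0 < cH H'),
      abs_of_nonneg (hint0 H hH lam hlam t ht), abs_of_pos (by norm_num : (0 : ℝ) < 4)]
    have p1 : 4 * |cH H - cH H'| * (∫ x in Set.Ioi (0 : ℝ), f H lam t x) ≤
        4 * (K * |H - H'|) * (2 * l₂ ^ 2 * t ^ ε * J) := by
      gcongr
      · exact hint0 H hH lam hlam t ht
      · exact hlip H hH H' hH'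
      · exact hintle H hH lam hlam t ht
    have p2 : 4 * cH H' * |(∫ x in Set.Ioi (0 : ℝ), f H lam t x) -
        ∫ x in Set.Ioi (0 : ℝ), f H' lam t x| ≤
        4 * M * (4 / ε * l₂ ^ 2 * t ^ ε * J * |H - H'|) := by
      gcongr
      · exact hcH'.2
      · exact hdiff H hH H' hH' lam hlam t ht
    have p3 : 0 ≤ 4 * M * (2 * l₂ ^ 2 * J) * t ^ ε * |H - H'| := by positivity
    calc _ ≤ 4 * (K * |H - H'|) * (2 * l₂ ^ 2 * t ^ ε * J) +
          4 * M * (4 / ε * l₂ ^ 2 * t ^ ε * J * |H - H'|) := add_le_add p1 p2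
      _ ≤ _ := by linarith

/-- The variogram of the stationary fractional Ornstein-Uhlenbeck process. -/
theorem rho_zero_sub_rho {θ : Param} (hH0 : 0 < θ 0) (hH1 : θ 0 < 1) (hl : 0 < θ 1) {t : ℝ}
    (ht : 0 < t) :
    rho θ 0 - rho θ t = θ 2 ^ 2 / 2 * t ^ (2 * θ 0) * (1 - defect (θ 0) (θ 1) t) := by
  unfold rho
  generalize θ 2 = σ
  have hI := fun s => integrableOn_rho_integrand hH0 hH1 hl s
  revert hH0 hH1 hl hI
  generalize θ 0 = H
  generalize θ 1 = lam
  intro hH0 hH1 hl hI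
  have hA := integrableOn_one_sub_cos hH0 hH1 t
  have hAv := abs_rpow_eq_integral hH0 hH1 t
  rw [abs_of_pos ht] at hAv
  have hI0t : IntegrableOn (fun x : ℝ => Real.cos (0 * x) * (x ^ (1 - 2 * H) / (lam ^ 2 + x ^ 2)) -
      Real.cos (t * x) * (x ^ (1 - 2 * H) / (lam ^ 2 + x ^ 2))) (Set.Ioi 0) := (hI 0).sub (hI t)
  -- The spectral densities `x^(-1-2H)` of the noise and `x^(1-2H) / (lam² + x²)` of the process
  -- differ by `lam² x^(-1-2H) / (lam² + x²)`, which is the weight in `defect` once `t^(2H)` is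
  -- factored out.
  have hsub : (∫ x in Set.Ioi (0 : ℝ), (1 - Real.cos (t * x)) * x ^ (-1 - 2 * H)) -
      ((∫ x in Set.Ioi (0 : ℝ), Real.cos (0 * x) * (x ^ (1 - 2 * H) / (lam ^ 2 + x ^ 2))) -
        ∫ x in Set.Ioi (0 : ℝ), Real.cos (t * x) * (x ^ (1 - 2 * H) / (lam ^ 2 + x ^ 2))) =
      t ^ (2 * H) * ∫ x in Set.Ioi (0 : ℝ),
        (1 - Real.cos (t * x)) * (t * x) ^ (-(2 * H)) * (lam ^ 2 * x⁻¹ / (lam ^ 2 + x ^ 2)) := by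
    rw [← integral_sub (hI 0) (hI t), ← integral_sub hA hI0t, ← integral_const_mul]
    refine setIntegral_congr_fun measurableSet_Ioi fun x hx => ?_
    have hx0 : (0 : ℝ) < x := hx
    have e1 : t ^ (2 * H) * (t * x) ^ (-(2 * H)) = x ^ (-(2 * H)) := by
      rw [Real.mul_rpow ht.le hx0.le, ← mul_assoc, ← Real.rpow_add ht]
      simp
    have e2 : x ^ (-1 - 2 * H) = x ^ (-(2 * H)) * x⁻¹ := by
      rw [show -1 - 2 * H = -(2 * H) - 1 by ring, Real.rpow_sub_one hx0.ne', div_eq_mul_inv]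
    have e3 : x ^ (1 - 2 * H) = x ^ (-(2 * H)) * x := by
      rw [show 1 - 2 * H = -(2 * H) + 1 by ring, Real.rpow_add_one hx0.ne']
    have hne : lam ^ 2 + x ^ 2 ≠ 0 := by positivity
    simp only [zero_mul, Real.cos_zero]
    calc _ = (1 - Real.cos (t * x)) * x ^ (-(2 * H)) * (lam ^ 2 * x⁻¹ / (lam ^ 2 + x ^ 2)) := by
          rw [e2, e3]; field_simp; ring
      _ = _ := by rw [← e1]; ring
  have hd : t ^ (2 * H) * defect H lam t = 4 * cH H * (t ^ (2 * H) * ∫ x in Set.Ioi (0 : ℝ),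
        (1 - Real.cos (t * x)) * (t * x) ^ (-(2 * H)) * (lam ^ 2 * x⁻¹ / (lam ^ 2 + x ^ 2))) := by
    unfold defect; ring
  rw [← hsub] at hd
  linear_combination σ ^ 2 / 2 * (hd - hAv)

theorem integrableOn_defect_integrand {H lam t : ℝ} (hH0 : 0 < H) (hH1 : H < 1) (hl : 0 < lam)
    (ht : 0 < t) :
    IntegrableOn (fun x : ℝ => (1 - Real.cos (t * x)) * (t * x) ^ (-(2 * H)) *
      (lam ^ 2 * x⁻¹ / (lam ^ 2 + x ^ 2))) (Set.Ioi 0) := by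
  refine Integrable.mono' ((integrableOn_rpow_div (p := 1 - H - 1) hl (by linarith)
    (by linarith)).const_mul (2 * lam ^ 2 * t ^ (1 - H)))
    (Measurable.aestronglyMeasurable (by fun_prop)) ?_
  refine ae_restrict_of_forall_mem measurableSet_Ioi fun x hx => ?_
  have hx0 : (0 : ℝ) < x := hx
  have hb := one_sub_cos_mul_rpow_le_rpow hH0 le_rfl hH1 (mul_pos ht hx0)
  rw [Real.norm_of_nonneg (mul_nonneg hb.1 (by positivity))]
  calc _ ≤ 2 * (t * x) ^ (1 - H) * (lam ^ 2 * x⁻¹ / (lam ^ 2 + x ^ 2)) :=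
        mul_le_mul_of_nonneg_right hb.2 (by positivity)
    _ = 2 * ((t * x) ^ (1 - H) * (lam ^ 2 * x⁻¹ / (lam ^ 2 + x ^ 2))) := by ring
    _ ≤ 2 * (lam ^ 2 * t ^ (1 - H) * (x ^ (1 - H - 1) / (lam ^ 2 + x ^ 2))) :=
        mul_le_mul_of_nonneg_left (defect_integrand_le hl le_rfl le_rfl ht hx0) (by norm_num)
    _ = _ := by ring

/-- The Taylor remainder, of order `z⁴`, is weakened to `z^(2+h)`: the full order would make the
spectral integral of the remainder diverge at infinity, and any `h > 0` still yields a vanishing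
relative error. -/
theorem abs_one_sub_cos_sub_half_sq_le {h z : ℝ} (hh : 0 < h) (hh1 : h ≤ 1) (hz : 0 < z) :
    |1 - Real.cos z - z ^ 2 / 2| ≤ z ^ 2 * z ^ h := by
  rcases le_total z 1 with h1 | h1
  · have hb := Real.cos_bound (x := z) (by rwa [abs_of_pos hz])
    rw [abs_of_pos hz] at hb
    have e : 1 - Real.cos z - z ^ 2 / 2 = -(Real.cos z - (1 - z ^ 2 / 2)) := by ring
    rw [e, abs_neg]
    have hp : z ^ 2 ≤ z ^ h := by
      rw [← Real.rpow_two]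
      exact Real.rpow_le_rpow_of_exponent_ge hz h1 (by linarith)
    have h2 : 0 < z ^ 2 := by positivity
    nlinarith
  · have hb := Real.one_sub_sq_div_two_le_cos (x := z)
    have hp : 1 ≤ z ^ h := Real.one_le_rpow h1 hh.le
    have h2 : 0 < z ^ 2 := by positivity
    rw [abs_le]
    constructor <;> nlinarith [Real.cos_le_one z]

theorem integrableOn_rpow_div_sq {l p : ℝ} (hl : 0 < l) (hp : -1 < p) (hp' : p < 3) :
    IntegrableOn (fun x : ℝ => x ^ p / (l ^ 2 + x ^ 2) ^ 2) (Set.Ioi 0) := by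
  refine integrableOn_Ioi_of_rpow_bounds (C := 1 + ((l ^ 2) ^ 2)⁻¹) hp (q := p - 4) (by linarith)
    (Measurable.aestronglyMeasurable (by fun_prop)) ?_ ?_
  · intro x hx _
    rw [abs_of_nonneg (by positivity), div_eq_mul_inv, mul_comm]
    gcongr
    calc ((l ^ 2 + x ^ 2) ^ 2)⁻¹ ≤ ((l ^ 2) ^ 2)⁻¹ := by gcongr; nlinarith
      _ ≤ 1 + ((l ^ 2) ^ 2)⁻¹ := by linarith
  · intro x hx
    have hx0 : 0 < x := by linarith
    have e : x ^ (p - 4) = x ^ p / (x ^ 2) ^ 2 := by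
      rw [Real.rpow_sub hx0, ← pow_mul]; norm_cast
    rw [abs_of_nonneg (by positivity), e]
    calc x ^ p / (l ^ 2 + x ^ 2) ^ 2 ≤ x ^ p / (x ^ 2) ^ 2 := by gcongr; nlinarith [sq_nonneg l]
      _ ≤ (1 + ((l ^ 2) ^ 2)⁻¹) * (x ^ p / (x ^ 2) ^ 2) := by
        refine le_mul_of_one_le_left (by positivity) ?_
        have : 0 < ((l ^ 2) ^ 2)⁻¹ := by positivity
        linarith

theorem rpow_le_one_add_rpow {x p q : ℝ} (hx : 0 < x) (hp : 0 ≤ p) (hpq : p ≤ q) :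
    x ^ p ≤ x ^ (0 : ℝ) + x ^ q := by
  rw [Real.rpow_zero]
  rcases le_total x 1 with h | h
  · linarith [Real.rpow_le_one hx.le h hp, Real.rpow_pos_of_pos hx q]
  · linarith [Real.rpow_le_rpow_of_exponent_le h hpq]

theorem defect_sub_defect {H lam lam' t : ℝ} (hH0 : 0 < H) (hH1 : H < 1) (hl : 0 < lam)
    (hl' : 0 < lam') (ht : 0 < t) :
    defect H lam' t - defect H lam t = 4 * cH H * (lam' ^ 2 - lam ^ 2) *
      ∫ x in Set.Ioi (0 : ℝ), (1 - Real.cos (t * x)) * (t * x) ^ (-(2 * H)) *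
        (x / ((lam ^ 2 + x ^ 2) * (lam' ^ 2 + x ^ 2))) := by
  unfold defect
  rw [← mul_sub, ← integral_sub (integrableOn_defect_integrand hH0 hH1 hl' ht)
    (integrableOn_defect_integrand hH0 hH1 hl ht), mul_assoc (4 * cH H) (lam' ^ 2 - lam ^ 2),
    ← integral_const_mul (lam' ^ 2 - lam ^ 2)]
  refine congrArg (4 * cH H * ·) (setIntegral_congr_fun measurableSet_Ioi fun x hx => ?_)
  have hx0 : (0 : ℝ) < x := hx
  have h1 : lam ^ 2 + x ^ 2 ≠ 0 := by positivity
  have h2 : lam' ^ 2 + x ^ 2 ≠ 0 := by positivity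
  generalize (t * x) ^ (-(2 * H)) = y
  field_simp
  ring

/-- First order expansion, for small times, of the dependence of `defect` on the mean reversion
rate. -/
theorem exists_defect_sub_defect_expansion {h₁ h₂ l₁ l₂ : ℝ} (hh₁ : 0 < h₁) (hh₂ : h₂ < 1)
    (hl₁ : 0 < l₁) :
    ∃ d D E : ℝ, 0 < d ∧ 0 ≤ D ∧ 0 ≤ E ∧
      ∀ H ∈ Set.Icc h₁ h₂, ∀ lam ∈ Set.Icc l₁ l₂, ∀ lam' ∈ Set.Icc l₁ l₂, ∃ p : ℝ,
        d * |lam' - lam| ≤ |p| ∧ |p| ≤ D * |lam' - lam| ∧ ∀ t > 0,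
          |defect H lam' t - defect H lam t - p * t ^ (2 - 2 * H)| ≤
            E * t ^ h₁ * t ^ (2 - 2 * H) * |lam' - lam| := by
  obtain ⟨c, M, K, hc, -, hcM, -⟩ := exists_cH_bounds hh₁ hh₂
  rcases Set.eq_empty_or_nonempty (Set.Icc h₁ h₂) with he | ⟨H₀, hH₀⟩
  · rw [he]; exact ⟨1, 0, 0, one_pos, le_rfl, le_rfl, by simp⟩
  rcases Set.eq_empty_or_nonempty (Set.Icc l₁ l₂) with he | ⟨l₀, hl₀⟩
  · rw [he]; exact ⟨1, 0, 0, one_pos, le_rfl, le_rfl, by simp⟩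
  have hM : 0 ≤ M := by linarith [(hcM H₀ hH₀).1, (hcM H₀ hH₀).2]
  have hl₂ : 0 < l₂ := by linarith [hl₀.1, hl₀.2]
  have h1lt : h₁ < 1 := by linarith [hH₀.1, hH₀.2]
  have hJint : IntegrableOn (fun x : ℝ => x ^ (0 : ℝ) / (l₁ ^ 2 + x ^ 2) ^ 2 +
      x ^ (3 - h₁) / (l₁ ^ 2 + x ^ 2) ^ 2) (Set.Ioi 0) :=
    (integrableOn_rpow_div_sq hl₁ (by norm_num) (by norm_num)).add
      (integrableOn_rpow_div_sq hl₁ (by linarith) (by linarith))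
  set J := ∫ x in Set.Ioi (0 : ℝ), (x ^ (0 : ℝ) / (l₁ ^ 2 + x ^ 2) ^ 2 +
      x ^ (3 - h₁) / (l₁ ^ 2 + x ^ 2) ^ 2) with hJ
  have hJ0 : 0 ≤ J := setIntegral_nonneg measurableSet_Ioi fun x hx => by
    have : (0 : ℝ) < x := hx
    positivity
  -- The coefficient will be `p = 2 cH (lam'² - lam²) D0`, with `D0` the limiting spectral integral.
  -- Here `c`, `2 l₁` and `(l₂² + 4)⁻²`, the last from the integrand on `(1, 2]`, bound its factors
  -- below; `M`, `2 l₂` and `J` bound them above.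
  refine ⟨2 * c * (2 * l₁) * ((l₂ ^ 2 + 4) ^ 2)⁻¹, 2 * M * (2 * l₂) * J, 4 * M * (2 * l₂) * J,
    by positivity, by positivity, by positivity, fun H hH lam hlam lam' hlam' => ?_⟩
  have hl0 : 0 < lam := by linarith [hlam.1]
  have hl0' : 0 < lam' := by linarith [hlam'.1]
  have hH0 : 0 < H := by linarith [hH.1]
  have hH1 : H < 1 := by linarith [hH.2]
  have hcH := hcM H hH
  -- One majorant for all exponents up to `3 - h₁` covers both the main term `3 - 2H` and the
  -- remainder `3 - 2H + h₁`, because `2H ≥ 2h₁`.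
  have hpq : ∀ x > 0, ∀ q, 0 ≤ q → q ≤ 3 - h₁ →
      x ^ q / ((lam ^ 2 + x ^ 2) * (lam' ^ 2 + x ^ 2)) ≤
        x ^ (0 : ℝ) / (l₁ ^ 2 + x ^ 2) ^ 2 + x ^ (3 - h₁) / (l₁ ^ 2 + x ^ 2) ^ 2 := by
    intro x hx q hq hq'
    rw [← add_div]
    gcongr
    · exact rpow_le_one_add_rpow hx hq hq'
    · rw [sq (l₁ ^ 2 + x ^ 2)]
      gcongr
      · exact hlam.1
      · exact hlam'.1
  have hqint : ∀ q, 0 ≤ q → q ≤ 3 - h₁ → IntegrableOn (fun x : ℝ =>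
      x ^ q / ((lam ^ 2 + x ^ 2) * (lam' ^ 2 + x ^ 2))) (Set.Ioi 0) := by
    intro q hq hq'
    refine Integrable.mono' hJint (Measurable.aestronglyMeasurable (by fun_prop)) ?_
    refine ae_restrict_of_forall_mem measurableSet_Ioi fun x hx => ?_
    have hx0 : (0 : ℝ) < x := hx
    rw [Real.norm_of_nonneg (by positivity)]
    exact hpq x hx0 q hq hq'
  have hqle : ∀ q, 0 ≤ q → q ≤ 3 - h₁ →
      ∫ x in Set.Ioi (0 : ℝ), x ^ q / ((lam ^ 2 + x ^ 2) * (lam' ^ 2 + x ^ 2)) ≤ J :=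
    fun q hq hq' => setIntegral_mono_on (hqint q hq hq') hJint measurableSet_Ioi
      fun x hx => hpq x hx q hq hq'
  set D0 := ∫ x in Set.Ioi (0 : ℝ), x ^ (3 - 2 * H) / ((lam ^ 2 + x ^ 2) * (lam' ^ 2 + x ^ 2))
    with hD0
  have hD0J : D0 ≤ J := hqle _ (by linarith) (by linarith [hH.1])
  have hD0int := hqint (3 - 2 * H) (by linarith) (by linarith [hH.1])
  have hD0low : ((l₂ ^ 2 + 4) ^ 2)⁻¹ ≤ D0 := by
    have e : ((l₂ ^ 2 + 4) ^ 2)⁻¹ = ∫ _x in Set.Ioc (1 : ℝ) 2, ((l₂ ^ 2 + 4) ^ 2)⁻¹ := by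
      rw [setIntegral_const]
      simp
      norm_num
    rw [e]
    calc _ ≤ ∫ x in Set.Ioc (1 : ℝ) 2,
          x ^ (3 - 2 * H) / ((lam ^ 2 + x ^ 2) * (lam' ^ 2 + x ^ 2)) := by
          refine setIntegral_mono_on (by simp)
            (hD0int.mono_set fun x hx => lt_trans one_pos hx.1) measurableSet_Ioc fun x hx => ?_
          have hx0 : 0 < x := lt_trans one_pos hx.1
          rw [inv_eq_one_div, sq (l₂ ^ 2 + 4)]
          gcongr
          · exact Real.one_le_rpow hx.1.le (by linarith)
          · exact hlam.2
          · nlinarith [hx.2]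
          · exact hlam'.2
          · nlinarith [hx.2]
      _ ≤ D0 := setIntegral_mono_set hD0int
          (ae_restrict_of_forall_mem measurableSet_Ioi fun x hx => by
            have : (0 : ℝ) < x := hx
            simp only [Pi.zero_apply]
            positivity)
          (LE.le.eventuallyLE fun x hx => lt_trans one_pos hx.1)
  have hD00 : 0 ≤ D0 := le_trans (by positivity) hD0low
  have hsq : |lam' ^ 2 - lam ^ 2| = (lam + lam') * |lam' - lam| := by
    rw [show lam' ^ 2 - lam ^ 2 = (lam + lam') * (lam' - lam) by ring, abs_mul,
      abs_of_pos (by linarith)]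
  have hsqle : |lam' ^ 2 - lam ^ 2| ≤ 2 * l₂ * |lam' - lam| := by
    rw [hsq]; gcongr; linarith [hlam.2, hlam'.2]
  have hsqge : 2 * l₁ * |lam' - lam| ≤ |lam' ^ 2 - lam ^ 2| := by
    rw [hsq]; gcongr; linarith [hlam.1, hlam'.1]
  have hpabs : |2 * cH H * (lam' ^ 2 - lam ^ 2) * D0| = 2 * cH H * |lam' ^ 2 - lam ^ 2| * D0 := by
    rw [abs_mul, abs_mul, abs_of_pos (by linarith : 0 < 2 * cH H), abs_of_nonneg hD00]
  refine ⟨2 * cH H * (lam' ^ 2 - lam ^ 2) * D0, ?_, ?_, fun t ht => ?_⟩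
  · rw [hpabs]
    calc _ = 2 * c * (2 * l₁ * |lam' - lam|) * ((l₂ ^ 2 + 4) ^ 2)⁻¹ := by ring
      _ ≤ _ := by
          have : 0 < cH H := by linarith
          gcongr
          exact hcH.1
  · rw [hpabs]
    calc _ ≤ 2 * M * (2 * l₂ * |lam' - lam|) * J := by
          have := hcH.2
          have : 0 < cH H := by linarith
          gcongr
      _ = _ := by ring
  · have hq : 0 ≤ 3 - 2 * H + h₁ := by linarith
    have hq' : 3 - 2 * H + h₁ ≤ 3 - h₁ := by linarith [hH.1]
    have hpow : ∀ x > 0, (t * x) ^ 2 * (t * x) ^ (-(2 * H)) * x = t ^ (2 - 2 * H) *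
        x ^ (3 - 2 * H) := by
      intro x hx
      rw [← Real.rpow_two, ← Real.rpow_add (mul_pos ht hx), Real.mul_rpow ht.le hx.le,
        show 3 - 2 * H = (2 + -(2 * H)) + 1 by ring, Real.rpow_add_one hx.ne']
      ring_nf
    set f : ℝ → ℝ := fun x => (1 - Real.cos (t * x)) * (t * x) ^ (-(2 * H)) *
        (x / ((lam ^ 2 + x ^ 2) * (lam' ^ 2 + x ^ 2)))
    have hbd : ∀ x > 0, |f x - t ^ (2 - 2 * H) / 2 *
        (x ^ (3 - 2 * H) / ((lam ^ 2 + x ^ 2) * (lam' ^ 2 + x ^ 2)))| ≤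
        t ^ h₁ * t ^ (2 - 2 * H) *
          (x ^ (3 - 2 * H + h₁) / ((lam ^ 2 + x ^ 2) * (lam' ^ 2 + x ^ 2))) := by
      intro x hx
      have hz := mul_pos ht hx
      have hb := abs_one_sub_cos_sub_half_sq_le hh₁ h1lt.le hz
      set W := (lam ^ 2 + x ^ 2) * (lam' ^ 2 + x ^ 2) with hW
      have hW0 : 0 < W := by positivity
      have e1 : f x - t ^ (2 - 2 * H) / 2 * (x ^ (3 - 2 * H) / W) =
          (1 - Real.cos (t * x) - (t * x) ^ 2 / 2) * ((t * x) ^ (-(2 * H)) * (x / W)) := by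
        have := hpow x hx
        simp only [f, ← hW]
        linear_combination (1 / 2 / W) * this
      rw [e1, abs_mul, abs_of_pos (a := (t * x) ^ (-(2 * H)) * (x / W)) (by positivity)]
      calc _ ≤ ((t * x) ^ 2 * (t * x) ^ h₁) * ((t * x) ^ (-(2 * H)) * (x / W)) := by gcongr
        _ = ((t * x) ^ 2 * (t * x) ^ (-(2 * H)) * x) * (t * x) ^ h₁ / W := by ring
        _ = _ := by
          rw [hpow x hx, Real.mul_rpow ht.le hx.le, Real.rpow_add hx (3 - 2 * H)]
          ring
    have hmeas : Measurable f := by fun_prop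
    have hdint : IntegrableOn (fun x => f x - t ^ (2 - 2 * H) / 2 *
        (x ^ (3 - 2 * H) / ((lam ^ 2 + x ^ 2) * (lam' ^ 2 + x ^ 2)))) (Set.Ioi 0) := by
      refine Integrable.mono' ((hqint _ hq hq').const_mul (t ^ h₁ * t ^ (2 - 2 * H)))
        (Measurable.aestronglyMeasurable (by fun_prop)) ?_
      exact ae_restrict_of_forall_mem measurableSet_Ioi fun x hx => hbd x hx
    have hfint : IntegrableOn f (Set.Ioi 0) := by
      refine (hdint.add (hD0int.const_mul (t ^ (2 - 2 * H) / 2))).congr ?_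
      filter_upwards with x
      simp
    have hmain : |(∫ x in Set.Ioi (0 : ℝ), f x) - t ^ (2 - 2 * H) / 2 * D0| ≤
        t ^ h₁ * t ^ (2 - 2 * H) * J := by
      rw [hD0, ← integral_const_mul, ← integral_sub hfint (hD0int.const_mul _),
        ← Real.norm_eq_abs]
      refine (norm_integral_le_of_norm_le ((hqint _ hq hq').const_mul (t ^ h₁ * t ^ (2 - 2 * H)))
        (ae_restrict_of_forall_mem measurableSet_Ioi fun x hx => hbd x hx)).trans ?_
      rw [integral_const_mul]
      gcongr
      exact hqle _ hq hq'
    rw [defect_sub_defect hH0 hH1 hl0 hl0' ht]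
    have e : 4 * cH H * (lam' ^ 2 - lam ^ 2) * (∫ x in Set.Ioi (0 : ℝ), f x) -
        2 * cH H * (lam' ^ 2 - lam ^ 2) * D0 * t ^ (2 - 2 * H) =
        4 * cH H * (lam' ^ 2 - lam ^ 2) *
          ((∫ x in Set.Ioi (0 : ℝ), f x) - t ^ (2 - 2 * H) / 2 * D0) := by ring
    rw [e, abs_mul, abs_mul, abs_of_pos (by linarith : 0 < 4 * cH H)]
    calc _ ≤ 4 * M * (2 * l₂ * |lam' - lam|) * (t ^ h₁ * t ^ (2 - 2 * H) * J) := by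
          have := hcH.2
          have : 0 < cH H := by linarith
          gcongr
      _ = _ := by ring

/-! ### Identification of the parameters from three lags -/

theorem abs_log_sub_log_le {a b m : ℝ} (hm : 0 < m) (ha : m ≤ a) (hb : m ≤ b) :
    |Real.log a - Real.log b| ≤ m⁻¹ * |a - b| := by
  wlog h : b ≤ a generalizing a b
  · rw [abs_sub_comm, abs_sub_comm a]
    exact this hb ha (le_of_not_ge h)
  have hb0 : 0 < b := by linarith
  have ha0 : 0 < a := by linarith
  rw [abs_of_nonneg (sub_nonneg.mpr (Real.log_le_log hb0 h)), abs_of_nonneg (sub_nonneg.mpr h),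
    ← Real.log_div ha0.ne' hb0.ne']
  calc Real.log (a / b) ≤ a / b - 1 := Real.log_le_sub_one_of_pos (by positivity)
    _ = b⁻¹ * (a - b) := by field_simp
    _ ≤ m⁻¹ * (a - b) := by
      have := sub_nonneg.mpr h
      gcongr

/-- Apply `1 - 1/r ≤ log r ≤ r - 1` to `r = (1 - b) / (1 - c)`: the deviations of the two sides from
`c - b` are `(c - b) u / (1 - u)` with `u = b` or `u = c`, and `u / (1 - u) ≤ 2M`. -/
theorem abs_log_one_sub_sub_log_one_sub_sub_le {b c M : ℝ} (hb : 0 ≤ b) (hc : 0 ≤ c)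
    (hbM : b ≤ M) (hcM : c ≤ M) (hM : M ≤ 1 / 2) :
    |Real.log (1 - b) - Real.log (1 - c) - (c - b)| ≤ 2 * M * |c - b| := by
  have h1b : 0 < 1 - b := by linarith
  have h1c : 0 < 1 - c := by linarith
  rw [← Real.log_div h1b.ne' h1c.ne', abs_le]
  have hup := Real.log_le_sub_one_of_pos (div_pos h1b h1c)
  have hlow := Real.one_sub_inv_le_log_of_pos (div_pos h1b h1c)
  have hx : ∀ u, 0 ≤ u → u ≤ M → |(c - b) * (u / (1 - u))| ≤ 2 * M * |c - b| := by
    intro u hu huM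
    have h1u : 0 < 1 - u := by linarith
    rw [abs_mul, abs_of_nonneg (div_nonneg hu h1u.le), mul_comm]
    gcongr
    rw [div_le_iff₀ h1u]
    nlinarith
  have e1 : (1 - b) / (1 - c) - 1 - (c - b) = (c - b) * (c / (1 - c)) := by field_simp; ring
  have e2 : 1 - ((1 - b) / (1 - c))⁻¹ - (c - b) = (c - b) * (b / (1 - b)) := by field_simp; ring
  have k1 := abs_le.mp (hx c hc hcM)
  have k2 := abs_le.mp (hx b hb hbM)
  constructor <;> linarith

/-- The secant slopes of `exp` from `0` to `β log 2` and to `β log 3` increase strictly. The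
difference of the two sides is the determinant with rows `(1, log k, k^β)`, `k = 1, 2, 3`. -/
theorem log_three_mul_lt {β : ℝ} (hβ : 0 < β) :
    Real.log 3 * ((2 : ℝ) ^ β - 1) < Real.log 2 * ((3 : ℝ) ^ β - 1) := by
  have h2 : 0 < Real.log 2 := Real.log_pos (by norm_num)
  have h23 : Real.log 2 < Real.log 3 := Real.log_lt_log (by norm_num) (by norm_num)
  have h := strictConvexOn_exp.secant_strict_mono (a := 0) (x := Real.log 2 * β)
    (y := Real.log 3 * β) (Set.mem_univ _) (Set.mem_univ _) (Set.mem_univ _) (by positivity)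
    (by nlinarith) (mul_lt_mul_of_pos_right h23 hβ)
  rw [← Real.rpow_def_of_pos (by norm_num), ← Real.rpow_def_of_pos (by norm_num), Real.exp_zero,
    sub_zero, sub_zero, div_lt_div_iff₀ (by positivity) (by nlinarith)] at h
  refine lt_of_mul_lt_mul_right ?_ hβ.le
  linarith

theorem exists_pos_le_of_rpow {b₁ b₂ : ℝ} (hb : 0 < b₁) :
    ∃ κ > 0, ∀ β ∈ Set.Icc b₁ b₂,
      κ ≤ Real.log 2 * ((3 : ℝ) ^ β - 1) - Real.log 3 * ((2 : ℝ) ^ β - 1) := by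
  rcases Set.eq_empty_or_nonempty (Set.Icc b₁ b₂) with he | hne
  · rw [he]; exact ⟨1, one_pos, by simp⟩
  have hc : Continuous fun β : ℝ =>
      Real.log 2 * ((3 : ℝ) ^ β - 1) - Real.log 3 * ((2 : ℝ) ^ β - 1) := by
    have h3 : Continuous fun β : ℝ => (3 : ℝ) ^ β := Real.continuous_const_rpow (by norm_num)
    have h2 : Continuous fun β : ℝ => (2 : ℝ) ^ β := Real.continuous_const_rpow (by norm_num)
    fun_prop
  obtain ⟨x, hx, hm⟩ := isCompact_Icc.exists_isMinOn hne hc.continuousOn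
  exact ⟨_, sub_pos.mpr (log_three_mul_lt (hb.trans_le hx.1)), fun β hβ => hm hβ⟩

theorem abs_sub_le_two_mul {a b c : ℝ} (ha : |a| ≤ c) (hb : |b| ≤ c) : |a - b| ≤ 2 * c :=
  (abs_sub _ _).trans (by linarith)

theorem abs_log_combination_le {u₁ u₂ u₃ b : ℝ} (h1 : |u₁| ≤ b) (h2 : |u₂| ≤ b) (h3 : |u₃| ≤ b) :
    |Real.log 2 * (u₃ - u₁) - Real.log 3 * (u₂ - u₁)| ≤ 6 * b := by
  have hl2 : 0 ≤ Real.log 2 := Real.log_nonneg (by norm_num)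
  have hl3 : 0 ≤ Real.log 3 := Real.log_nonneg (by norm_num)
  have hl2' : Real.log 2 ≤ 1 := by linarith [Real.log_two_lt_d9]
  have hl3' : Real.log 3 ≤ 2 := by
    have := Real.log_le_sub_one_of_pos (x := 3) (by norm_num)
    linarith
  have hb : 0 ≤ b := (abs_nonneg _).trans h1
  refine (abs_sub _ _).trans ?_
  rw [abs_mul, abs_mul, abs_of_nonneg hl2, abs_of_nonneg hl3]
  have b1 : Real.log 2 * |u₃ - u₁| ≤ 1 * (2 * b) := by
    gcongr
    exact abs_sub_le_two_mul h3 h1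
  have b2 : Real.log 3 * |u₂ - u₁| ≤ 2 * (2 * b) := by
    gcongr
    exact abs_sub_le_two_mul h2 h1
  linarith

/-- Stability of the perturbed linear system satisfied by the logarithmic variogram increments. -/
theorem linear_stability {d D κ ε G R : ℝ} (hd : 0 < d) (hκ : 0 < κ)
    (hε1 : ε ≤ 1) (hD : 0 ≤ D) (hG : G = 2 / (d * κ)) (hR : R = 2 + 6 * (3 * D + 2) * G)
    (hε2 : ε ≤ d * κ / 12) (hε3 : ε * R ≤ 1 / 2)
    {Λ m A p S n c₂ c₃ w₁ w₂ w₃ x₁ x₂ x₃ y₁ y₂ y₃ W : ℝ} (hW : W = |w₁| + |w₂| + |w₃|)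
    (hn : 0 ≤ n) (hS : 0 < S)
    (e1 : w₁ = Λ + 2 * m * A + x₁ + p * S + y₁)
    (e2 : w₂ = Λ + 2 * m * (A + Real.log 2) + x₂ + p * c₂ * S + y₂)
    (e3 : w₃ = Λ + 2 * m * (A + Real.log 3) + x₃ + p * c₃ * S + y₃)
    (hx1 : |x₁| ≤ ε * |m|) (hx2 : |x₂| ≤ ε * |m|) (hx3 : |x₃| ≤ ε * |m|)
    (hy1 : |y₁| ≤ ε * (S * n)) (hy2 : |y₂| ≤ ε * (S * n)) (hy3 : |y₃| ≤ ε * (S * n))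
    (hp1 : d * n ≤ |p|) (hp2 : |p| ≤ D * n) (hc2 : |c₂ - 1| ≤ 3)
    (hκc : κ ≤ Real.log 2 * (c₃ - 1) - Real.log 3 * (c₂ - 1)) :
    |m| ≤ 2 * R * W ∧ S * n ≤ G * (6 + 12 * R) * W ∧
      |Λ| ≤ W + (2 * |A| + 1) * |m| + (D + 1) * (S * n) := by
  -- The `w` are differences of log variograms, `Λ` and `m` those of `log (σ²/2)` and `H`, `A` is
  -- `log α`, `n` the change of `lam`, `p S` its leading effect; the `x` and `y` are the errors due
  -- to `H` and `lam`.
  have hG0 : 0 < G := by rw [hG]; positivity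
  have hR0 : 0 < R := by rw [hR]; positivity
  have hW1 := abs_nonneg w₁
  have hW2 := abs_nonneg w₂
  have hW3 := abs_nonneg w₃
  have hw1 : |w₁| ≤ W := by linarith
  have hw2 : |w₂| ≤ W := by linarith
  have hw3 : |w₃| ≤ W := by linarith
  have hm0 := abs_nonneg m
  have hSn : 0 ≤ S * n := by positivity
  have hW0 : 0 ≤ W := by linarith
  have hpS : |p| * S ≤ D * (S * n) := by
    calc |p| * S ≤ D * n * S := by gcongr
      _ = _ := by ring
  -- The combination `log 2 (w₃ - w₁) - log 3 (w₂ - w₁)` eliminates `Λ` and `m`. The error `6 ε S n`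
  -- is at most half of `d κ S n`, whence `G = 2 / (d κ)`.
  have hlam : S * n ≤ G * (6 * W + 6 * (ε * |m|)) := by
    have e : p * (Real.log 2 * (c₃ - 1) - Real.log 3 * (c₂ - 1)) * S =
        (Real.log 2 * (w₃ - w₁) - Real.log 3 * (w₂ - w₁)) -
        (Real.log 2 * (x₃ - x₁) - Real.log 3 * (x₂ - x₁)) -
        (Real.log 2 * (y₃ - y₁) - Real.log 3 * (y₂ - y₁)) := by
      rw [e1, e2, e3]; ring
    have h1 : d * n * κ * S ≤ 6 * W + 6 * (ε * |m|) + 6 * (ε * (S * n)) := by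
      calc d * n * κ * S ≤ |p| * (Real.log 2 * (c₃ - 1) - Real.log 3 * (c₂ - 1)) * S := by
            gcongr
        _ = |p * (Real.log 2 * (c₃ - 1) - Real.log 3 * (c₂ - 1)) * S| := by
            rw [abs_mul, abs_mul, abs_of_pos hS, abs_of_pos (hκ.trans_le hκc)]
        _ ≤ _ := by
            rw [e]
            exact (abs_sub _ _).trans (add_le_add ((abs_sub _ _).trans
              (add_le_add (abs_log_combination_le hw1 hw2 hw3)
                (abs_log_combination_le hx1 hx2 hx3))) (abs_log_combination_le hy1 hy2 hy3))
    have h2 : ε * (S * n) ≤ d * κ / 12 * (S * n) := mul_le_mul_of_nonneg_right hε2 hSn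
    rw [hG, div_mul_eq_mul_div, le_div_iff₀ (by positivity)]
    linarith
  -- Now `w₂ - w₁` isolates `m`. Inserting `hlam` gives `|m| ≤ R W + ε R |m|`, which defines `R`,
  -- and `ε R ≤ 1/2` absorbs the last term.
  have hm : |m| ≤ 2 * R * W := by
    have e : 2 * m * Real.log 2 = (w₂ - w₁) - (x₂ - x₁) - (p * (c₂ - 1) * S) - (y₂ - y₁) := by
      rw [e1, e2]; ring
    have h1 : |2 * m * Real.log 2| ≤ 2 * W + 2 * (ε * |m|) + 3 * (D * (S * n)) +
        2 * (ε * (S * n)) := by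
      rw [e]
      refine (abs_sub _ _).trans (add_le_add ((abs_sub _ _).trans (add_le_add
        ((abs_sub _ _).trans (add_le_add (abs_sub_le_two_mul hw2 hw1)
          (abs_sub_le_two_mul hx2 hx1))) ?_)) (abs_sub_le_two_mul hy2 hy1))
      rw [abs_mul, abs_mul, abs_of_pos hS]
      calc |p| * |c₂ - 1| * S ≤ |p| * 3 * S := by gcongr
        _ ≤ _ := by linarith
    have h2 : |m| ≤ |2 * m * Real.log 2| := by
      rw [abs_mul, abs_mul, abs_two, abs_of_nonneg (Real.log_nonneg (by norm_num))]
      have := Real.log_two_gt_d9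
      nlinarith
    have h3 : ε * (S * n) ≤ 1 * (S * n) := mul_le_mul_of_nonneg_right hε1 hSn
    have h4 : (3 * D + 2) * (S * n) ≤ (3 * D + 2) * (G * (6 * W + 6 * (ε * |m|))) := by gcongr
    have h5 : |m| ≤ R * W + ε * R * |m| := by
      rw [hR]
      linarith
    have h6 : ε * R * |m| ≤ 1 / 2 * |m| := mul_le_mul_of_nonneg_right hε3 hm0
    linarith
  have h7 : ε * |m| ≤ 1 * |m| := mul_le_mul_of_nonneg_right hε1 hm0
  refine ⟨hm, ?_, ?_⟩
  · refine hlam.trans ?_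
    rw [mul_assoc G]
    gcongr
    linarith
  · have e : Λ = w₁ - 2 * m * A - x₁ - p * S - y₁ := by rw [e1]; ring
    have h3 : ε * (S * n) ≤ 1 * (S * n) := mul_le_mul_of_nonneg_right hε1 hSn
    have h8 : |Λ| ≤ W + 2 * |m| * |A| + ε * |m| + D * (S * n) + ε * (S * n) := by
      rw [e]
      refine (abs_sub _ _).trans (add_le_add ((abs_sub _ _).trans (add_le_add
        ((abs_sub _ _).trans (add_le_add ((abs_sub _ _).trans (add_le_add hw1 ?_)) hx1)) ?_)) hy1)
      · rw [abs_mul, abs_mul, abs_two]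
      · rw [abs_mul, abs_of_pos hS]
        exact hpS
    linarith

/-- The change of parameters is made in two moves, with `a`, `b`, `c` the defects at `(H, lam)`,
`(H', lam)` and `(H', lam')`. The move in `H` is the error `x`; the move in `lam` is its linear part
`q` plus the error `y`. -/
theorem exists_log_increment {s s' T H H' a b c q r M : ℝ} (hs : 0 < s) (hs' : 0 < s') (hT : 0 < T)
    (haM : a ≤ M) (hb : 0 ≤ b) (hbM : b ≤ M) (hc : 0 ≤ c) (hcM : c ≤ M)
    (hM : M ≤ 1 / 2) (hq : |c - b - q| ≤ r) :
    ∃ x y : ℝ, Real.log (s * T ^ (2 * H) * (1 - a)) - Real.log (s' * T ^ (2 * H') * (1 - c)) =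
      Real.log s - Real.log s' + 2 * (H - H') * Real.log T + x + q + y ∧
      |x| ≤ 2 * |a - b| ∧ |y| ≤ 2 * M * (|q| + r) + r := by
  refine ⟨Real.log (1 - a) - Real.log (1 - b), Real.log (1 - b) - Real.log (1 - c) - q, ?_, ?_, ?_⟩
  · have h1 : 0 < T ^ (2 * H) := by positivity
    have h2 : 0 < T ^ (2 * H') := by positivity
    have h3 : 0 < 1 - a := by linarith
    have h4 : 0 < 1 - c := by linarith
    rw [Real.log_mul (mul_pos hs h1).ne' h3.ne', Real.log_mul (mul_pos hs' h2).ne' h4.ne',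
      Real.log_mul hs.ne' h1.ne', Real.log_mul hs'.ne' h2.ne', Real.log_rpow hT, Real.log_rpow hT]
    ring
  · have h := abs_log_sub_log_le (m := 1 / 2) (a := 1 - a) (b := 1 - b) (by norm_num) (by linarith)
      (by linarith)
    rw [show 1 - a - (1 - b) = -(a - b) by ring, abs_neg] at h
    norm_num at h
    exact h
  · have h := abs_log_one_sub_sub_log_one_sub_sub_le hb hc hbM hcM hM
    have h1 : |c - b| ≤ |q| + r := by
      have := abs_add_le q (c - b - q)
      rw [add_sub_cancel] at this
      linarith
    rw [show Real.log (1 - b) - Real.log (1 - c) - q =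
      (Real.log (1 - b) - Real.log (1 - c) - (c - b)) + (c - b - q) by ring]
    refine (abs_add_le _ _).trans (add_le_add (h.trans ?_) hq)
    have : 0 ≤ M := hb.trans hbM
    gcongr

theorem exists_rpow_le {q δ : ℝ} (hq : 0 < q) (hδ : 0 < δ) :
    ∃ τ₀ > 0, ∀ τ, 0 < τ → τ ≤ τ₀ → τ ^ q ≤ δ := by
  refine ⟨δ ^ q⁻¹, by positivity, fun τ h0 h => ?_⟩
  calc τ ^ q ≤ (δ ^ q⁻¹) ^ q := by gcongr
    _ = δ := Real.rpow_inv_rpow hδ.le hq.ne'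

/-- A known sign keeps `σ + σ'` away from zero, so that `σ² - σ'² = (σ - σ')(σ + σ')` controls `σ -
σ'`. -/
theorem exists_abs_bounds_of_sign {σ₁ σ₂ : ℝ} (h : 0 < σ₁ ∨ σ₂ < 0) :
    ∃ m M : ℝ, 0 < m ∧ 0 < M ∧ ∀ σ ∈ Set.Icc σ₁ σ₂, m ^ 2 ≤ σ ^ 2 ∧ σ ^ 2 ≤ M ^ 2 ∧
      ∀ σ' ∈ Set.Icc σ₁ σ₂, 2 * m ≤ |σ + σ'| := by
  rcases h with h | h
  · refine ⟨σ₁, |σ₂| + 1, h, by positivity, fun σ hσ => ⟨?_, ?_, fun σ' hσ' => ?_⟩⟩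
    · nlinarith [hσ.1]
    · have := hσ.2.trans (le_abs_self σ₂)
      have := hσ.1
      gcongr <;> linarith
    · exact le_trans (by linarith [hσ.1, hσ'.1]) (le_abs_self _)
  · refine ⟨-σ₂, |σ₁| + 1, by linarith, by positivity, fun σ hσ => ⟨?_, ?_, fun σ' hσ' => ?_⟩⟩
    · nlinarith [hσ.2]
    · have := hσ.1
      have := neg_abs_le σ₁
      rw [← neg_sq σ]
      have := hσ.2
      gcongr <;> linarith
    · exact le_trans (by linarith [hσ.2, hσ'.2]) (neg_le_abs _)

theorem norm_le_sum_abs (x : Param) : ‖x‖ ≤ |x 0| + |x 1| + |x 2| := by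
  rw [EuclideanSpace.norm_eq, Fin.sum_univ_three]
  refine Real.sqrt_le_iff.mpr ⟨by positivity, ?_⟩
  simp only [Real.norm_eq_abs]
  nlinarith [abs_nonneg (x 0), abs_nonneg (x 1), abs_nonneg (x 2),
    mul_nonneg (abs_nonneg (x 0)) (abs_nonneg (x 1)),
    mul_nonneg (abs_nonneg (x 0)) (abs_nonneg (x 2)),
    mul_nonneg (abs_nonneg (x 1)) (abs_nonneg (x 2))]

theorem two_rpow_sub_one_bounds {β : ℝ} (h0 : 0 ≤ β) (h2 : β ≤ 2) :
    |(2 : ℝ) ^ β - 1| ≤ 3 := by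
  have h1 : (1 : ℝ) ≤ 2 ^ β := Real.one_le_rpow (by norm_num) h0
  have h3 : (2 : ℝ) ^ β ≤ 2 ^ (2 : ℝ) := Real.rpow_le_rpow_of_exponent_le (by norm_num) h2
  norm_num at h3
  rw [abs_le]
  constructor <;> linarith

set_option maxHeartbeats 1000000 in
/-- For small steps, the variogram at three consecutive lags determines the parameters, with a
Lipschitz inverse. -/
theorem exists_norm_sub_le_variogram (lo hi : Param) (hH : 0 < lo 0 ∧ hi 0 < 1) (hlam : 0 < lo 1)
    (hσ : 0 < lo 2 ∨ hi 2 < 0) :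
    ∃ α₀ : ℝ, 0 < α₀ ∧ ∀ α : ℝ, 0 < α → α < α₀ → ∃ C : ℝ, 0 ≤ C ∧
      ∀ θ ∈ rectangle lo hi, ∀ θ' ∈ rectangle lo hi, ‖θ - θ'‖ ≤ C *
        ∑ k ∈ Finset.Icc (1 : ℕ) 3,
          |(rho θ 0 - rho θ (α * k)) - (rho θ' 0 - rho θ' (α * k))| := by
  obtain ⟨h₁pos, h₂lt⟩ := hH
  generalize hh₁ : lo 0 = h₁ at h₁pos
  generalize hh₂ : hi 0 = h₂ at h₂lt
  generalize hl₁ : lo 1 = l₁ at hlam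
  generalize hl₂ : hi 1 = l₂
  have hmem0 : ∀ θ ∈ rectangle lo hi, θ 0 ∈ Set.Icc h₁ h₂ := fun θ hθ => hh₁ ▸ hh₂ ▸ hθ 0
  have hmem1 : ∀ θ ∈ rectangle lo hi, θ 1 ∈ Set.Icc l₁ l₂ := fun θ hθ => hl₁ ▸ hl₂ ▸ hθ 1
  have hmem2 : ∀ θ ∈ rectangle lo hi, θ 2 ∈ Set.Icc (lo 2) (hi 2) := fun θ hθ => hθ 2
  obtain ⟨C, hC0, hC⟩ := exists_defect_bounds (l₂ := l₂) h₁pos h₂lt hlam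
  obtain ⟨d, D, E, hd, hD, hE, hexp⟩ :=
    exists_defect_sub_defect_expansion (l₂ := l₂) h₁pos h₂lt hlam
  obtain ⟨κ, hκ, hκb⟩ := exists_pos_le_of_rpow (b₁ := 2 - 2 * h₂) (b₂ := 2 - 2 * h₁) (by linarith)
  obtain ⟨m₀, M₀, hm₀, hM₀, hσb⟩ := exists_abs_bounds_of_sign hσ
  obtain ⟨G, hG⟩ : ∃ G, G = 2 / (d * κ) := ⟨_, rfl⟩
  have hG0 : 0 < G := by rw [hG]; positivity
  obtain ⟨R, hR⟩ : ∃ R, R = 2 + 6 * (3 * D + 2) * G := ⟨_, rfl⟩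
  have hR0 : 0 < R := by rw [hR]; positivity
  obtain ⟨ε, hε0, hε1, hε2, hε3⟩ : ∃ ε : ℝ, 0 < ε ∧ ε ≤ 1 ∧ ε ≤ d * κ / 12 ∧ ε * R ≤ 1 / 2 := by
    refine ⟨min 1 (min (d * κ / 12) (1 / (2 * R))), by positivity, min_le_left _ _,
      (min_le_right _ _).trans (min_le_left _ _), ?_⟩
    have h : min 1 (min (d * κ / 12) (1 / (2 * R))) ≤ 1 / (2 * R) :=
      (min_le_right _ _).trans (min_le_right _ _)
    rw [le_div_iff₀ (by positivity)] at h
    linarith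
  -- `Q` adds up the coefficients of `δ` in the error bounds `hCδ` and `hEδ`, so that `δ = ε / Q`
  -- brings both below `ε`; the summand `1` keeps `δ ≤ ε`.
  obtain ⟨Q, hQ⟩ : ∃ Q, Q = 1 + 2 * C + 9 * E + 18 * C * (D + E) := ⟨_, rfl⟩
  have hQ1 : 1 ≤ Q := by
    have : 0 ≤ 2 * C + 9 * E + 18 * C * (D + E) := by positivity
    linarith
  obtain ⟨δ, hδ⟩ : ∃ δ, δ = ε / Q := ⟨_, rfl⟩
  have hδ0 : 0 < δ := by rw [hδ]; positivity
  have hδQ : δ * Q = ε := by rw [hδ]; field_simp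
  have hδ1 : δ ≤ 1 := by
    rw [hδ]
    exact (div_le_self hε0.le hQ1).trans hε1
  have hCδ : 2 * C * δ ≤ ε := by
    have : 0 ≤ δ * (1 + 9 * E + 18 * C * (D + E)) := by positivity
    rw [← hδQ, hQ]
    linarith
  have hEδ : 9 * E * δ + 18 * C * (D + E) * δ ≤ ε := by
    have : 0 ≤ δ * (1 + 2 * C) := by positivity
    rw [← hδQ, hQ]
    linarith
  obtain ⟨τ₁, hτ₁, hτ₁'⟩ := exists_rpow_le (q := 1 - h₂) (by linarith) hδ0
  obtain ⟨τ₂, hτ₂, hτ₂'⟩ := exists_rpow_le h₁pos hδ0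
  -- Division by three keeps all lags up to `3α` below the thresholds, and below `1`, where powers
  -- decrease in the exponent.
  refine ⟨min 1 (min τ₁ τ₂) / 3, by positivity, fun α hα hαlt => ?_⟩
  have hα3 : 3 * α ≤ min 1 (min τ₁ τ₂) := by linarith
  have hα1 : 3 * α ≤ 1 := hα3.trans (min_le_left _ _)
  have hα2 : 3 * α ≤ τ₁ := hα3.trans ((min_le_right _ _).trans (min_le_left _ _))
  have hα4 : 3 * α ≤ τ₂ := hα3.trans ((min_le_right _ _).trans (min_le_right _ _))
  have hk : ∀ k ∈ Finset.Icc (1 : ℕ) 3, (1 : ℝ) ≤ k ∧ (k : ℝ) ≤ 3 := by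
    intro k hk
    rw [Finset.mem_Icc] at hk
    exact ⟨by exact_mod_cast hk.1, by exact_mod_cast hk.2⟩
  have hT : ∀ k ∈ Finset.Icc (1 : ℕ) 3, 0 < α * k ∧ α ≤ α * k ∧ α * k ≤ 1 ∧
      (α * k) ^ (1 - h₂) ≤ δ ∧ (α * k) ^ h₁ ≤ δ := by
    intro k hk'
    obtain ⟨k1, k3⟩ := hk k hk'
    have h0 : 0 < α * k := by positivity
    have h3 : α * k ≤ 3 * α := by rw [mul_comm]; gcongr
    exact ⟨h0, le_mul_of_one_le_right hα.le k1, h3.trans hα1, hτ₁' _ h0 (h3.trans hα2), hτ₂' _ h0 (h3.trans hα4)⟩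
  -- A lower bound for the variogram at the three lags: `σ² ≥ m₀²`, `(αk)^(2H) ≥ α²`, and a defect
  -- of at most `1/2`.
  obtain ⟨v, hv⟩ : ∃ v, v = m₀ ^ 2 / 2 * α ^ 2 * (1 / 2) := ⟨_, rfl⟩
  have hv0 : 0 < v := by rw [hv]; positivity
  have hvar : ∀ θ ∈ rectangle lo hi, ∀ k ∈ Finset.Icc (1 : ℕ) 3,
      rho θ 0 - rho θ (α * k) =
        θ 2 ^ 2 / 2 * (α * k) ^ (2 * θ 0) * (1 - defect (θ 0) (θ 1) (α * k)) ∧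
      v ≤ rho θ 0 - rho θ (α * k) := by
    intro θ hθ k hk'
    obtain ⟨T0, T1, T2, T3, T4⟩ := hT k hk'
    have b0 := hmem0 θ hθ
    have b1 := hmem1 θ hθ
    have e := rho_zero_sub_rho (θ := θ) (by linarith [b0.1]) (by linarith [b0.2])
      (by linarith [b1.1]) T0
    refine ⟨e, ?_⟩
    rw [e, hv]
    have f1 := (hσb _ (hmem2 θ hθ)).1
    have f2 := (hC _ b0 _ b1 _ T0).2.1
    have f3 : C * (α * k) ^ (1 - h₂) ≤ C * δ := by gcongr
    have f4 : α ^ 2 ≤ (α * k) ^ (2 * θ 0) := by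
      calc α ^ 2 ≤ (α * k) ^ 2 := by gcongr
        _ = (α * k) ^ (2 : ℝ) := (Real.rpow_two _).symm
        _ ≤ _ := Real.rpow_le_rpow_of_exponent_ge T0 T2 (by linarith [b0.2])
    gcongr
    linarith
  -- The three summands bound the errors in `H`, in `lam` (dividing by `S ≥ α²`) and in `σ`.
  obtain ⟨K, hK⟩ : ∃ K, K = 2 * R + (α ^ 2)⁻¹ * (G * (6 + 12 * R)) +
      m₀⁻¹ * (M₀ ^ 2 / 2) * (1 + (2 * |Real.log α| + 1) * (2 * R) +
        (D + 1) * (G * (6 + 12 * R))) := ⟨_, rfl⟩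
  have hK0 : 0 ≤ K := by rw [hK]; positivity
  refine ⟨K * v⁻¹, by positivity, fun θ hθ θ' hθ' => ?_⟩
  have b0 := hmem0 θ hθ
  have b1 := hmem1 θ hθ
  have b0' := hmem0 θ' hθ'
  have b1' := hmem1 θ' hθ'
  have s0 : 0 < θ 2 ^ 2 / 2 := by linarith [(hσb _ (hmem2 θ hθ)).1, pow_pos hm₀ 2]
  have s0' : 0 < θ' 2 ^ 2 / 2 := by linarith [(hσb _ (hmem2 θ' hθ')).1, pow_pos hm₀ 2]
  obtain ⟨p, hp1, hp2, hp3⟩ := hexp _ b0' _ b1 _ b1'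
  obtain ⟨β, hβ⟩ : ∃ β, β = 2 - 2 * θ' 0 := ⟨_, rfl⟩
  have hβ0 : 0 ≤ β := by linarith [b0'.2]
  have hβ2 : β ≤ 2 := by linarith [b0'.1]
  obtain ⟨S, hS⟩ : ∃ S, S = α ^ β := ⟨_, rfl⟩
  have hS0 : 0 < S := by rw [hS]; positivity
  have hSα : α ^ 2 ≤ S := by
    rw [hS, ← Real.rpow_two]
    exact Real.rpow_le_rpow_of_exponent_ge hα (by linarith) hβ2
  rw [← hβ] at hp3
  have hkβ : ∀ k ∈ Finset.Icc (1 : ℕ) 3, (k : ℝ) ^ β ≤ 9 := by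
    intro k hk'
    obtain ⟨k1, k3⟩ := hk k hk'
    calc (k : ℝ) ^ β ≤ (k : ℝ) ^ (2 : ℝ) := Real.rpow_le_rpow_of_exponent_le k1 hβ2
      _ = (k : ℝ) ^ 2 := Real.rpow_two _
      _ ≤ 3 ^ 2 := by gcongr
      _ = 9 := by norm_num
  have hdec : ∀ k ∈ Finset.Icc (1 : ℕ) 3, ∃ x y : ℝ,
      Real.log (rho θ 0 - rho θ (α * k)) - Real.log (rho θ' 0 - rho θ' (α * k)) =
        Real.log (θ 2 ^ 2 / 2) - Real.log (θ' 2 ^ 2 / 2) +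
          2 * (θ 0 - θ' 0) * (Real.log α + Real.log k) + x + p * (k : ℝ) ^ β * S + y ∧
        |x| ≤ ε * |θ 0 - θ' 0| ∧ |y| ≤ ε * (S * |θ' 1 - θ 1|) := by
    intro k hk'
    obtain ⟨T0, T1, T2, T3, T4⟩ := hT k hk'
    obtain ⟨k1, k3⟩ := hk k hk'
    have ca := hC _ b0 _ b1 _ T0
    have cb := hC _ b0' _ b1 _ T0
    have cc := hC _ b0' _ b1' _ T0
    have f3 : C * (α * k) ^ (1 - h₂) ≤ C * δ := by gcongr
    have hTβ : (α * k) ^ β = (k : ℝ) ^ β * S := by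
      rw [Real.mul_rpow hα.le (by linarith), hS, mul_comm]
    have hq := hp3 _ T0
    rw [hTβ, ← mul_assoc p] at hq
    obtain ⟨x, y, e, hx, hy⟩ := exists_log_increment (H := θ 0) (H' := θ' 0) s0 s0' T0
      (ca.2.1.trans f3) cb.1 (cb.2.1.trans f3) cc.1 (cc.2.1.trans f3) (by linarith) hq
    refine ⟨x, y, ?_, ?_, ?_⟩
    · rw [(hvar θ hθ k hk').1, (hvar θ' hθ' k hk').1, e,
        Real.log_mul hα.ne' (by positivity)]
    · refine hx.trans ?_
      calc 2 * |defect (θ 0) (θ 1) (α * k) - defect (θ' 0) (θ 1) (α * k)|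
          ≤ 2 * (C * (α * k) ^ (1 - h₂) * |θ 0 - θ' 0|) := by
            gcongr
            exact ca.2.2 _ b0'
        _ ≤ 2 * (C * δ * |θ 0 - θ' 0|) := by gcongr
        _ = 2 * C * δ * |θ 0 - θ' 0| := by ring
        _ ≤ _ := by gcongr
    -- The factors `9` come from `k^β ≤ 3²`, and `18 = 2 · 9` from the quadratic error of the
    -- logarithm.
    · refine hy.trans ?_
      have hkb := hkβ k hk'
      have hr : E * (α * k) ^ h₁ * ((k : ℝ) ^ β * S) * |θ' 1 - θ 1| ≤
          E * δ * (9 * S) * |θ' 1 - θ 1| := by gcongr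
      have hr' : E * δ * (9 * S) * |θ' 1 - θ 1| ≤ E * 1 * (9 * S) * |θ' 1 - θ 1| := by gcongr
      have hqa : |p * (k : ℝ) ^ β * S| ≤ D * |θ' 1 - θ 1| * 9 * S := by
        rw [abs_mul, abs_mul, abs_of_pos hS0, abs_of_nonneg (by positivity : 0 ≤ (k : ℝ) ^ β)]
        gcongr
      calc _ ≤ 2 * (C * δ) * (D * |θ' 1 - θ 1| * 9 * S + E * 1 * (9 * S) * |θ' 1 - θ 1|) +
            E * δ * (9 * S) * |θ' 1 - θ 1| :=
            add_le_add (mul_le_mul le_rfl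
              (add_le_add hqa (hr.trans hr')) (by positivity) (by positivity)) hr
        _ = (9 * E * δ + 18 * C * (D + E) * δ) * (S * |θ' 1 - θ 1|) := by ring
        _ ≤ _ := by gcongr
  obtain ⟨x₁, y₁, e1, hx1, hy1⟩ := hdec 1 (by decide)
  obtain ⟨x₂, y₂, e2, hx2, hy2⟩ := hdec 2 (by decide)
  obtain ⟨x₃, y₃, e3, hx3, hy3⟩ := hdec 3 (by decide)
  have hlog : ∀ k ∈ Finset.Icc (1 : ℕ) 3,
      |Real.log (rho θ 0 - rho θ (α * k)) - Real.log (rho θ' 0 - rho θ' (α * k))| ≤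
        v⁻¹ * |(rho θ 0 - rho θ (α * k)) - (rho θ' 0 - rho θ' (α * k))| :=
    fun k hk' => abs_log_sub_log_le hv0 (hvar θ hθ k hk').2 (hvar θ' hθ' k hk').2
  obtain ⟨W, hW⟩ : ∃ W, W = ∑ k ∈ Finset.Icc (1 : ℕ) 3,
      |Real.log (rho θ 0 - rho θ (α * k)) - Real.log (rho θ' 0 - rho θ' (α * k))| := ⟨_, rfl⟩
  have hWle := Finset.sum_le_sum hlog
  rw [← hW, ← Finset.mul_sum] at hWle
  have hIcc : Finset.Icc (1 : ℕ) 3 = {1, 2, 3} := by decide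
  rw [hIcc, Finset.sum_insert (by decide), Finset.sum_insert (by decide), Finset.sum_singleton,
    ← add_assoc] at hW
  rw [Nat.cast_one, Real.one_rpow, mul_one p, Real.log_one, add_zero (Real.log α)] at e1
  rw [Nat.cast_ofNat] at e2 e3
  rw [Nat.cast_one, Nat.cast_ofNat, Nat.cast_ofNat] at hW
  obtain ⟨r1, r2, r3⟩ := linear_stability hd hκ hε1 hD hG hR hε2 hε3 hW (abs_nonneg _) hS0
    e1 e2 e3 hx1 hx2 hx3 hy1 hy2 hy3 hp1 hp2 (two_rpow_sub_one_bounds hβ0 hβ2)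
    (hκb β ⟨by linarith [b0'.2], by linarith [b0'.1]⟩)
  have hW0 : 0 ≤ W := by rw [hW]; positivity
  have q2 : |θ' 1 - θ 1| ≤ (α ^ 2)⁻¹ * (G * (6 + 12 * R)) * W := by
    rw [mul_assoc, inv_mul_eq_div, le_div_iff₀ (by positivity), mul_comm]
    exact le_trans (by gcongr) r2
  -- Exponentiate back, with Lipschitz constant `M₀² / 2`, and divide the difference of squares by
  -- `|σ + σ'| ≥ 2 m₀`.
  have q3 : |θ 2 - θ' 2| ≤ m₀⁻¹ * (M₀ ^ 2 / 2) *
      |Real.log (θ 2 ^ 2 / 2) - Real.log (θ' 2 ^ 2 / 2)| := by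
    have u := hσb _ (hmem2 θ hθ)
    have u' := hσb _ (hmem2 θ' hθ')
    have h := abs_exp_sub_exp_le (u := Real.log (θ 2 ^ 2 / 2)) (v := Real.log (θ' 2 ^ 2 / 2))
      (M := M₀ ^ 2 / 2) (by rw [Real.exp_log s0]; linarith [u.2.1])
      (by rw [Real.exp_log s0']; linarith [u'.2.1])
    rw [Real.exp_log s0, Real.exp_log s0', show θ 2 ^ 2 / 2 - θ' 2 ^ 2 / 2 =
      (θ 2 - θ' 2) * (θ 2 + θ' 2) / 2 by ring, abs_div, abs_mul, abs_two] at h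
    rw [mul_assoc, inv_mul_eq_div, le_div_iff₀ hm₀]
    refine le_trans ?_ h
    have := u.2.2 _ (hmem2 θ' hθ')
    have := mul_le_mul_of_nonneg_left this (abs_nonneg (θ 2 - θ' 2))
    linarith
  have hsum : ‖θ - θ'‖ ≤ K * W := by
    refine (norm_le_sum_abs _).trans ?_
    simp only [PiLp.sub_apply]
    rw [abs_sub_comm (θ 1)]
    have q4 : |Real.log (θ 2 ^ 2 / 2) - Real.log (θ' 2 ^ 2 / 2)| ≤
        (1 + (2 * |Real.log α| + 1) * (2 * R) + (D + 1) * (G * (6 + 12 * R))) * W := by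
      refine r3.trans ?_
      calc _ ≤ W + (2 * |Real.log α| + 1) * (2 * R * W) + (D + 1) * (G * (6 + 12 * R) * W) := by
            gcongr
        _ = _ := by ring
    have q5 := q3.trans (mul_le_mul_of_nonneg_left q4 (by positivity))
    rw [hK]
    linarith
  calc ‖θ - θ'‖ ≤ K * W := hsum
    _ ≤ K * (v⁻¹ * ∑ k ∈ Finset.Icc (1 : ℕ) 3,
          |(rho θ 0 - rho θ (α * k)) - (rho θ' 0 - rho θ' (α * k))|) := by gcongr
    _ = _ := by ring

/-! ### From the moment conditions to the estimation error -/

/-- As `B` kills constants, it factors through the `L` differences `x k - x 0`. Full rank makes the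
induced square map surjective, hence injective, and an injective linear map in finite dimension is
bounded below. -/
theorem exists_norm_le_mul_norm_of_rank {L : ℕ} {B : Matrix (Fin L) (Fin (L + 1)) ℝ}
    (hrank : B.rank = L) (hrow : ∀ ℓ, ∑ k, B ℓ k = 0) :
    ∃ C : ℝ, 0 ≤ C ∧ ∀ (x : Fin (L + 1) → ℝ) (k : Fin (L + 1)),
      |x 0 - x k| ≤ C * ‖B.mulVec x‖ := by
  set g : (Fin L → ℝ) →ₗ[ℝ] (Fin L → ℝ) := (B.submatrix id Fin.succ).mulVecLin with hg
  have hgx : ∀ x : Fin (L + 1) → ℝ, g (fun k => x k.succ - x 0) = B.mulVec x := by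
    intro x
    ext ℓ
    have h1 : ∑ k, B ℓ k * (x k - x 0) = ∑ k, B ℓ k * x k := by
      simp_rw [mul_sub]
      rw [Finset.sum_sub_distrib, ← Finset.sum_mul, hrow, zero_mul, sub_zero]
    rw [Fin.sum_univ_succ, sub_self, mul_zero, zero_add] at h1
    exact h1
  have hBsurj : Function.Surjective B.mulVec := by
    have : LinearMap.range B.mulVecLin = ⊤ := by
      apply Submodule.eq_top_of_finrank_eq
      rw [Module.finrank_fin_fun]
      exact hrank
    intro y
    obtain ⟨x, hx⟩ := LinearMap.range_eq_top.mp this y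
    exact ⟨x, hx⟩
  have hinj : Function.Injective g := by
    rw [LinearMap.injective_iff_surjective]
    intro y
    obtain ⟨x, hx⟩ := hBsurj y
    exact ⟨_, (hgx x).trans hx⟩
  obtain ⟨K, -, hK⟩ := g.exists_antilipschitzWith (LinearMap.ker_eq_bot.mpr hinj)
  refine ⟨K, K.2, fun x k => ?_⟩
  refine Fin.cases ?_ (fun k => ?_) k
  · simpa using mul_nonneg K.2 (norm_nonneg (B.mulVec x))
  · have h := hK.le_mul_dist (fun k => x k.succ - x 0) 0
    rw [map_zero, dist_zero_right, dist_zero_right, hgx] at h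
    rw [abs_sub_comm]
    exact (norm_le_pi_norm (fun k : Fin L => x k.succ - x 0) k).trans h

theorem exists_norm_sub_le_theoreticalVariance (lo hi : Param) (hH : 0 < lo 0 ∧ hi 0 < 1)
    (hlam : 0 < lo 1) (hσ : 0 < lo 2 ∨ hi 2 < 0) :
    ∃ α₀ : ℝ, 0 < α₀ ∧ ∀ α : ℝ, 0 < α → α < α₀ → ∀ (L : ℕ) (_ : 3 ≤ L)
      (a : Fin L → Fin (L + 1) → ℝ) (_ : ∀ ℓ, ∑ q, a ℓ q = 0) (_ : (matrixB a).rank = L),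
      ∃ C : ℝ, 0 ≤ C ∧ ∀ θ ∈ rectangle lo hi, ∀ θ' ∈ rectangle lo hi, ‖θ - θ'‖ ≤ C *
        ‖fun ℓ => theoreticalVariance (a ℓ) α θ - theoreticalVariance (a ℓ) α θ'‖ := by
  obtain ⟨α₀, hα₀, h⟩ := exists_norm_sub_le_variogram lo hi hH hlam hσ
  refine ⟨α₀, hα₀, fun α hα hαlt L hL a ha hB => ?_⟩
  obtain ⟨C, hC, hle⟩ := h α hα hαlt
  obtain ⟨C', hC', hle'⟩ := exists_norm_le_mul_norm_of_rank hB
    fun ℓ => sum_filterB_eq_zero (ha ℓ)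
  -- Each of the three lags costs one `C'`; they all occur among the lags up to `L` because `3 ≤ L`.
  refine ⟨C * (3 * C'), by positivity, fun θ hθ θ' hθ' => (hle θ hθ θ' hθ').trans ?_⟩
  have e : (matrixB a).mulVec (fun k : Fin (L + 1) =>
      rho θ (α * (k : ℕ)) - rho θ' (α * (k : ℕ))) =
      fun ℓ => theoreticalVariance (a ℓ) α θ - theoreticalVariance (a ℓ) α θ' := by
    ext ℓ
    simp only [Matrix.mulVec, dotProduct, matrixB, Matrix.of_apply, theoreticalVariance,
      ← Finset.sum_sub_distrib, mul_sub]
  rw [mul_assoc, ← e]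
  refine mul_le_mul_of_nonneg_left ?_ hC
  calc _ ≤ ∑ k ∈ Finset.Icc (1 : ℕ) 3, C' * ‖(matrixB a).mulVec (fun k : Fin (L + 1) =>
          rho θ (α * (k : ℕ)) - rho θ' (α * (k : ℕ)))‖ := by
        refine Finset.sum_le_sum fun k hk => ?_
        rw [Finset.mem_Icc] at hk
        have := hle' (fun k : Fin (L + 1) => rho θ (α * (k : ℕ)) - rho θ' (α * (k : ℕ)))
          ⟨k, by omega⟩
        simp only [Fin.val_zero, Nat.cast_zero, mul_zero] at this
        rwa [sub_sub_sub_comm]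
    _ = _ := by
        rw [Finset.sum_const, Nat.card_Icc, nsmul_eq_mul]
        norm_num
        ring

/-- By homogeneity and compactness of the unit sphere the quadratic form is comparable to the
squared norm. An empty sphere means that all vectors vanish. -/
theorem exists_norm_le_of_posDef {L : ℕ} {A : Matrix (Fin L) (Fin L) ℝ} (hA : A.PosDef) :
    ∃ C : ℝ, 0 ≤ C ∧ ∀ u v : Fin L → ℝ,
      u ⬝ᵥ A.mulVec u ≤ v ⬝ᵥ A.mulVec v → ‖u‖ ≤ C * ‖v‖ := by
  set q : (Fin L → ℝ) → ℝ := fun u => u ⬝ᵥ A.mulVec u with hq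
  have hcont : Continuous q := by
    simp only [hq]
    exact Continuous.dotProduct continuous_id (Continuous.matrix_mulVec continuous_const
      continuous_id)
  have hpos : ∀ u, u ≠ 0 → 0 < q u := fun u hu => by
    have := hA.dotProduct_mulVec_pos hu
    simpa using this
  have hhom : ∀ (r : ℝ) u, q (r • u) = r ^ 2 * q u := fun r u => by
    simp only [hq, Matrix.mulVec_smul, smul_dotProduct, dotProduct_smul, smul_eq_mul]
    ring
  have hsc : IsCompact (Metric.sphere (0 : Fin L → ℝ) 1) := isCompact_sphere _ _
  rcases (Metric.sphere (0 : Fin L → ℝ) 1).eq_empty_or_nonempty with he | hne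
  · refine ⟨0, le_rfl, fun u v _ => ?_⟩
    rw [zero_mul]
    by_contra! hu
    have : ‖u‖⁻¹ • u ∈ Metric.sphere (0 : Fin L → ℝ) 1 := by
      rw [mem_sphere_zero_iff_norm, norm_smul, norm_inv, norm_norm, inv_mul_cancel₀ hu.ne']
    rw [he] at this
    exact this
  obtain ⟨x, hx, hxm⟩ := hsc.exists_isMinOn hne hcont.continuousOn
  obtain ⟨y, hy, hym⟩ := hsc.exists_isMaxOn hne hcont.continuousOn
  have hx0 : 0 < q x := hpos x (by rintro rfl; simp at hx)
  have hy0 : 0 ≤ q y := hx0.le.trans (hym hx)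
  have hb : ∀ u, q x * ‖u‖ ^ 2 ≤ q u ∧ q u ≤ q y * ‖u‖ ^ 2 := by
    intro u
    rcases eq_or_ne u 0 with rfl | hu
    · simp [hq]
    have hu0 : ‖u‖ ≠ 0 := norm_ne_zero_iff.mpr hu
    have hs : ‖u‖⁻¹ • u ∈ Metric.sphere (0 : Fin L → ℝ) 1 := by
      rw [mem_sphere_zero_iff_norm, norm_smul, norm_inv, norm_norm, inv_mul_cancel₀ hu0]
    have e : q u = q (‖u‖⁻¹ • u) * ‖u‖ ^ 2 := by rw [hhom]; field_simp
    rw [e]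
    exact ⟨mul_le_mul_of_nonneg_right (hxm hs) (by positivity),
      mul_le_mul_of_nonneg_right (hym hs) (by positivity)⟩
  refine ⟨√(q y / q x), Real.sqrt_nonneg _, fun u v huv => ?_⟩
  refine abs_le_of_sq_le_sq' ?_ (by positivity) |>.2
  rw [mul_pow, Real.sq_sqrt (by positivity), div_mul_eq_mul_div, le_div_iff₀ hx0, mul_comm]
  exact (hb u).1.trans (huv.trans (hb v).2)

theorem gHat_sub_gHat {Ω : Type*} {L : ℕ} (X : ℝ → Ω → ℝ) (a : Fin L → Fin (L + 1) → ℝ) (α : ℝ)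
    {N : ℕ} (hN : L ≤ N) (θ θ' : Param) (ω : Ω) :
    gHat X a α N θ' ω - gHat X a α N θ ω =
      fun ℓ => theoreticalVariance (a ℓ) α θ - theoreticalVariance (a ℓ) α θ' := by
  ext ℓ
  have hN' : (L : ℝ) ≤ N := by exact_mod_cast hN
  have h0 : (N : ℝ) - L + 1 ≠ 0 := by linarith
  simp only [gHat, Pi.sub_apply]
  rw [← mul_sub, ← Finset.sum_sub_distrib]
  simp only [sub_sub_sub_cancel_left]
  rw [Finset.sum_const, Nat.card_Icc, nsmul_eq_mul, Nat.cast_sub (by omega), Nat.cast_add_one,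
    ← mul_assoc, show (N : ℝ) + 1 - L = N - L + 1 by ring, inv_mul_cancel₀ h0, one_mul]

theorem norm_sq_le_sum_sq {L : ℕ} (g : Fin L → ℝ) : ‖g‖ ^ 2 ≤ ∑ ℓ, g ℓ ^ 2 := by
  have h0 : 0 ≤ ∑ ℓ, g ℓ ^ 2 := Finset.sum_nonneg fun _ _ => sq_nonneg _
  refine (Real.le_sqrt (norm_nonneg _) h0).mp ?_
  refine (pi_norm_le_iff_of_nonneg (Real.sqrt_nonneg _)).mpr fun ℓ => ?_
  refine Real.le_sqrt_of_sq_le ?_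
  rw [Real.norm_eq_abs, sq_abs]
  exact Finset.single_le_sum (f := fun ℓ => g ℓ ^ 2) (fun _ _ => sq_nonneg _) (Finset.mem_univ ℓ)

theorem norm_le_sum_abs_pi {L : ℕ} (g : Fin L → ℝ) : ‖g‖ ≤ ∑ ℓ, |g ℓ| :=
  (pi_norm_le_iff_of_nonneg (Finset.sum_nonneg fun _ _ => abs_nonneg _)).mpr fun ℓ =>
    Finset.single_le_sum (f := fun ℓ => |g ℓ|) (fun _ _ => abs_nonneg _) (Finset.mem_univ ℓ)

/-- The estimation error is controlled by the moment conditions at the true parameter. -/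
theorem IsGMMEstimator.exists_norm_sub_le {Ω : Type*} [MeasurableSpace Ω] {μ : Measure Ω} {L : ℕ}
    {X : ℝ → Ω → ℝ} {a : Fin L → Fin (L + 1) → ℝ} {α : ℝ} {A : Matrix (Fin L) (Fin L) ℝ}
    (hA : A.PosDef) {Θ : Set Param} {C : ℝ} (hC : 0 ≤ C)
    (hid : ∀ θ ∈ Θ, ∀ θ' ∈ Θ, ‖θ - θ'‖ ≤ C *
      ‖fun ℓ => theoreticalVariance (a ℓ) α θ - theoreticalVariance (a ℓ) α θ'‖)
    {θ : Param} (hθ : θ ∈ Θ) {θhat : ℕ → Ω → Param} (hhat : IsGMMEstimator μ X a α A Θ θhat) :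
    ∃ K : ℝ, 0 ≤ K ∧ ∀ N ≥ L, ∀ᵐ ω ∂μ, ‖θhat N ω - θ‖ ≤ K * ‖gHat X a α N θ ω‖ := by
  obtain ⟨C', hC', hle⟩ := exists_norm_le_of_posDef hA
  refine ⟨C * (C' + 1), by positivity, fun N hN => ?_⟩
  filter_upwards [(hhat N hN).2] with ω hω
  have h1 := hle _ _ (hω.2 θ hθ)
  have h2 := hid θ hθ _ hω.1
  rw [← gHat_sub_gHat X a α hN θ (θhat N ω) ω] at h2
  rw [norm_sub_rev, mul_assoc]
  refine h2.trans (mul_le_mul_of_nonneg_left ((norm_sub_le _ _).trans ?_) hC)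
  linarith

theorem gHat_eq_sum_range {Ω : Type*} {L : ℕ} (X : ℝ → Ω → ℝ) (a : Fin L → Fin (L + 1) → ℝ)
    (α : ℝ) {N : ℕ} (hN : L ≤ N) (θ : Param) (ω : Ω) (ℓ : Fin L) :
    gHat X a α N θ ω ℓ = (((N + 1 - L : ℕ) : ℝ))⁻¹ * ∑ i ∈ Finset.range (N + 1 - L),
      (filtered X (a ℓ) α (α * (i + L : ℕ)) ω ^ 2 - theoreticalVariance (a ℓ) α θ) := by
  have e : Finset.Icc L N = Finset.Ico L (N + 1) := by
    ext i
    simp only [Finset.mem_Icc, Finset.mem_Ico]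
    omega
  rw [gHat, e, Finset.sum_Ico_eq_sum_range, Nat.cast_sub (by omega), Nat.cast_add_one,
    show (N : ℝ) + 1 - L = N - L + 1 by ring]
  simp only [add_comm L]

/-! ### Rates for the empirical moments -/

section Rates

variable {Ω : Type*} [MeasurableSpace Ω] {μ : Measure Ω} [IsProbabilityMeasure μ] {θ : Param}
  {X : ℝ → Ω → ℝ} {L : ℕ} {α : ℝ}

/-- The moment bound holds for every finite index set, so starting the observations at index `L` is
a mere translation. -/
theorem IsStationaryFOU.integral_shifted_sum_sq_le (hX : IsStationaryFOU μ θ X) (hH0 : 0 < θ 0)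
    (hH1 : θ 0 < 1) (hl : 0 < θ 1) {a : Fin (L + 1) → ℝ} (ha : ∑ q, a q = 0) (hα : 0 < α)
    (s : Finset ℕ) :
    Integrable (fun ω => (∑ i ∈ s, (filtered X a α (α * (i + L : ℕ)) ω ^ 2 -
      theoreticalVariance a α θ)) ^ 2) μ ∧
    ∫ ω, (∑ i ∈ s, (filtered X a α (α * (i + L : ℕ)) ω ^ 2 -
      theoreticalVariance a α θ)) ^ 2 ∂μ ≤ (2 * ∑' k : ℤ, filteredCov θ a α (α * k) ^ 2) * s.card := by
  have h := hX.integral_sum_sq_le hH0 hH1 hl ha hα (s.map (addRightEmbedding L))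
  simpa only [Finset.sum_map, Finset.card_map, addRightEmbedding_apply] using h

theorem IsStationaryFOU.integral_gHat_sq_le (hX : IsStationaryFOU μ θ X) (hH0 : 0 < θ 0)
    (hH1 : θ 0 < 1) (hl : 0 < θ 1) {a : Fin L → Fin (L + 1) → ℝ} (ha : ∀ ℓ, ∑ q, a ℓ q = 0)
    (hα : 0 < α) {N : ℕ} (hN : L ≤ N) (ℓ : Fin L) :
    Integrable (fun ω => gHat X a α N θ ω ℓ ^ 2) μ ∧
      ∫ ω, gHat X a α N θ ω ℓ ^ 2 ∂μ ≤
        (2 * ∑' k : ℤ, filteredCov θ (a ℓ) α (α * k) ^ 2) * ((N + 1 - L : ℕ) : ℝ)⁻¹ := by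
  obtain ⟨h1, h2⟩ := hX.integral_shifted_sum_sq_le hH0 hH1 hl (ha ℓ) hα (Finset.range (N + 1 - L))
  have h0 : (0 : ℝ) < ((N + 1 - L : ℕ) : ℝ) := by
    have : 0 < N + 1 - L := by omega
    exact_mod_cast this
  simp only [gHat_eq_sum_range X a α hN, mul_pow]
  refine ⟨h1.const_mul _, ?_⟩
  rw [integral_const_mul]
  rw [Finset.card_range] at h2
  refine (mul_le_mul_of_nonneg_left h2 (by positivity)).trans (le_of_eq ?_)
  field_simp

theorem IsStationaryFOU.ae_tendsto_norm_gHat (hX : IsStationaryFOU μ θ X) (hH0 : 0 < θ 0)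
    (hH1 : θ 0 < 1) (hl : 0 < θ 1) {a : Fin L → Fin (L + 1) → ℝ} (ha : ∀ ℓ, ∑ q, a ℓ q = 0)
    (hα : 0 < α) (hL : 0 < L) {γ : ℝ} (hγ : γ < 1 / 2) :
    ∀ᵐ ω ∂μ, Tendsto (fun N : ℕ => (N : ℝ) ^ γ * ‖gHat X a α N θ ω‖) atTop (𝓝 0) := by
  -- A nonnegative exponent is needed to pass from `N ≤ L n`, with `n` the number of terms, to `N^γ
  -- ≤ L^γ' n^γ'`.
  set γ' := max γ 0 with hγ'
  have h : ∀ᵐ ω ∂μ, ∀ ℓ, Tendsto (fun n : ℕ => (n : ℝ) ^ (γ' - 1) * |∑ i ∈ Finset.range n,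
      (filtered X (a ℓ) α (α * (i + L : ℕ)) ω ^ 2 - theoreticalVariance (a ℓ) α θ)|)
      atTop (𝓝 0) := by
    rw [ae_all_iff]
    intro ℓ
    have hb := hX.integral_shifted_sum_sq_le hH0 hH1 hl (ha ℓ) hα
    exact ae_tendsto_rpow_mul_sum (fun s => (hb s).1) (fun s => (hb s).2)
      (max_lt hγ (by norm_num))
  filter_upwards [h] with ω hω
  have hshift : Tendsto (fun N : ℕ => N + 1 - L) atTop atTop :=
    (tendsto_sub_atTop_nat L).comp (tendsto_add_atTop_nat 1)
  have hlim : Tendsto (fun N : ℕ => (L : ℝ) ^ γ' * ∑ ℓ, ((N + 1 - L : ℕ) : ℝ) ^ (γ' - 1) *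
      |∑ i ∈ Finset.range (N + 1 - L), (filtered X (a ℓ) α (α * (i + L : ℕ)) ω ^ 2 -
        theoreticalVariance (a ℓ) α θ)|) atTop (𝓝 0) := by
    have := (tendsto_finsetSum Finset.univ fun ℓ _ => (hω ℓ).comp hshift).const_mul
      ((L : ℝ) ^ γ')
    simpa using this
  refine squeeze_zero' (Eventually.of_forall fun N => by positivity) ?_ hlim
  filter_upwards [eventually_ge_atTop L] with N hN
  set n := N + 1 - L with hn
  have hn0 : (0 : ℝ) < n := by
    have : 0 < n := by omega
    exact_mod_cast this
  have hN1 : (1 : ℝ) ≤ N := by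
    have : 1 ≤ N := by omega
    exact_mod_cast this
  have hNn : (N : ℝ) ≤ L * n := by
    have : N ≤ L * n := by
      obtain ⟨j, rfl⟩ := Nat.exists_eq_add_of_le hN
      have : n = j + 1 := by omega
      rw [this]
      nlinarith
    exact_mod_cast this
  have hpow : (N : ℝ) ^ γ ≤ (L : ℝ) ^ γ' * (n : ℝ) ^ γ' := by
    rw [← Real.mul_rpow (by positivity) hn0.le]
    calc (N : ℝ) ^ γ ≤ (N : ℝ) ^ γ' := Real.rpow_le_rpow_of_exponent_le hN1 (le_max_left _ _)
      _ ≤ _ := Real.rpow_le_rpow (by positivity) hNn (le_max_right _ _)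
  calc (N : ℝ) ^ γ * ‖gHat X a α N θ ω‖
      ≤ ((L : ℝ) ^ γ' * (n : ℝ) ^ γ') * ∑ ℓ, |gHat X a α N θ ω ℓ| := by
        gcongr
        exact norm_le_sum_abs_pi _
    _ = _ := by
        rw [mul_assoc, Finset.mul_sum]
        congr 1
        refine Finset.sum_congr rfl fun ℓ _ => ?_
        rw [gHat_eq_sum_range X a α hN, abs_mul, abs_of_pos (inv_pos.mpr hn0),
          Real.rpow_sub_one hn0.ne']
        ring

end Rates

end FOU

/-! ### Conclusion: the two rates of the estimator -/

theorem proposition3p1 (lo hi : FOU.Param)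
    (hH : 0 < lo 0 ∧ hi 0 < 1)
    (hlam : 0 < lo 1 ∧ hi 1 < Real.exp (FOU.digamma 3))
    (hσ : 0 < lo 2 ∨ hi 2 < 0) :
    ∃ α₀ : ℝ, 0 < α₀ ∧ ∀ α : ℝ, 0 < α → α < α₀ →
      ∀ (L : ℕ) (_ : 3 ≤ L) (a : Fin L → Fin (L + 1) → ℝ) (l : Fin L → ℕ)
        (_ : ∀ ℓ, 1 ≤ l ℓ) (_ : ∀ ℓ, FOU.IsFilter (a ℓ) (l ℓ)) (_ : (FOU.matrixB a).rank = L)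
        (A : Matrix (Fin L) (Fin L) ℝ) (_ : A.PosDef)
        (θ : FOU.Param) (_ : θ ∈ FOU.rectangle lo hi)
        (Ω : Type*) [MeasurableSpace Ω] (μ : Measure Ω) [IsProbabilityMeasure μ]
        (X : ℝ → Ω → ℝ) (_ : FOU.IsStationaryFOU μ θ X)
        (θhat : ℕ → Ω → FOU.Param)
        (_ : FOU.IsGMMEstimator μ X a α A (FOU.rectangle lo hi) θhat),
        ((∀ N ≥ L, Integrable (fun ω => ‖θhat N ω - θ‖ ^ 2) μ) ∧
          (fun N : ℕ => ∫ ω, ‖θhat N ω - θ‖ ^ 2 ∂μ) =O[atTop] fun N : ℕ => ((N : ℝ))⁻¹) ∧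
        ∀ γ : ℝ, γ < 1 / 2 →
          ∀ᵐ ω ∂μ, Tendsto (fun N : ℕ => (N : ℝ) ^ γ * ‖θhat N ω - θ‖) atTop (𝓝 0) := by
  obtain ⟨α₀, hα₀, hid⟩ := FOU.exists_norm_sub_le_theoreticalVariance lo hi hH hlam.1 hσ
  refine ⟨α₀, hα₀, fun α hα hαlt L hL a l hl hfil hB A hA θ hθ Ω _ μ _ X hX θhat hhat => ?_⟩
  have ha : ∀ ℓ, ∑ q, a ℓ q = 0 := fun ℓ => (hfil ℓ).sum_eq_zero (hl ℓ)
  have hH0 : 0 < θ 0 := hH.1.trans_le (hθ 0).1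
  have hH1 : θ 0 < 1 := (hθ 0).2.trans_lt hH.2
  have hl1 : 0 < θ 1 := hlam.1.trans_le (hθ 1).1
  obtain ⟨C, hC, hle⟩ := hid α hα hαlt L hL a ha hB
  obtain ⟨K, hK, herr⟩ := FOU.IsGMMEstimator.exists_norm_sub_le hA hC hle hθ hhat
  have hsq : ∀ N ≥ L, ∀ᵐ ω ∂μ, ‖θhat N ω - θ‖ ^ 2 ≤
      K ^ 2 * ∑ ℓ, FOU.gHat X a α N θ ω ℓ ^ 2 := by
    intro N hN
    filter_upwards [herr N hN] with ω hω
    calc ‖θhat N ω - θ‖ ^ 2 ≤ (K * ‖FOU.gHat X a α N θ ω‖) ^ 2 := by gcongr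
      _ = K ^ 2 * ‖FOU.gHat X a α N θ ω‖ ^ 2 := mul_pow _ _ _
      _ ≤ _ := by
          gcongr
          exact FOU.norm_sq_le_sum_sq _
  have hg := fun (N : ℕ) (hN : N ≥ L) => hX.integral_gHat_sq_le hH0 hH1 hl1 ha hα hN
  have hgint : ∀ N ≥ L, Integrable (fun ω => K ^ 2 * ∑ ℓ, FOU.gHat X a α N θ ω ℓ ^ 2) μ :=
    fun N hN => (integrable_finsetSum _ fun ℓ _ => (hg N hN ℓ).1).const_mul _
  have hint : ∀ N ≥ L, Integrable (fun ω => ‖θhat N ω - θ‖ ^ 2) μ := by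
    intro N hN
    refine (hgint N hN).mono' ?_ ?_
    · exact (((hhat N hN).1.sub_const θ).norm.pow_const 2).aestronglyMeasurable
    · filter_upwards [hsq N hN] with ω hω
      rwa [Real.norm_of_nonneg (by positivity)]
  refine ⟨⟨hint, ?_⟩, fun γ hγ => ?_⟩
  · set V := ∑ ℓ, 2 * ∑' k : ℤ, FOU.filteredCov θ (a ℓ) α (α * k) ^ 2 with hV
    have hV0 : 0 ≤ V := Finset.sum_nonneg fun ℓ _ =>
      mul_nonneg zero_le_two (tsum_nonneg fun k => sq_nonneg _)
    refine Asymptotics.IsBigO.of_bound (K ^ 2 * V * L) ?_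
    filter_upwards [eventually_ge_atTop L] with N hN
    have hN0 : (0 : ℝ) < N := by
      have : 0 < N := by omega
      exact_mod_cast this
    have hn0 : (0 : ℝ) < ((N + 1 - L : ℕ) : ℝ) := by
      have : 0 < N + 1 - L := by omega
      exact_mod_cast this
    -- With `N = L + j` the number of terms is `j + 1`, and `L + j ≤ L (j + 1)`; so the number of
    -- terms can be replaced by `N` at the price of a factor `L`.
    have hNn : (N : ℝ) ≤ L * ((N + 1 - L : ℕ) : ℝ) := by
      have : N ≤ L * (N + 1 - L) := by
        obtain ⟨j, rfl⟩ := Nat.exists_eq_add_of_le hN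
        rw [show L + j + 1 - L = j + 1 by omega]
        nlinarith
      exact_mod_cast this
    rw [Real.norm_of_nonneg (integral_nonneg fun ω => by positivity),
      Real.norm_of_nonneg (by positivity)]
    calc ∫ ω, ‖θhat N ω - θ‖ ^ 2 ∂μ
        ≤ ∫ ω, K ^ 2 * ∑ ℓ, FOU.gHat X a α N θ ω ℓ ^ 2 ∂μ :=
          integral_mono_ae (hint N hN) (hgint N hN) (hsq N hN)
      _ = K ^ 2 * ∑ ℓ, ∫ ω, FOU.gHat X a α N θ ω ℓ ^ 2 ∂μ := by
          rw [integral_const_mul, integral_finsetSum _ fun ℓ _ => (hg N hN ℓ).1]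
      _ ≤ K ^ 2 * ∑ ℓ, (2 * ∑' k : ℤ, FOU.filteredCov θ (a ℓ) α (α * k) ^ 2) *
          ((N + 1 - L : ℕ) : ℝ)⁻¹ := by
          gcongr with ℓ _
          exact (hg N hN ℓ).2
      _ = K ^ 2 * V * ((N + 1 - L : ℕ) : ℝ)⁻¹ := by rw [← Finset.sum_mul, ← hV, mul_assoc]
      _ ≤ K ^ 2 * V * (L * (N : ℝ)⁻¹) := by
          refine mul_le_mul_of_nonneg_left ?_ (by positivity)
          rw [← div_eq_mul_inv, inv_eq_one_div, div_le_div_iff₀ hn0 hN0, one_mul]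
          exact hNn
      _ = K ^ 2 * V * L * (N : ℝ)⁻¹ := by ring
  · have hall : ∀ᵐ ω ∂μ, ∀ N, N ≥ L → ‖θhat N ω - θ‖ ≤ K * ‖FOU.gHat X a α N θ ω‖ := by
      rw [ae_all_iff]
      intro N
      by_cases hN : N ≥ L
      · filter_upwards [herr N hN] with ω hω _ using hω
      · exact Eventually.of_forall fun ω h => absurd h hN
    filter_upwards [hall, hX.ae_tendsto_norm_gHat hH0 hH1 hl1 ha hα (by omega) hγ] with ω h1 h2
    have h3 := h2.const_mul K
    rw [mul_zero] at h3
    refine squeeze_zero' (Eventually.of_forall fun N => by positivity) ?_ h3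
    filter_upwards [eventually_ge_atTop L] with N hN
    calc (N : ℝ) ^ γ * ‖θhat N ω - θ‖ ≤ (N : ℝ) ^ γ * (K * ‖FOU.gHat X a α N θ ω‖) := by
          gcongr
          exact h1 N hN
      _ = _ := by ring
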